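/- **Notation.** Vectors $\underline x\in\mathbb R^2$ are columns. $G_2=\{[\underline x,A]:\underline x\in\mathbb R^2,\ A\in \mathrm{GL}_2(\mathbb R)\}$ is the group of invertible affine maps $[\underline x,A]:\underline z\mapsto \underline x+A\underline z$. Put $$K_0=\left\{\begin{pmatrix}s&-t\\t&s\end{pmatrix}:s^2+t^2>0\right\},\qquad H_{(1,0)}=\{C\in\mathrm{GL}_2(\mathbb R):(1,0)C=(1,0)\}=\left\{\begin{pmatrix}1&0\\u&v\end{pmatrix}:v\neq0\right\}.$$ Every $A\in\mathrm{GL}_2(\mathbb R)$ factors uniquely as $A=M_AC_A$ with $M_A\in K_0$, $C_A\in H_{(1,0)}$. The subgroup $K=\{[\underline 0,M]:M\in K_0\}$ of $G_2$ is identified with $K_0$. The left Haar measures used are: $\frac{dt}{|t|}$ on $\mathbb R^*=\mathbb R\setminus\{0\}$; $\frac{dw\,dx\,dy\,dz}{(wz-xy)^2}$ on $\mathrm{GL}_2(\mathbb R)\ni\begin{pmatrix}w&x\\y&z\end{pmatrix}$; $\frac{du\,dv}{v^2}$ on $H_{(1,0)}$; and on $K$ the measure $\frac{d\underline\omega}{\|\underline\omega\|^2}$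 in the coordinate $\underline\omega=(1,0)L^{-1}\in\mathbb R^2\setminus\{0\}$ of $L\in K_0$. $L^2(\mathcal O_1)$ is the $L^2$-space of $\mathcal O_1=\mathbb R\setminus\{0\}$ with Lebesgue measure. Inner products are linear in the first variable. *Representations (homomorphisms into unitary groups).* - $\pi^1$ of $H_{(1,0)}$ on $L^2(\mathbb R^*)$: $\ (\pi^1(C)f)(b)=e^{2\pi i u/b}f(v^{-1}b)$ for $C=\begin{pmatrix}1&0\\u&v\end{pmatrix}$. - $\pi^{(1,0)}$ of $G_2$ on $L^2(\mathrm{GL}_2(\mathbb R))$: $\ (\pi^{(1,0)}[\underline x,A]f)(B)=e^{2\pi i(1,0)B^{-1}\underline x}f(A^{-1}B)$. - $\sigma$ of $G_2$ on $L^2(K,L^2(\mathbb R^*))$: $\ (\sigma[\underline x,A]F)(L)=|\det C_{A^{-1}L}|^{-1/2}e^{2\pi i(1,0)L^{-1}\underline x}\,\pi^1(C_{A^{-1}L}^{-1})F(M_{A^{-1}L})$. *Subspaces.* For $g\in L^2(\mathbb R^*)$ with $\int_{\mathbb R}|g(t)|^2dt=1$ let $V_gf(D)=\langle f,\pi^1(D)g\rangle$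 for $f\in L^2(\mathbb R^*)$, $D\in H_{(1,0)}$, and $\mathcal K_g=V_gL^2(\mathbb R^*)\subseteq L^2(H_{(1,0)})$. Let $W_1:L^2(\mathrm{GL}_2(\mathbb R))\to L^2(K,L^2(H_{(1,0)}))$ be the map $(W_1f(L))(C)=|\det C|^{1/2}f(LC)$, and let $\mathcal H_g=W_1^{-1}L^2(K,\mathcal K_g)$, the set of $f$ such that $W_1f(L)\in\mathcal K_g$ for almost every $L\in K$. **Proposition.** Let $\{g_j:j\in J\}\subseteq L^2(\mathcal O_1)\cap L^2(\mathbb R^*)$ be an orthonormal basis of $L^2(\mathcal O_1)$. Then each $\mathcal H_{g_j}$ is a closed $\pi^{(1,0)}$-invariant subspace of $L^2(\mathrm{GL}_2(\mathbb R))$, and the restriction of $\pi^{(1,0)}$ to $\mathcal H_{g_j}$ is unitarily equivalent to $\sigma$. Moreover $L^2(\mathrm{GL}_2(\mathbb R))$ is the orthogonal (Hilbert space) direct sum $\sum^{\oplus}_{j\in J}\mathcal H_{g_j}$. -/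

import Mathlib

noncomputable section

namespace AffPlane

open MeasureTheory Set
open scoped ENNReal Matrix

section General
variable {X V E : Type*} [MeasurableSpace X] [MeasurableSpace V]

theorem measurableEmbedding_of_comap {c : X → V} (h : ‹MeasurableSpace X› = .comap c ‹_›)
    (hi : Function.Injective c) (hr : MeasurableSet (range c)) : MeasurableEmbedding c where
  injective := hi
  measurable := by rw [h]; exact comap_measurable c
  measurableSet_image' := by
    intro s hs
    rw [h] at hs
    obtain ⟨t, ht, rfl⟩ := hs
    rw [image_preimage_eq_inter_range]
    exact ht.inter hr

theorem map_comap_eq {c : X → V} (hc : MeasurableEmbedding c) {ν : Measure V} {φ : X → X}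
    {T : V → V} (hφ : Measurable φ) (hT : Measurable T) (hcomm : ∀ x, c (φ x) = T (c x))
    (hR : T ⁻¹' range c = range c) {κ : ℝ≥0∞} (hv : ν.map T = κ • ν) :
    (ν.comap c).map φ = κ • ν.comap c := by
  have h1 : ((ν.comap c).map φ).map c = (κ • ν.comap c).map c := by
    rw [Measure.map_map hc.measurable hφ]
    have : c ∘ φ = T ∘ c := funext hcomm
    rw [this, ← Measure.map_map hT hc.measurable, Measure.map_smul, hc.map_comap]
    rw [← Measure.restrict_smul, ← hv, Measure.restrict_map hT hc.measurableSet_range, hR]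
  rw [← hc.comap_map ((ν.comap c).map φ), h1, hc.comap_map]

theorem lintegral_twist {μ : Measure X} {φ : X → X} (hφ : Measurable φ) {κ : ℝ≥0∞}
    (h0 : κ ≠ 0) (ht : κ ≠ ∞) (hm : μ.map φ = κ • μ) {ρ : X → ℝ≥0∞} (hρ : Measurable ρ)
    {w : X → ℝ≥0∞} (hw : Measurable w) (hrel : ∀ x, ρ x * w x * κ = ρ (φ x))
    (f : X → ℝ≥0∞) (hf : AEMeasurable f (μ.withDensity ρ)) :
    ∫⁻ x, w x * f (φ x) ∂(μ.withDensity ρ) = ∫⁻ x, f x ∂(μ.withDensity ρ) := by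
  have key : ∀ g : X → ℝ≥0∞, Measurable g →
      ∫⁻ x, w x * g (φ x) ∂(μ.withDensity ρ) = ∫⁻ x, g x ∂(μ.withDensity ρ) := by
    intro g hg
    have hwg : Measurable fun x => w x * g (φ x) := hw.mul (hg.comp hφ)
    rw [lintegral_withDensity_eq_lintegral_mul _ hρ hwg,
      lintegral_withDensity_eq_lintegral_mul _ hρ hg]
    have e1 : ∫⁻ x, (ρ * g) x ∂(μ.map φ) = κ * ∫⁻ x, (ρ * g) x ∂μ := by
      rw [hm, lintegral_smul_measure]; rfl
    rw [lintegral_map (hρ.mul hg) hφ] at e1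
    have e2 : ∀ x, (ρ * g) (φ x) = κ * (ρ x * (w x * g (φ x))) := by
      intro x
      simp only [Pi.mul_apply]
      rw [← hrel x]; ring
    simp_rw [e2] at e1
    rw [lintegral_const_mul κ (f := fun x => ρ x * (w x * g (φ x))) (hρ.mul hwg)] at e1
    exact (ENNReal.mul_right_inj h0 ht).1 e1
  have hq : ∀ s, (μ.withDensity ρ) s = 0 → MeasurableSet s →
      ∀ᵐ x ∂(μ.withDensity ρ), w x * s.indicator 1 (φ x) = 0 := by
    intro s hs hms
    have := key (s.indicator 1) (measurable_one.indicator hms)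
    rw [lintegral_indicator_one hms, hs] at this
    exact (lintegral_eq_zero_iff (hw.mul ((measurable_one.indicator hms).comp hφ))).1 this
  rw [lintegral_congr_ae hf.ae_eq_mk, ← key _ hf.measurable_mk]
  apply lintegral_congr_ae
  have hn := ae_iff.1 hf.ae_eq_mk
  have := hq _ ((measure_toMeasurable _).trans hn) (measurableSet_toMeasurable _ _)
  filter_upwards [this] with x hx
  rcases mul_eq_zero.1 hx with h | h
  · simp [h]
  · congr 1
    by_contra hne
    have hmem : φ x ∈ toMeasurable (μ.withDensity ρ) {a | ¬f a = hf.mk f a} :=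
      subset_toMeasurable _ _ hne
    simp [indicator_of_mem hmem] at h

theorem eLpNorm_two {E : Type*} [NormedAddCommGroup E] (μ : Measure X) (f : X → E) :
    eLpNorm f 2 μ = (∫⁻ x, ‖f x‖ₑ ^ 2 ∂μ) ^ (1 / 2 : ℝ) := by
  rw [eLpNorm_eq_lintegral_rpow_enorm_toReal (by norm_num) (by norm_num)]
  simp

variable [NormedAddCommGroup E] [InnerProductSpace ℂ E]

theorem eLpNorm_twist {μ : Measure X} {φ : X → X} {w : X → ℂ} {U : X → E →ₗᵢ[ℂ] E}
    (hi : ∀ f : X → ℝ≥0∞, AEMeasurable f μ → ∫⁻ x, ‖w x‖ₑ ^ 2 * f (φ x) ∂μ = ∫⁻ x, f x ∂μ)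
    (F : X → E) (hF : AEStronglyMeasurable F μ) :
    eLpNorm (fun x => w x • U x (F (φ x))) 2 μ = eLpNorm F 2 μ := by
  rw [eLpNorm_two, eLpNorm_two, ← hi (fun x => ‖F x‖ₑ ^ 2) (hF.enorm.pow_const 2)]
  congr 2
  ext x
  rw [enorm_smul, mul_pow, LinearIsometry.enorm_map]

theorem memLp_twist {μ : Measure X} {φ : X → X} {w : X → ℂ} {U : X → E →ₗᵢ[ℂ] E}
    (hm : ∀ F : X → E, AEStronglyMeasurable F μ →
      AEStronglyMeasurable (fun x => w x • U x (F (φ x))) μ)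
    (hi : ∀ f : X → ℝ≥0∞, AEMeasurable f μ →
      ∫⁻ x, ‖w x‖ₑ ^ 2 * f (φ x) ∂μ = ∫⁻ x, f x ∂μ) (F : Lp E 2 μ) :
    MemLp (fun x => w x • U x (F (φ x))) 2 μ :=
  ⟨hm F (Lp.aestronglyMeasurable F), by
    rw [eLpNorm_twist hi _ (Lp.aestronglyMeasurable F)]; exact Lp.eLpNorm_lt_top F⟩

/-- The isometry `(T F) x = w x • U x (F (φ x))` of `L²(X, E)`, where `U x` is isometric and
`|w|²` compensates the change of measure under `φ`. -/
def twist (μ : Measure X) (φ : X → X) (w : X → ℂ) (U : X → E →ₗᵢ[ℂ] E)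
    (hφ : Measure.QuasiMeasurePreserving φ μ μ)
    (hm : ∀ F : X → E, AEStronglyMeasurable F μ →
      AEStronglyMeasurable (fun x => w x • U x (F (φ x))) μ)
    (hi : ∀ f : X → ℝ≥0∞, AEMeasurable f μ →
      ∫⁻ x, ‖w x‖ₑ ^ 2 * f (φ x) ∂μ = ∫⁻ x, f x ∂μ) :
    Lp E 2 μ →ₗᵢ[ℂ] Lp E 2 μ where
  toFun F := (memLp_twist hm hi F).toLp
  map_add' F F' := by
    rw [← MemLp.toLp_add, MemLp.toLp_eq_toLp_iff]
    filter_upwards [hφ.ae (Lp.coeFn_add F F')] with x hx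
    rw [hx]; simp
  map_smul' c F := by
    rw [RingHom.id_apply, ← MemLp.toLp_const_smul, MemLp.toLp_eq_toLp_iff]
    filter_upwards [hφ.ae (Lp.coeFn_smul c F)] with x hx
    rw [hx]; simp [smul_comm c]
  norm_map' F := by
    simp only [LinearMap.coe_mk, AddHom.coe_mk]
    rw [Lp.norm_toLp, eLpNorm_twist hi _ (Lp.aestronglyMeasurable F)]
    rfl

theorem coeFn_twist {μ : Measure X} {φ : X → X} {w : X → ℂ} {U : X → E →ₗᵢ[ℂ] E}
    (hφ : Measure.QuasiMeasurePreserving φ μ μ)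
    (hm : ∀ F : X → E, AEStronglyMeasurable F μ →
      AEStronglyMeasurable (fun x => w x • U x (F (φ x))) μ)
    (hi : ∀ f : X → ℝ≥0∞, AEMeasurable f μ →
      ∫⁻ x, ‖w x‖ₑ ^ 2 * f (φ x) ∂μ = ∫⁻ x, f x ∂μ) (F : Lp E 2 μ) :
    twist μ φ w U hφ hm hi F =ᵐ[μ] fun x => w x • U x (F (φ x)) :=
  (memLp_twist hm hi F).coeFn_toLp

theorem quasi_twist {μ : Measure X} {φ : X → X} (hφ : Measurable φ) {w : X → ℝ≥0∞}
    (hw : Measurable w) (hw0 : ∀ x, w x ≠ 0)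
    (hi : ∀ f : X → ℝ≥0∞, AEMeasurable f μ → ∫⁻ x, w x * f (φ x) ∂μ = ∫⁻ x, f x ∂μ) :
    Measure.QuasiMeasurePreserving φ μ μ := by
  refine ⟨hφ, Measure.AbsolutelyContinuous.mk fun s hs h => ?_⟩
  have := hi (s.indicator 1) (measurable_one.indicator hs).aemeasurable
  have hws : Measurable fun x => w x * s.indicator (1 : X → ℝ≥0∞) (φ x) :=
    hw.mul ((measurable_one.indicator hs).comp hφ)
  rw [lintegral_indicator_one hs, h,
    lintegral_eq_zero_iff hws] at this
  rw [Measure.map_apply hφ hs, ← nonpos_iff_eq_zero, ← (ae_iff.1 this)]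
  refine measure_mono fun x hx => ?_
  have hx' : φ x ∈ s := hx
  simp [hw0 x, hx']

end General

/-- A homomorphism from a group into the linear isometries of `H` takes unitary values. -/
def unitaryRep {G H : Type*} [Group G] [NormedAddCommGroup H] [InnerProductSpace ℂ H]
    (T : G → H →ₗᵢ[ℂ] H) (h1 : ∀ v, T 1 v = v) (hmul : ∀ a b v, T (a * b) v = T a (T b v)) :
    G →* (H ≃ₗᵢ[ℂ] H) where
  toFun a :=
    { toLinearEquiv := LinearEquiv.ofLinearMap (T a).toLinearMap (T a⁻¹).toLinearMap
        (by ext v; simp [← hmul, h1]) (by ext v; simp [← hmul, h1])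
      norm_map' := fun v => (T a).norm_map v }
  map_one' := by ext v; exact h1 v
  map_mul' a b := by ext v; exact hmul a b v


/-! ### The groups -/

/-- Through this, `GL₂(ℝ)` and its subgroups carry the σ-algebra generated by the matrix entries,
which is the Borel σ-algebra. -/
instance : MeasurableSpace (Matrix (Fin 2) (Fin 2) ℝ) := MeasurableSpace.pi

/-- The group `GL₂(ℝ)`. -/
abbrev GL2 := GL (Fin 2) ℝ

/-- The group `G₂` of invertible affine transformations `[x, A] : z ↦ x + A z` of the plane,
with `x = trans` and `A = lin`. -/
@[ext] structure Aff2 where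
  trans : Fin 2 → ℝ
  lin : GL2

namespace Aff2

instance : Mul Aff2 := ⟨fun g h => ⟨g.trans + (g.lin : Matrix (Fin 2) (Fin 2) ℝ) *ᵥ h.trans, g.lin * h.lin⟩⟩
instance : One Aff2 := ⟨⟨0, 1⟩⟩
instance : Inv Aff2 :=
  ⟨fun g => ⟨-(((g.lin⁻¹ : GL2) : Matrix (Fin 2) (Fin 2) ℝ) *ᵥ g.trans), g.lin⁻¹⟩⟩

theorem mul_trans (g h : Aff2) :
    (g * h).trans = g.trans + (g.lin : Matrix (Fin 2) (Fin 2) ℝ) *ᵥ h.trans := rfl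
theorem mul_lin (g h : Aff2) : (g * h).lin = g.lin * h.lin := rfl
theorem one_trans : (1 : Aff2).trans = 0 := rfl
theorem one_lin : (1 : Aff2).lin = 1 := rfl
theorem inv_trans (g : Aff2) :
    (g⁻¹).trans = -(((g.lin⁻¹ : GL2) : Matrix (Fin 2) (Fin 2) ℝ) *ᵥ g.trans) := rfl
theorem inv_lin (g : Aff2) : (g⁻¹).lin = g.lin⁻¹ := rfl

instance : Group Aff2 :=
  Group.ofLeftAxioms
    (by
      intro a b c
      ext1
      · rw [mul_trans, mul_trans, mul_trans, mul_trans, mul_lin, Matrix.mulVec_add,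
          Matrix.mulVec_mulVec, Matrix.GeneralLinearGroup.coe_mul, add_assoc]
      · simp [mul_lin, mul_assoc])
    (by intro a; ext1 <;> simp [mul_trans, mul_lin, one_trans, one_lin])
    (by intro a; ext1 <;> simp [mul_trans, mul_lin, one_trans, one_lin, inv_trans, inv_lin])

end Aff2

/-- The stabiliser `{A : (1,0) A = (1,0)}`, that is, the matrices `(1 0; u v)` with `v ≠ 0`. -/
def H10 : Subgroup GL2 where
  carrier := {A | ![1, 0] ᵥ* (A : Matrix (Fin 2) (Fin 2) ℝ) = ![1, 0]}
  one_mem' := by simp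
  mul_mem' {A B} hA hB := by
    simp only [mem_ofPred_eq] at *
    rw [Matrix.GeneralLinearGroup.coe_mul, ← Matrix.vecMul_vecMul, hA, hB]
  inv_mem' {A} hA := by
    simp only [mem_ofPred_eq] at *
    conv_lhs => rw [← hA]
    rw [Matrix.vecMul_vecMul, ← Matrix.GeneralLinearGroup.coe_mul, mul_inv_cancel]
    simp

theorem mem_H10 {A : GL2} : A ∈ H10 ↔ A 0 0 = 1 ∧ A 0 1 = 0 := by
  change ![1, 0] ᵥ* (A : Matrix (Fin 2) (Fin 2) ℝ) = ![1, 0] ↔ _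
  rw [funext_iff]
  simp [Matrix.vecMul, dotProduct, Fin.forall_fin_two, Fin.sum_univ_two]

/-- The group `K₀` of matrices `(s -t; t s)` with `s² + t² > 0`. The subgroup
`K = {[0, M] : M ∈ K₀}` of `G₂` is identified with `K₀` through `[0, M] ↦ M`. -/
def K0 : Subgroup GL2 where
  carrier := {A | A 1 1 = A 0 0 ∧ A 0 1 = -A 1 0}
  one_mem' := by simp
  mul_mem' {A B} hA hB := by
    simp only [mem_ofPred_eq] at *
    simp only [Matrix.GeneralLinearGroup.coe_mul, Matrix.mul_apply, Fin.sum_univ_two, hA.1, hA.2,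
      hB.1, hB.2]
    constructor <;> ring
  inv_mem' {A} hA := by
    simp only [mem_ofPred_eq] at *
    simp [Matrix.coe_units_inv, Matrix.inv_def, Matrix.adjugate_fin_two, hA.1, hA.2]

theorem mem_K0 {A : GL2} : A ∈ K0 ↔ A 1 1 = A 0 0 ∧ A 0 1 = -A 1 0 := Iff.rfl

theorem det_ne (A : GL2) : (A : Matrix (Fin 2) (Fin 2) ℝ).det ≠ 0 := A.det.ne_zero

theorem col_ne (A : GL2) : A 0 1 ^ 2 + A 1 1 ^ 2 ≠ 0 := by
  intro h
  have h1 : A 0 1 = 0 := by nlinarith [sq_nonneg (A 0 1), sq_nonneg (A 1 1)]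
  have h2 : A 1 1 = 0 := by nlinarith [sq_nonneg (A 0 1), sq_nonneg (A 1 1)]
  apply det_ne A
  rw [Matrix.det_fin_two, h1, h2]; ring

/-- The factor `M_A ∈ K₀` in the factorisation `A = M_A C_A`. -/
def facK (A : GL2) : K0 :=
  ⟨Matrix.GeneralLinearGroup.mkOfDetNeZero
    ((((A : Matrix (Fin 2) (Fin 2) ℝ).det / (A 0 1 ^ 2 + A 1 1 ^ 2)) •
      !![A 1 1, A 0 1; -A 0 1, A 1 1])) (by
      rw [Matrix.det_smul, Matrix.det_fin_two_of]
      have := col_ne A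
      have h2 : A 1 1 * A 1 1 - A 0 1 * -A 0 1 = A 0 1 ^ 2 + A 1 1 ^ 2 := by ring
      rw [h2]
      exact mul_ne_zero (pow_ne_zero _ (div_ne_zero (det_ne A) this)) this), by
    simp [mem_K0, Matrix.GeneralLinearGroup.mkOfDetNeZero]⟩

/-- The factor `C_A ∈ H_(1,0)` in the factorisation `A = M_A C_A`. -/
def facH (A : GL2) : H10 :=
  ⟨(facK A : GL2)⁻¹ * A, by
    have hc := col_ne A
    have hd := det_ne A
    have hdd : A 0 0 * A 1 1 - A 0 1 * A 1 0 ≠ 0 := by rwa [Matrix.det_fin_two] at hd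
    have hv : (!![1, 0; (A 1 0 * A 1 1 + A 0 0 * A 0 1) / (A : Matrix (Fin 2) (Fin 2) ℝ).det,
        (A 0 1 ^ 2 + A 1 1 ^ 2) / (A : Matrix (Fin 2) (Fin 2) ℝ).det]).det ≠ 0 := by
      rw [Matrix.det_fin_two_of]; simpa using ⟨hc, hd⟩
    have e : (facK A : GL2) * Matrix.GeneralLinearGroup.mkOfDetNeZero _ hv = A := by
      ext i j
      fin_cases i <;> fin_cases j <;>
      · simp [facK, Matrix.GeneralLinearGroup.mkOfDetNeZero, Matrix.mul_apply, Fin.sum_univ_two]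
        rw [Matrix.det_fin_two]
        field_simp
        try ring
    rw [inv_mul_eq_iff_eq_mul.2 e.symm]
    simp [mem_H10, Matrix.GeneralLinearGroup.mkOfDetNeZero]⟩

theorem fac_mul (A : GL2) : (facK A : GL2) * (facH A : GL2) = A := by
  simp [facH]

theorem fac_unique {M : GL2} (hM : M ∈ K0) {C : GL2} (hC : C ∈ H10) {M' : GL2} (hM' : M' ∈ K0)
    {C' : GL2} (hC' : C' ∈ H10) (h : M * C = M' * C') : M = M' ∧ C = C' := by
  have h1 : M'⁻¹ * M = C' * C⁻¹ := by
    rw [inv_mul_eq_iff_eq_mul, ← mul_assoc, ← h, mul_assoc, mul_inv_cancel, mul_one]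
  have hk : M'⁻¹ * M ∈ K0 := K0.mul_mem (K0.inv_mem hM') hM
  have hh : M'⁻¹ * M ∈ H10 := by rw [h1]; exact H10.mul_mem hC' (H10.inv_mem hC)
  rw [mem_K0] at hk
  rw [mem_H10] at hh
  have e : M'⁻¹ * M = 1 := by
    ext i j
    fin_cases i <;> fin_cases j
    · simpa using hh.1
    · simpa using hh.2
    · have := hk.2
      rw [hh.2] at this
      simpa using this.symm
    · simpa [hh.1] using hk.1
  refine ⟨(inv_mul_eq_one.1 e).symm, ?_⟩
  rw [e] at h1
  exact (mul_inv_eq_one.1 h1.symm).symm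

theorem facK_mul (X : GL2) (C : H10) : facK (X * C) = facK X := by
  have := fac_unique (facK (X * C)).2 (facH (X * C)).2 (facK X).2 (facH X * C).2
    (by rw [fac_mul, H10.coe_mul, ← mul_assoc, fac_mul])
  exact Subtype.ext this.1

theorem facH_mul (X : GL2) (C : H10) : facH (X * C) = facH X * C := by
  have := fac_unique (facK (X * C)).2 (facH (X * C)).2 (facK X).2 (facH X * C).2
    (by rw [fac_mul, H10.coe_mul, ← mul_assoc, fac_mul])
  exact Subtype.ext this.2

theorem fac_of_mem (L : K0) : facK L = L ∧ facH L = 1 := by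
  have := fac_unique (facK L).2 (facH L).2 L.2 H10.one_mem (by rw [fac_mul, mul_one])
  exact ⟨Subtype.ext this.1, Subtype.ext this.2⟩

/-! ### Haar measures -/

/-- Lebesgue measure on `𝒪₁ = ℝ ∖ {0}`, the set of nonzero reals. -/
def lebO1 : Measure ℝˣ := (volume : Measure ℝ).comap Units.val

/-- Haar measure `dt / |t|` of the group `ℝ* = ℝ ∖ {0}`. -/
def haarR : Measure ℝˣ := lebO1.withDensity fun t => ENNReal.ofReal |(t : ℝ)|⁻¹

/-- The four entries of a matrix, grouped by columns. -/
def colsGL (A : GL2) : (Fin 2 → ℝ) × (Fin 2 → ℝ) := (fun i => A i 0, fun i => A i 1)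

/-- Haar measure of `GL₂(ℝ)`: Lebesgue measure in the four entries, divided by `det²`. -/
def haarGL : Measure GL2 := ((volume : Measure ((Fin 2 → ℝ) × (Fin 2 → ℝ))).comap colsGL).withDensity
  fun A => ENNReal.ofReal ((A : Matrix (Fin 2) (Fin 2) ℝ).det ^ 2)⁻¹

/-- Left Haar measure `du dv / v²` of `H_(1,0)`, for `C = (1 0; u v)`. -/
def haarH : Measure H10 := ((volume : Measure (ℝ × ℝ)).comap
    fun C : H10 => ((C : GL2) 1 0, (C : GL2) 1 1)).withDensity
  fun C => ENNReal.ofReal ((C : GL2) 1 1 ^ 2)⁻¹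

/-- The coordinate `ω = (1,0) L⁻¹` of `L ∈ K₀`; it is the inverse of
`γ(ω) = ‖ω‖⁻² (ω₁ -ω₂; ω₂ ω₁)`. -/
def orb (L : K0) : Fin 2 → ℝ := ![1, 0] ᵥ* (((L : GL2)⁻¹ : GL2) : Matrix (Fin 2) (Fin 2) ℝ)

/-- Haar measure `dω / ‖ω‖²` of `K₀`, for `L = γ(ω)`. -/
def haarK : Measure K0 := ((volume : Measure (Fin 2 → ℝ)).comap orb).withDensity
  fun L => ENNReal.ofReal (orb L 0 ^ 2 + orb L 1 ^ 2)⁻¹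


/-! ### Measurability and invariance -/

theorem measurable_toUnits {X M : Type*} [MeasurableSpace X] [Monoid M] [MeasurableSpace M]
    {f : X → Mˣ} (h : Measurable fun x => (f x : M)) : Measurable f :=
  measurable_comap_iff.2 h

theorem measurable_entry (i j : Fin 2) : Measurable fun A : GL2 => A i j :=
  have hval : Measurable fun A : GL2 => (A : Matrix (Fin 2) (Fin 2) ℝ) :=
    comap_measurable Units.val
  (measurable_pi_apply j).comp ((measurable_pi_apply i).comp hval)

theorem measurable_of_entries {F : ℝ → ℝ → ℝ → ℝ → ℝ}
    (hF : Measurable fun p : ℝ × ℝ × ℝ × ℝ => F p.1 p.2.1 p.2.2.1 p.2.2.2) :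
    Measurable fun A : GL2 => F (A 0 0) (A 0 1) (A 1 0) (A 1 1) :=
  hF.comp ((measurable_entry 0 0).prodMk ((measurable_entry 0 1).prodMk
    ((measurable_entry 1 0).prodMk (measurable_entry 1 1))))

theorem measurable_toGL {X : Type*} [MeasurableSpace X] {f : X → GL2}
    (h : ∀ i j, Measurable fun x => f x i j) : Measurable f :=
  measurable_toUnits (measurable_pi_lambda _ fun i => measurable_pi_lambda _ fun j => h i j)

theorem measurable_det : Measurable fun A : GL2 => (A : Matrix (Fin 2) (Fin 2) ℝ).det := by
  simp_rw [Matrix.det_fin_two]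
  exact measurable_of_entries (F := fun a b c d => a * d - b * c) (by fun_prop)

theorem inv_entries (A : GL2) :
    ((A⁻¹ : GL2) : Matrix (Fin 2) (Fin 2) ℝ) = (A : Matrix (Fin 2) (Fin 2) ℝ).det⁻¹ •
      !![A 1 1, -A 0 1; -A 1 0, A 0 0] := by
  rw [Matrix.coe_units_inv, Matrix.inv_def, Matrix.adjugate_fin_two]
  simp

theorem measurable_invGL : Measurable fun A : GL2 => A⁻¹ := by
  refine measurable_toGL fun i j => ?_
  simp_rw [inv_entries]
  fin_cases i <;> fin_cases j <;> simp only [Fin.zero_eta, Fin.mk_one, Fin.isValue,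
    Matrix.smul_apply, smul_eq_mul, Matrix.of_apply, Matrix.cons_val]
  · exact measurable_det.inv.mul (measurable_entry 1 1)
  · exact measurable_det.inv.mul (measurable_entry 0 1).neg
  · exact measurable_det.inv.mul (measurable_entry 1 0).neg
  · exact measurable_det.inv.mul (measurable_entry 0 0)

theorem measurable_mulGL {X : Type*} [MeasurableSpace X] {f g : X → GL2} (hf : Measurable f)
    (hg : Measurable g) : Measurable fun x => f x * g x := by
  refine measurable_toGL fun i j => ?_
  simp only [Matrix.GeneralLinearGroup.coe_mul, Matrix.mul_apply, Fin.sum_univ_two]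
  have h1 := fun i j => (measurable_entry i j).comp hf
  have h2 := fun i j => (measurable_entry i j).comp hg
  exact ((h1 i 0).mul (h2 0 j)).add ((h1 i 1).mul (h2 1 j))

theorem measurable_facK : Measurable facK := by
  refine Measurable.subtype_mk (measurable_toGL fun i j => ?_)
  have h : Measurable fun A : GL2 =>
      (A : Matrix (Fin 2) (Fin 2) ℝ).det / (A 0 1 ^ 2 + A 1 1 ^ 2) :=
    measurable_det.div (((measurable_entry 0 1).pow_const 2).add
      ((measurable_entry 1 1).pow_const 2))
  fin_cases i <;> fin_cases j
  · exact h.mul (measurable_entry 1 1)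
  · exact h.mul (measurable_entry 0 1)
  · exact h.mul (measurable_entry 0 1).neg
  · exact h.mul (measurable_entry 1 1)

theorem measurable_facH : Measurable facH :=
  Measurable.subtype_mk (measurable_mulGL
    (measurable_invGL.comp (measurable_subtype_coe.comp measurable_facK)) measurable_id)

theorem range_unitsVal : range (Units.val : ℝˣ → ℝ) = {0}ᶜ := by
  ext t
  simp only [mem_range, mem_compl_iff, mem_singleton_iff]
  exact ⟨by rintro ⟨u, rfl⟩; exact u.ne_zero, fun h => ⟨Units.mk0 t h, rfl⟩⟩

theorem measurableEmbedding_unitsVal : MeasurableEmbedding (Units.val : ℝˣ → ℝ) :=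
  measurableEmbedding_of_comap rfl Units.val_injective
    (by rw [range_unitsVal]; exact (measurableSet_singleton 0).compl)

theorem map_mul_lebO1 (a : ℝˣ) :
    lebO1.map (fun t => a * t) = ENNReal.ofReal |(a : ℝ)⁻¹| • lebO1 := by
  refine map_comap_eq (T := fun t => (a : ℝ) * t) measurableEmbedding_unitsVal
    (measurable_toUnits ?_) (measurable_const_mul _) (fun x => rfl) ?_
    (Real.map_volume_mul_left a.ne_zero)
  · exact (measurable_const_mul (a : ℝ)).comp (comap_measurable Units.val)
  · rw [range_unitsVal]; ext t; simp

theorem measurable_mulUnits (a : ℝˣ) : Measurable fun t : ℝˣ => a * t :=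
  measurable_toUnits ((measurable_const_mul (a : ℝ)).comp (comap_measurable Units.val))

theorem measurable_unitsVal : Measurable (Units.val : ℝˣ → ℝ) := comap_measurable Units.val

theorem lintegral_mul_haarR (a : ℝˣ) (f : ℝˣ → ℝ≥0∞) (hf : AEMeasurable f haarR) :
    ∫⁻ t, f (a * t) ∂haarR = ∫⁻ t, f t ∂haarR := by
  have h := lintegral_twist (μ := lebO1) (measurable_mulUnits a) (κ := ENNReal.ofReal |(a : ℝ)⁻¹|)
    (by simp) (by simp) (map_mul_lebO1 a)
    (ρ := fun t => ENNReal.ofReal |(t : ℝ)|⁻¹) (w := fun _ => 1)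
    (by have := measurable_unitsVal; fun_prop) measurable_const
    (by
      intro x
      rw [mul_one, ← ENNReal.ofReal_mul (by positivity)]
      congr 1
      simp [abs_mul, abs_inv, mul_comm]) f hf
  simpa [haarR] using h

theorem range_colsGL : range colsGL = {p | p.1 0 * p.2 1 - p.2 0 * p.1 1 ≠ 0} := by
  ext p
  constructor
  · rintro ⟨A, rfl⟩
    have := det_ne A
    rwa [Matrix.det_fin_two] at this
  · intro h
    refine ⟨Matrix.GeneralLinearGroup.mkOfDetNeZero !![p.1 0, p.2 0; p.1 1, p.2 1]
      (by rw [Matrix.det_fin_two_of]; exact h), ?_⟩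
    ext i <;> fin_cases i <;> rfl

theorem measurable_colsGL : Measurable colsGL :=
  (measurable_pi_lambda _ fun i => measurable_entry i 0).prodMk
    (measurable_pi_lambda _ fun i => measurable_entry i 1)

theorem measurableSet_range_colsGL : MeasurableSet (range colsGL) := by
  rw [range_colsGL]
  exact (measurableSet_singleton (0 : ℝ)).compl.preimage
    (f := fun p : (Fin 2 → ℝ) × (Fin 2 → ℝ) => p.1 0 * p.2 1 - p.2 0 * p.1 1) (by fun_prop)

theorem measurableEmbedding_colsGL : MeasurableEmbedding colsGL := by
  classical
  refine MeasurableEmbedding.of_measurable_inverse measurable_colsGL measurableSet_range_colsGL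
    (g := fun p => if h : p.1 0 * p.2 1 - p.2 0 * p.1 1 ≠ 0 then
      Matrix.GeneralLinearGroup.mkOfDetNeZero !![p.1 0, p.2 0; p.1 1, p.2 1]
        (by rw [Matrix.det_fin_two_of]; exact h) else 1) ?_ ?_
  · refine Measurable.dite
      (s := {p : (Fin 2 → ℝ) × (Fin 2 → ℝ) | p.1 0 * p.2 1 - p.2 0 * p.1 1 ≠ 0})
      (f := fun p => Matrix.GeneralLinearGroup.mkOfDetNeZero
        !![p.1.1 0, p.1.2 0; p.1.1 1, p.1.2 1] (by rw [Matrix.det_fin_two_of]; exact p.2))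
      (measurable_toGL fun i j => ?_) measurable_const
      (range_colsGL ▸ measurableSet_range_colsGL)
    have h1 (i : Fin 2) : Measurable fun p : {p : (Fin 2 → ℝ) × (Fin 2 → ℝ) |
        p.1 0 * p.2 1 - p.2 0 * p.1 1 ≠ 0} => p.1.1 i :=
      (measurable_pi_apply i).comp (measurable_fst.comp measurable_subtype_coe)
    have h2 (i : Fin 2) : Measurable fun p : {p : (Fin 2 → ℝ) × (Fin 2 → ℝ) |
        p.1 0 * p.2 1 - p.2 0 * p.1 1 ≠ 0} => p.1.2 i :=
      (measurable_pi_apply i).comp (measurable_snd.comp measurable_subtype_coe)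
    fin_cases i <;> fin_cases j
    exacts [h1 0, h2 0, h1 1, h2 1]
  · intro A
    have h : (colsGL A).1 0 * (colsGL A).2 1 - (colsGL A).2 0 * (colsGL A).1 1 ≠ 0 := by
      have := det_ne A
      rwa [Matrix.det_fin_two] at this
    simp only [dif_pos h]
    ext i j
    fin_cases i <;> fin_cases j <;> rfl

theorem lintegral_mul_haarGL (A : GL2) (f : GL2 → ℝ≥0∞) (hf : AEMeasurable f haarGL) :
    ∫⁻ B, f (A * B) ∂haarGL = ∫⁻ B, f B ∂haarGL := by
  set d := (A : Matrix (Fin 2) (Fin 2) ℝ).det with hd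
  set T := Matrix.toLin' (A : Matrix (Fin 2) (Fin 2) ℝ) with hT
  have hTm : Measurable T := (LinearMap.continuous_on_pi T).measurable
  have hv : (volume : Measure (Fin 2 → ℝ)).map T = ENNReal.ofReal |d⁻¹| • volume :=
    Real.map_matrix_volume_pi_eq_smul_volume_pi (det_ne A)
  have hmap : ((volume : Measure ((Fin 2 → ℝ) × (Fin 2 → ℝ))).comap colsGL).map (fun B => A * B) =
      (ENNReal.ofReal |d⁻¹| * ENNReal.ofReal |d⁻¹|) • volume.comap colsGL := by
    refine map_comap_eq (T := Prod.map T T) measurableEmbedding_colsGL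
      (measurable_mulGL measurable_const measurable_id) (hTm.prodMap hTm) ?_ ?_ ?_
    · intro B
      ext i <;> fin_cases i <;> simp [colsGL, hT, Matrix.mul_apply]
    · rw [range_colsGL]
      ext p
      have : (T p.1) 0 * (T p.2) 1 - (T p.2) 0 * (T p.1) 1 =
          d * (p.1 0 * p.2 1 - p.2 0 * p.1 1) := by
        rw [hd, Matrix.det_fin_two, hT]
        simp [Matrix.mulVec, dotProduct, Fin.sum_univ_two]
        ring
      simp only [mem_preimage, mem_ofPred_eq, Prod.map_fst, Prod.map_snd, this]
      simp [hd, det_ne A]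
    · rw [Measure.volume_eq_prod, ← Measure.map_prod_map _ _ hTm hTm, hv, Measure.prod_smul_left,
        Measure.prod_smul_right, smul_smul]
  have hd0 : d ≠ 0 := det_ne A
  have h := lintegral_twist (measurable_mulGL measurable_const measurable_id)
    (by simp [hd0]) (by finiteness) hmap
    (ρ := fun A => ENNReal.ofReal ((A : Matrix (Fin 2) (Fin 2) ℝ).det ^ 2)⁻¹) (w := fun _ => 1)
    (by have := measurable_det; fun_prop) measurable_const
    (by
      intro x
      rw [mul_one, ← ENNReal.ofReal_mul (by positivity), ← ENNReal.ofReal_mul (by positivity)]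
      congr 1
      simp only [Matrix.GeneralLinearGroup.coe_mul, Matrix.det_mul, ← hd, id]
      rw [← abs_mul, abs_of_nonneg (mul_self_nonneg _)]
      ring) f hf
  simpa [haarGL] using h

/-! ### The orbit coordinate on `K₀` -/

theorem orb_eq (L : K0) : orb L 0 = (L : GL2) 0 0 * ((L : GL2) : Matrix (Fin 2) (Fin 2) ℝ).det⁻¹ ∧
    orb L 1 = (L : GL2) 1 0 * ((L : GL2) : Matrix (Fin 2) (Fin 2) ℝ).det⁻¹ := by
  have h := mem_K0.1 L.2
  rw [orb, inv_entries]
  simp [h.1, h.2, mul_comm]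

theorem det_K0 (L : K0) : ((L : GL2) : Matrix (Fin 2) (Fin 2) ℝ).det =
    (L : GL2) 0 0 ^ 2 + (L : GL2) 1 0 ^ 2 := by
  have h := mem_K0.1 L.2
  rw [Matrix.det_fin_two, h.1, h.2]; ring

theorem orb_sq (L : K0) :
    orb L 0 ^ 2 + orb L 1 ^ 2 = ((L : GL2) : Matrix (Fin 2) (Fin 2) ℝ).det⁻¹ := by
  have hd := det_ne L
  rw [(orb_eq L).1, (orb_eq L).2]
  rw [det_K0] at hd ⊢
  field_simp

theorem orb_facK (X : GL2) (L : K0) : orb (facK (X⁻¹ * L)) = orb L ᵥ* (X : Matrix _ _ ℝ) := by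
  have h1 : ((facK (X⁻¹ * L) : GL2))⁻¹ = (facH (X⁻¹ * L) : GL2) * ((L : GL2)⁻¹ * X) := by
    have := fac_mul (X⁻¹ * L)
    rw [eq_comm, ← mul_inv_eq_iff_eq_mul] at this
    rw [← this]
    group
  have h2 : ![1, 0] ᵥ* ((facH (X⁻¹ * L) : GL2) : Matrix (Fin 2) (Fin 2) ℝ) = ![1, 0] :=
    (facH (X⁻¹ * L)).2
  rw [orb, h1, Matrix.GeneralLinearGroup.coe_mul, Matrix.GeneralLinearGroup.coe_mul,
    ← Matrix.vecMul_vecMul, h2, ← Matrix.vecMul_vecMul, orb]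

/-- The cross-section `γ(ω) = ‖ω‖⁻² (ω₁ -ω₂; ω₂ ω₁)`. -/
def gam (ω : Fin 2 → ℝ) (h : ω 0 ^ 2 + ω 1 ^ 2 ≠ 0) : K0 :=
  ⟨Matrix.GeneralLinearGroup.mkOfDetNeZero
    !![(ω 0 ^ 2 + ω 1 ^ 2)⁻¹ * ω 0, -((ω 0 ^ 2 + ω 1 ^ 2)⁻¹ * ω 1);
      (ω 0 ^ 2 + ω 1 ^ 2)⁻¹ * ω 1, (ω 0 ^ 2 + ω 1 ^ 2)⁻¹ * ω 0] (by
    rw [Matrix.det_fin_two_of]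
    have : (ω 0 ^ 2 + ω 1 ^ 2)⁻¹ * ω 0 * ((ω 0 ^ 2 + ω 1 ^ 2)⁻¹ * ω 0) -
        -((ω 0 ^ 2 + ω 1 ^ 2)⁻¹ * ω 1) * ((ω 0 ^ 2 + ω 1 ^ 2)⁻¹ * ω 1) =
        (ω 0 ^ 2 + ω 1 ^ 2)⁻¹ := by field_simp; ring
    rw [this]
    exact inv_ne_zero h), rfl, rfl⟩

theorem gam_orb (L : K0) (h : orb L 0 ^ 2 + orb L 1 ^ 2 ≠ 0) : gam (orb L) h = L := by
  have hm := mem_K0.1 L.2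
  have hd := det_ne L
  have h0 : (orb L 0 ^ 2 + orb L 1 ^ 2)⁻¹ * orb L 0 = (L : GL2) 0 0 := by
    rw [orb_sq, (orb_eq L).1, inv_inv, mul_comm, mul_assoc, inv_mul_cancel₀ hd, mul_one]
  have h1 : (orb L 0 ^ 2 + orb L 1 ^ 2)⁻¹ * orb L 1 = (L : GL2) 1 0 := by
    rw [orb_sq, (orb_eq L).2, inv_inv, mul_comm, mul_assoc, inv_mul_cancel₀ hd, mul_one]
  apply Subtype.ext
  ext i j
  fin_cases i <;> fin_cases j
  · exact h0
  · exact (congrArg Neg.neg h1).trans hm.2.symm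
  · exact h1
  · exact h0.trans hm.1.symm

theorem orb_gam (ω : Fin 2 → ℝ) (h : ω 0 ^ 2 + ω 1 ^ 2 ≠ 0) : orb (gam ω h) = ω := by
  have hd := det_ne (gam ω h)
  have e0 : ((gam ω h : GL2) 0 0) = (ω 0 ^ 2 + ω 1 ^ 2)⁻¹ * ω 0 := rfl
  have e1 : ((gam ω h : GL2) 1 0) = (ω 0 ^ 2 + ω 1 ^ 2)⁻¹ * ω 1 := rfl
  have hdet : ((gam ω h : GL2) : Matrix (Fin 2) (Fin 2) ℝ).det = (ω 0 ^ 2 + ω 1 ^ 2)⁻¹ := by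
    rw [det_K0, e0, e1]; field_simp
  ext i
  fin_cases i
  · change orb (gam ω h) 0 = ω 0
    rw [(orb_eq _).1, hdet, e0, inv_inv, mul_comm, ← mul_assoc, mul_inv_cancel₀ h, one_mul]
  · change orb (gam ω h) 1 = ω 1
    rw [(orb_eq _).2, hdet, e1, inv_inv, mul_comm, ← mul_assoc, mul_inv_cancel₀ h, one_mul]

theorem orb_sq_ne (L : K0) : orb L 0 ^ 2 + orb L 1 ^ 2 ≠ 0 := by
  rw [orb_sq]; exact inv_ne_zero (det_ne L)

theorem range_orb : range orb = {ω | ω 0 ^ 2 + ω 1 ^ 2 ≠ 0} := by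
  ext ω
  exact ⟨by rintro ⟨L, rfl⟩; exact orb_sq_ne L, fun h => ⟨gam ω h, orb_gam ω h⟩⟩

theorem measurableSet_range_orb : MeasurableSet (range orb) := by
  rw [range_orb]
  exact (measurableSet_singleton (0 : ℝ)).compl.preimage
    (f := fun ω : Fin 2 → ℝ => ω 0 ^ 2 + ω 1 ^ 2) (by fun_prop)

theorem measurable_orb : Measurable orb := by
  refine measurable_pi_lambda _ fun i => ?_
  have h (a b : Fin 2) : Measurable fun L : K0 => (((L : GL2)⁻¹ : GL2) a b : ℝ) :=
    (measurable_entry a b).comp (measurable_invGL.comp measurable_subtype_coe)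
  simp only [orb, Matrix.vecMul, dotProduct, Fin.sum_univ_two]
  exact ((h 0 i).const_mul _).add ((h 1 i).const_mul _)

theorem measurableEmbedding_orb : MeasurableEmbedding orb := by
  classical
  refine MeasurableEmbedding.of_measurable_inverse measurable_orb measurableSet_range_orb
    (g := fun ω => if h : ω 0 ^ 2 + ω 1 ^ 2 ≠ 0 then gam ω h else 1) ?_ ?_
  · refine Measurable.dite (s := {ω : Fin 2 → ℝ | ω 0 ^ 2 + ω 1 ^ 2 ≠ 0})
      (f := fun ω => gam ω.1 ω.2) (Measurable.subtype_mk (measurable_toGL fun i j => ?_))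
      measurable_const (range_orb ▸ measurableSet_range_orb)
    have h (i : Fin 2) : Measurable fun ω : {ω : Fin 2 → ℝ | ω 0 ^ 2 + ω 1 ^ 2 ≠ 0} => ω.1 i :=
      (measurable_pi_apply i).comp measurable_subtype_coe
    have hq := (((h 0).pow_const 2).add ((h 1).pow_const 2)).inv
    fin_cases i <;> fin_cases j
    exacts [hq.mul (h 0), (hq.mul (h 1)).neg, hq.mul (h 1), hq.mul (h 0)]
  · intro L
    simp only [dif_pos (orb_sq_ne L)]
    exact gam_orb L _

theorem lintegral_act_haarK (A : GL2) (f : K0 → ℝ≥0∞) (hf : AEMeasurable f haarK) :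
    ∫⁻ L : K0, ENNReal.ofReal
        |((facH (A⁻¹ * L) : GL2) : Matrix (Fin 2) (Fin 2) ℝ).det|⁻¹ * f (facK (A⁻¹ * L)) ∂haarK =
      ∫⁻ L, f L ∂haarK := by
  have hmX : Measurable fun L : K0 => A⁻¹ * (L : GL2) :=
    measurable_mulGL measurable_const measurable_subtype_coe
  have hφ : Measurable fun L : K0 => facK (A⁻¹ * L) := measurable_facK.comp hmX
  set d := (A : Matrix (Fin 2) (Fin 2) ℝ).det with hd
  have hd0 : d ≠ 0 := det_ne A
  set T := Matrix.toLin' (A : Matrix (Fin 2) (Fin 2) ℝ)ᵀ with hT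
  have hTm : Measurable T := (LinearMap.continuous_on_pi T).measurable
  have hv : (volume : Measure (Fin 2 → ℝ)).map T = ENNReal.ofReal |d⁻¹| • volume := by
    rw [hT, Real.map_matrix_volume_pi_eq_smul_volume_pi (by rwa [Matrix.det_transpose]),
      Matrix.det_transpose]
  have hTe (ω : Fin 2 → ℝ) : T ω = ω ᵥ* (A : Matrix (Fin 2) (Fin 2) ℝ) := by
    rw [hT, Matrix.toLin'_apply, Matrix.mulVec_transpose]
  have hmap : ((volume : Measure (Fin 2 → ℝ)).comap orb).map (fun L : K0 => facK (A⁻¹ * L)) =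
      ENNReal.ofReal |d⁻¹| • volume.comap orb := by
    refine map_comap_eq (T := T) measurableEmbedding_orb hφ hTm ?_ ?_ hv
    · intro L; rw [orb_facK, hTe]
    · ext ω
      have hne (η : Fin 2 → ℝ) : η ∈ range orb ↔ η ≠ 0 := by
        rw [range_orb, mem_ofPred_eq, not_iff_not]
        constructor
        · intro h
          ext i
          fin_cases i <;> simp <;> nlinarith [sq_nonneg (η 0), sq_nonneg (η 1)]
        · rintro rfl; simp
      rw [mem_preimage, hne, hne, not_iff_not]
      constructor
      · intro h
        have h2 := congrArg (fun v => v ᵥ* ((A⁻¹ : GL2) : Matrix (Fin 2) (Fin 2) ℝ)) h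
        simp only [hTe, Matrix.vecMul_vecMul, Matrix.zero_vecMul,
          ← Matrix.GeneralLinearGroup.coe_mul, mul_inv_cancel] at h2
        simpa using h2
      · rintro rfl; simp
  refine lintegral_twist hφ (by simp [hd0]) (by simp) hmap
    (ρ := fun L => ENNReal.ofReal (orb L 0 ^ 2 + orb L 1 ^ 2)⁻¹) ?_ ?_ ?_ f hf
  · have h (i : Fin 2) : Measurable fun L => orb L i := (measurable_pi_apply i).comp measurable_orb
    exact ((((h 0).pow_const 2).add ((h 1).pow_const 2)).inv).ennreal_ofReal
  · have : Measurable fun L : K0 => ((facH (A⁻¹ * L) : GL2) : Matrix (Fin 2) (Fin 2) ℝ).det :=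
      measurable_det.comp (measurable_subtype_coe.comp (measurable_facH.comp hmX))
    exact (measurable_norm.comp this).inv.ennreal_ofReal
  · intro L
    rw [orb_sq, orb_sq, inv_inv, inv_inv, ← ENNReal.ofReal_mul (by rw [det_K0]; positivity),
      ← ENNReal.ofReal_mul (mul_nonneg (by rw [det_K0]; positivity) (by positivity))]
    congr 1
    have h := congrArg (fun X : GL2 => |(X : Matrix (Fin 2) (Fin 2) ℝ).det|)
      (fac_mul (A⁻¹ * L))
    have hA : ((A⁻¹ : GL2) : Matrix (Fin 2) (Fin 2) ℝ).det = d⁻¹ := by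
      rw [inv_entries, Matrix.det_smul, Matrix.det_fin_two_of]
      have : A 1 1 * A 0 0 - -A 0 1 * -A 1 0 = d := by rw [hd, Matrix.det_fin_two]; ring
      simp only [← hd, this]
      simp; field_simp
    simp only [Matrix.GeneralLinearGroup.coe_mul, Matrix.det_mul, abs_mul, hA] at h
    have hM : 0 ≤ ((facK (A⁻¹ * L) : GL2) : Matrix (Fin 2) (Fin 2) ℝ).det := by
      rw [det_K0]; positivity
    have hL : 0 ≤ ((L : GL2) : Matrix (Fin 2) (Fin 2) ℝ).det := by
      rw [det_K0]; positivity
    rw [abs_of_nonneg hM, abs_of_nonneg hL] at h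
    have hC : |((facH (A⁻¹ * L) : GL2) : Matrix (Fin 2) (Fin 2) ℝ).det| ≠ 0 :=
      abs_ne_zero.2 (det_ne _)
    rw [mul_right_comm, mul_comm _ |d⁻¹|, ← h, mul_assoc, mul_inv_cancel₀ hC, mul_one]

/-! ### The representations -/

/-- `e2pi r = exp(2πi r)`. -/
def e2pi (r : ℝ) : ℂ := Complex.exp (2 * Real.pi * Complex.I * r)

theorem norm_e2pi (r : ℝ) : ‖e2pi r‖ = 1 := by
  rw [e2pi, show 2 * Real.pi * Complex.I * r = ((2 * Real.pi * r : ℝ) : ℂ) * Complex.I by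
    push_cast; ring]
  exact Complex.norm_exp_ofReal_mul_I _

theorem enorm_e2pi (r : ℝ) : ‖e2pi r‖ₑ = 1 := by
  rw [← ofReal_norm, norm_e2pi]; simp

theorem e2pi_add (r s : ℝ) : e2pi (r + s) = e2pi r * e2pi s := by
  rw [e2pi, e2pi, e2pi, ← Complex.exp_add]; push_cast; ring_nf

theorem e2pi_zero : e2pi 0 = 1 := by simp [e2pi]

theorem measurable_e2pi : Measurable e2pi := by
  unfold e2pi; fun_prop

/-- `L²(ℝ*)`. -/
abbrev L2R : Type := Lp ℂ 2 haarR

/-- `L²(GL₂(ℝ))`. -/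
abbrev L2GL : Type := Lp ℂ 2 haarGL

/-- `L²(H_(1,0))`. -/
abbrev L2H : Type := Lp ℂ 2 haarH

theorem measurable_mulUnitsInv {X : Type*} [MeasurableSpace X] {f : X → GL2} {g : X → ℝˣ}
    (hf : Measurable f) (hg : Measurable g) :
    Measurable fun x => (Matrix.GeneralLinearGroup.det (f x))⁻¹ * g x := by
  refine measurable_toUnits ?_
  simp only [Units.val_mul, Units.val_inv_eq_inv_val, Matrix.GeneralLinearGroup.val_det_apply]
  exact (measurable_det.comp hf).inv.mul (measurable_unitsVal.comp hg)

theorem quasi_mul_haarR (a : ℝˣ) :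
    Measure.QuasiMeasurePreserving (fun b => a * b) haarR haarR :=
  quasi_twist (w := fun _ => 1) (measurable_mulUnits a) measurable_const (by simp)
    (by simpa using lintegral_mul_haarR a)

theorem measurable_pi1 (C : H10) : Measurable fun b : ℝˣ => e2pi ((C : GL2) 1 0 / (b : ℝ)) :=
  measurable_e2pi.comp (measurable_unitsVal.const_div _)

/-- The isometry `f ↦ (b ↦ exp(2πi u / b) f(v⁻¹ b))` of `L²(ℝ*)`, for `C = (1 0; u v)`. -/
def pi1Op (C : H10) : L2R →ₗᵢ[ℂ] L2R :=
  twist haarR (fun b => (Matrix.GeneralLinearGroup.det (C : GL2))⁻¹ * b)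
    (fun b => e2pi ((C : GL2) 1 0 / (b : ℝ))) (fun _ => LinearIsometry.id)
    (quasi_mul_haarR _)
    (fun _ hF => (measurable_pi1 C).aestronglyMeasurable.smul
      (hF.comp_quasiMeasurePreserving (quasi_mul_haarR _)))
    (fun f hf => by
      simp only [enorm_e2pi, one_pow, one_mul]
      exact lintegral_mul_haarR _ f hf)

theorem coeFn_pi1Op (C : H10) (f : L2R) : pi1Op C f =ᵐ[haarR] fun b =>
    e2pi ((C : GL2) 1 0 / (b : ℝ)) * f ((Matrix.GeneralLinearGroup.det (C : GL2))⁻¹ * b) :=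
  coeFn_twist (quasi_mul_haarR _) _ _ f

theorem det_H10 (C : H10) : ((Matrix.GeneralLinearGroup.det (C : GL2) : ℝˣ) : ℝ) = (C : GL2) 1 1 := by
  have h := mem_H10.1 C.2
  rw [Matrix.GeneralLinearGroup.val_det_apply, Matrix.det_fin_two, h.1, h.2]; ring

/-- The representation `π¹` of `H_(1,0)` on `L²(ℝ*)`:
`(π¹(C) f)(b) = exp(2πi u / b) f(v⁻¹ b)` for `C = (1 0; u v)`; note `v = det C`. -/
def pi1 : H10 →* (L2R ≃ₗᵢ[ℂ] L2R) :=
  unitaryRep pi1Op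
    (by
      intro f
      apply Lp.ext
      filter_upwards [coeFn_pi1Op 1 f] with b hb
      rw [hb]
      simp [e2pi_zero])
    (by
      intro C D f
      apply Lp.ext
      filter_upwards [coeFn_pi1Op (C * D) f, coeFn_pi1Op C (pi1Op D f),
        (quasi_mul_haarR (Matrix.GeneralLinearGroup.det (C : GL2))⁻¹).ae (coeFn_pi1Op D f)]
        with b h1 h2 h3
      rw [h1, h2, h3, ← mul_assoc, ← e2pi_add]
      have hd := det_H10 C
      have hv : (C : GL2) 1 1 ≠ 0 := by rw [← hd]; exact Units.ne_zero _
      congr 2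
      · have hb : (b : ℝ) ≠ 0 := b.ne_zero
        have hD := mem_H10.1 D.2
        rw [Units.val_mul, Units.val_inv_eq_inv_val, hd, Subgroup.coe_mul,
          Matrix.GeneralLinearGroup.coe_mul, Matrix.mul_apply, Fin.sum_univ_two, hD.1]
        field_simp
      · rw [Subgroup.coe_mul, map_mul, mul_inv_rev, mul_assoc])

theorem coeFn_pi1 (C : H10) (f : L2R) : pi1 C f =ᵐ[haarR] fun b =>
    e2pi ((C : GL2) 1 0 / (b : ℝ)) * f ((Matrix.GeneralLinearGroup.det (C : GL2))⁻¹ * b) :=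
  coeFn_pi1Op C f

theorem quasi_mul_haarGL (A : GL2) :
    Measure.QuasiMeasurePreserving (fun B => A * B) haarGL haarGL :=
  quasi_twist (w := fun _ => 1) (measurable_mulGL measurable_const measurable_id)
    measurable_const (by simp) (by simpa using lintegral_mul_haarGL A)

theorem measurable_pi10 (g : Aff2) : Measurable fun B : GL2 =>
    e2pi (![1, 0] ⬝ᵥ (((B⁻¹ : GL2) : Matrix (Fin 2) (Fin 2) ℝ) *ᵥ g.trans)) := by
  refine measurable_e2pi.comp ?_
  have h (i j : Fin 2) : Measurable fun B : GL2 => ((B⁻¹ : GL2) i j : ℝ) :=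
    (measurable_entry i j).comp measurable_invGL
  simp only [Matrix.mulVec, dotProduct, Fin.sum_univ_two]
  exact (((((h 0 0).mul_const _).add ((h 0 1).mul_const _)).const_mul _).add
    ((((h 1 0).mul_const _).add ((h 1 1).mul_const _)).const_mul _))

/-- The isometry `f ↦ (B ↦ exp(2πi (1,0) B⁻¹ x) f(A⁻¹ B))` of `L²(GL₂(ℝ))`, for `g = [x, A]`. -/
def pi10Op (g : Aff2) : L2GL →ₗᵢ[ℂ] L2GL :=
  twist haarGL (fun B => g.lin⁻¹ * B)
    (fun B => e2pi (![1, 0] ⬝ᵥ (((B⁻¹ : GL2) : Matrix (Fin 2) (Fin 2) ℝ) *ᵥ g.trans)))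
    (fun _ => LinearIsometry.id)
    (quasi_mul_haarGL _)
    (fun _ hF => (measurable_pi10 g).aestronglyMeasurable.smul
      (hF.comp_quasiMeasurePreserving (quasi_mul_haarGL _)))
    (fun f hf => by
      simp only [enorm_e2pi, one_pow, one_mul]
      exact lintegral_mul_haarGL _ f hf)

theorem coeFn_pi10Op (g : Aff2) (f : L2GL) : pi10Op g f =ᵐ[haarGL] fun B =>
    e2pi (![1, 0] ⬝ᵥ (((B⁻¹ : GL2) : Matrix (Fin 2) (Fin 2) ℝ) *ᵥ g.trans)) * f (g.lin⁻¹ * B) :=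
  coeFn_twist (quasi_mul_haarGL _) _ _ f

/-- The representation `π^(1,0)` of `G₂` on `L²(GL₂(ℝ))`:
`(π^(1,0)[x, A] f)(B) = exp(2πi (1,0) B⁻¹ x) f(A⁻¹ B)`. -/
def pi10 : Aff2 →* (L2GL ≃ₗᵢ[ℂ] L2GL) :=
  unitaryRep pi10Op
    (by
      intro f
      apply Lp.ext
      filter_upwards [coeFn_pi10Op 1 f] with b hb
      rw [hb, Aff2.one_lin, Aff2.one_trans, Matrix.mulVec_zero, dotProduct_zero, e2pi_zero,
        inv_one, one_mul, one_mul])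
    (by
      intro g h f
      apply Lp.ext
      filter_upwards [coeFn_pi10Op (g * h) f, coeFn_pi10Op g (pi10Op h f),
        (quasi_mul_haarGL g.lin⁻¹).ae (coeFn_pi10Op h f)] with B h1 h2 h3
      rw [h1, h2, h3, ← mul_assoc, ← e2pi_add]
      congr 2
      · rw [Aff2.mul_trans, Matrix.mulVec_add, dotProduct_add, Matrix.mulVec_mulVec,
          ← Matrix.GeneralLinearGroup.coe_mul, mul_inv_rev, inv_inv]
      · rw [Aff2.mul_lin, mul_inv_rev, mul_assoc])

theorem coeFn_pi10 (g : Aff2) (f : L2GL) : pi10 g f =ᵐ[haarGL] fun B =>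
    e2pi (![1, 0] ⬝ᵥ (((B⁻¹ : GL2) : Matrix (Fin 2) (Fin 2) ℝ) *ᵥ g.trans)) * f (g.lin⁻¹ * B) :=
  coeFn_pi10Op g f

instance : SigmaFinite lebO1 := by
  refine ⟨⟨⟨fun n => Units.val ⁻¹' Metric.ball (0 : ℝ) n, fun _ => trivial, ?_, ?_⟩⟩⟩
  · intro n
    rw [lebO1, measurableEmbedding_unitsVal.comap_preimage]
    exact (measure_mono inter_subset_left).trans_lt measure_ball_lt_top
  · rw [← preimage_iUnion, Metric.iUnion_ball_nat, preimage_univ]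

instance : SFinite haarR := by unfold haarR; infer_instance

instance : MeasurableSpace.CountablyGenerated ℝˣ := MeasurableSpace.CountablyGenerated.comap _

theorem measurable_of_dist {X Y : Type*} [MeasurableSpace X] [PseudoMetricSpace Y]
    [SecondCountableTopology Y] [MeasurableSpace Y] [BorelSpace Y] {u : X → Y}
    (h : ∀ y, Measurable fun x => dist (u x) y) : Measurable u := by
  refine measurable_of_isOpen fun s hs => ?_
  choose r hr hrs using fun y : s => Metric.isOpen_iff.1 hs y y.2
  obtain ⟨T, hT, hTs⟩ := TopologicalSpace.isOpen_iUnion_countable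
    (fun y : s => Metric.ball (y : Y) (r y)) fun _ => Metric.isOpen_ball
  have e : s = ⋃ y ∈ T, Metric.ball (y : Y) (r y) := by
    rw [hTs]
    apply Subset.antisymm
    · intro y hy
      exact mem_iUnion.2 ⟨⟨y, hy⟩, Metric.mem_ball_self (hr _)⟩
    · exact iUnion_subset hrs
  rw [e, preimage_iUnion₂]
  exact MeasurableSet.biUnion hT fun y _ => measurableSet_lt (h y) measurable_const

instance : SecondCountableTopology L2R :=
  haveI : Fact ((2 : ℝ≥0∞) ≠ ∞) := ⟨by norm_num⟩
  Lp.SecondCountableTopology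

theorem stronglyMeasurable_pi1 (ξ : L2R) : StronglyMeasurable fun C : H10 => pi1 C ξ := by
  borelize L2R
  refine Measurable.stronglyMeasurable (measurable_of_dist fun η => ?_)
  have hk : Measurable fun p : H10 × ℝˣ => ‖e2pi ((p.1 : GL2) 1 0 / (p.2 : ℝ)) *
      ξ ((Matrix.GeneralLinearGroup.det (p.1 : GL2))⁻¹ * p.2) - η p.2‖ₑ ^ 2 := by
    have h1 : Measurable fun p : H10 × ℝˣ => (p.1 : GL2) :=
      measurable_subtype_coe.comp measurable_fst
    refine Measurable.pow_const (Measurable.enorm (Measurable.sub (Measurable.mul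
      (measurable_e2pi.comp (((measurable_entry 1 0).comp h1).div
        (measurable_unitsVal.comp measurable_snd)))
      ((Lp.stronglyMeasurable ξ).measurable.comp (measurable_mulUnitsInv h1 measurable_snd)))
      ((Lp.stronglyMeasurable η).measurable.comp measurable_snd))) 2
  have e : ∀ C : H10, dist (pi1 C ξ) η = ((∫⁻ b, ‖e2pi ((C : GL2) 1 0 / (b : ℝ)) *
      ξ ((Matrix.GeneralLinearGroup.det (C : GL2))⁻¹ * b) - η b‖ₑ ^ 2 ∂haarR) ^
        (1 / 2 : ℝ)).toReal := by
    intro C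
    rw [Lp.dist_def, eLpNorm_two]
    congr 2
    apply lintegral_congr_ae
    filter_upwards [coeFn_pi1 C ξ] with b hb
    rw [Pi.sub_apply, hb]
  simp_rw [e]
  exact ((Measurable.lintegral_prod_right' hk).pow_const _).ennreal_toReal

/-- `L²(K, L²(ℝ*))`, with `K` identified with `K₀`. -/
abbrev L2KR : Type := Lp L2R 2 haarK

/-- The factor `|det C_{A⁻¹L}|^{-1/2} exp(2πi (1,0) L⁻¹ x)`, for `g = [x, A]`. -/
def sigmaWeight (g : Aff2) (L : K0) : ℂ :=
  ((|((facH (g.lin⁻¹ * L) : GL2) : Matrix (Fin 2) (Fin 2) ℝ).det| ^ (-(1 / 2) : ℝ) : ℝ) : ℂ) *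
    e2pi (![1, 0] ⬝ᵥ ((((L : GL2)⁻¹ : GL2) : Matrix (Fin 2) (Fin 2) ℝ) *ᵥ g.trans))

theorem enorm_sigmaWeight (g : Aff2) (L : K0) : ‖sigmaWeight g L‖ₑ ^ 2 =
    ENNReal.ofReal |((facH (g.lin⁻¹ * L) : GL2) : Matrix (Fin 2) (Fin 2) ℝ).det|⁻¹ := by
  rw [sigmaWeight, enorm_mul, enorm_e2pi, mul_one, ← ofReal_norm, Complex.norm_real,
    Real.norm_of_nonneg (by positivity), ← ENNReal.ofReal_pow (by positivity),
    ← Real.rpow_natCast, ← Real.rpow_mul (abs_nonneg _)]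
  norm_num [Real.rpow_neg_one]

theorem measurable_shift (g : Aff2) : Measurable fun L : K0 => g.lin⁻¹ * (L : GL2) :=
  measurable_mulGL measurable_const measurable_subtype_coe

theorem measurable_sigmaWeight (g : Aff2) : Measurable (sigmaWeight g) := by
  have h (i j : Fin 2) : Measurable fun L : K0 => (((L : GL2)⁻¹ : GL2) i j : ℝ) :=
    (measurable_entry i j).comp (measurable_invGL.comp measurable_subtype_coe)
  have hdet : Measurable fun L : K0 =>
      ((facH (g.lin⁻¹ * L) : GL2) : Matrix (Fin 2) (Fin 2) ℝ).det :=
    measurable_det.comp (measurable_subtype_coe.comp (measurable_facH.comp (measurable_shift g)))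
  refine (Complex.measurable_ofReal.comp ((measurable_norm.comp hdet).pow_const _)).mul
    (measurable_e2pi.comp ?_)
  simp only [Matrix.mulVec, dotProduct, Fin.sum_univ_two]
  exact (((((h 0 0).mul_const _).add ((h 0 1).mul_const _)).const_mul _).add
    ((((h 1 0).mul_const _).add ((h 1 1).mul_const _)).const_mul _))

theorem lintegral_sigma (g : Aff2) (f : K0 → ℝ≥0∞) (hf : AEMeasurable f haarK) :
    ∫⁻ L, ‖sigmaWeight g L‖ₑ ^ 2 * f (facK (g.lin⁻¹ * L)) ∂haarK = ∫⁻ L, f L ∂haarK := by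
  simp_rw [enorm_sigmaWeight]
  exact lintegral_act_haarK g.lin f hf

theorem quasi_sigma (g : Aff2) :
    Measure.QuasiMeasurePreserving (fun L : K0 => facK (g.lin⁻¹ * L)) haarK haarK :=
  quasi_twist (measurable_facK.comp (measurable_shift g))
    ((measurable_sigmaWeight g).enorm.pow_const 2)
    (by intro L; rw [enorm_sigmaWeight]; simp [abs_pos, det_ne]) (lintegral_sigma g)

theorem aestronglyMeasurable_sigma (g : Aff2) (F : K0 → L2R) (hF : AEStronglyMeasurable F haarK) :
    AEStronglyMeasurable (fun L : K0 => sigmaWeight g L •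
      (pi1 (facH (g.lin⁻¹ * L))⁻¹).toLinearIsometry (F (facK (g.lin⁻¹ * L)))) haarK := by
  borelize L2R
  refine (measurable_sigmaWeight g).aestronglyMeasurable.smul ?_
  have hC : Measurable fun L : K0 => (facH (g.lin⁻¹ * L))⁻¹ :=
    (Measurable.subtype_mk (measurable_invGL.comp measurable_subtype_coe)).comp
      (measurable_facH.comp (measurable_shift g))
  have hu : StronglyMeasurable (Function.uncurry fun (ξ : L2R) (C : H10) => pi1 C ξ) :=
    stronglyMeasurable_uncurry_of_continuous_of_stronglyMeasurable
      (fun C => (pi1 C).continuous) stronglyMeasurable_pi1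
  refine AEStronglyMeasurable.comp_aemeasurable
    (f := fun L : K0 => (F (facK (g.lin⁻¹ * L)), (facH (g.lin⁻¹ * L))⁻¹))
    (StronglyMeasurable.aestronglyMeasurable hu)
    ((hF.comp_quasiMeasurePreserving (quasi_sigma g)).aemeasurable.prodMk hC.aemeasurable)

/-- The isometry `F ↦ (L ↦ |det C_{A⁻¹L}|^{-1/2} exp(2πi (1,0) L⁻¹ x) π¹(C_{A⁻¹L}⁻¹) F(M_{A⁻¹L}))`
of `L²(K, L²(ℝ*))`, for `g = [x, A]`. -/
def sigmaOp (g : Aff2) : L2KR →ₗᵢ[ℂ] L2KR :=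
  twist haarK (fun L => facK (g.lin⁻¹ * L)) (sigmaWeight g)
    (fun L => (pi1 (facH (g.lin⁻¹ * L))⁻¹).toLinearIsometry)
    (quasi_sigma g) (aestronglyMeasurable_sigma g) (lintegral_sigma g)

theorem coeFn_sigmaOp (g : Aff2) (F : L2KR) : sigmaOp g F =ᵐ[haarK] fun L =>
    sigmaWeight g L • pi1 (facH (g.lin⁻¹ * L))⁻¹ (F (facK (g.lin⁻¹ * L))) :=
  coeFn_twist _ _ _ F

theorem shift_mul (g h : Aff2) (L : K0) : (g * h).lin⁻¹ * (L : GL2) =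
    (h.lin⁻¹ * (facK (g.lin⁻¹ * L) : GL2)) * (facH (g.lin⁻¹ * L) : GL2) := by
  rw [Aff2.mul_lin, mul_inv_rev, mul_assoc, mul_assoc, fac_mul]

/-- The representation `σ` of `G₂` on `L²(K, L²(ℝ*))`:
`(σ[x, A] F)(L) = |det C_{A⁻¹L}|^{-1/2} exp(2πi (1,0) L⁻¹ x) π¹(C_{A⁻¹L}⁻¹) F(M_{A⁻¹L})`. -/
def sigma : Aff2 →* (L2KR ≃ₗᵢ[ℂ] L2KR) :=
  unitaryRep sigmaOp
    (by
      intro F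
      apply Lp.ext
      filter_upwards [coeFn_sigmaOp 1 F] with L h
      rw [h, sigmaWeight, Aff2.one_lin, inv_one, one_mul, (fac_of_mem L).1, (fac_of_mem L).2]
      simp [e2pi_zero, Aff2.one_trans])
    (by
      intro g h F
      apply Lp.ext
      filter_upwards [coeFn_sigmaOp (g * h) F, coeFn_sigmaOp g (sigmaOp h F),
        (quasi_sigma g).ae (coeFn_sigmaOp h F)] with L h1 h2 h3
      rw [h1, h2, h3, map_smul, smul_smul]
      congr 1
      · rw [sigmaWeight, sigmaWeight, sigmaWeight, shift_mul, facH_mul, Subgroup.coe_mul,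
          Matrix.GeneralLinearGroup.coe_mul, Matrix.det_mul, abs_mul,
          Real.mul_rpow (abs_nonneg _) (abs_nonneg _)]
        have e : ![1, 0] ⬝ᵥ ((((L : GL2)⁻¹ : GL2) : Matrix (Fin 2) (Fin 2) ℝ) *ᵥ (g * h).trans) =
            ![1, 0] ⬝ᵥ ((((L : GL2)⁻¹ : GL2) : Matrix (Fin 2) (Fin 2) ℝ) *ᵥ g.trans) +
            ![1, 0] ⬝ᵥ ((((facK (g.lin⁻¹ * L) : GL2)⁻¹ : GL2) :
              Matrix (Fin 2) (Fin 2) ℝ) *ᵥ h.trans) := by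
          rw [Aff2.mul_trans, Matrix.mulVec_add, dotProduct_add, Matrix.dotProduct_mulVec _ _ h.trans,
            Matrix.dotProduct_mulVec _ _ (_ *ᵥ _)]
          have := orb_facK g.lin L
          rw [orb, orb] at this
          rw [this, Matrix.dotProduct_mulVec, Matrix.dotProduct_mulVec _ _ h.trans]
        rw [e, e2pi_add]
        push_cast
        ring
      · rw [shift_mul, facH_mul, facK_mul, mul_inv_rev, map_mul]
        rfl)

theorem coeFn_sigma (g : Aff2) (F : L2KR) : sigma g F =ᵐ[haarK] fun L =>
    sigmaWeight g L • pi1 (facH (g.lin⁻¹ * L))⁻¹ (F (facK (g.lin⁻¹ * L))) :=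
  coeFn_sigmaOp g F

/-! ### The subspaces `𝒦_g` and `ℋ_g` -/

/-- `V_g f (D) = ⟨f, π¹(D) g⟩`, where `⟨·,·⟩` is linear in its first argument
(Mathlib's `inner` is linear in the second). -/
def Vg (g f : L2R) (D : H10) : ℂ := inner ℂ (pi1 D g) f

/-- `𝒦_g = V_g L²(ℝ*)`, as a subspace of `L²(H_(1,0))`. -/
def Kg (g : L2R) : Submodule ℂ L2H where
  carrier := {h | ∃ f : L2R, h =ᵐ[haarH] Vg g f}
  add_mem' := by
    rintro h h' ⟨f, hf⟩ ⟨f', hf'⟩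
    refine ⟨f + f', ?_⟩
    filter_upwards [Lp.coeFn_add h h', hf, hf'] with D h1 h2 h3
    rw [h1, Pi.add_apply, h2, h3, Vg, Vg, Vg, inner_add_right]
  zero_mem' := by
    refine ⟨0, ?_⟩
    filter_upwards [Lp.coeFn_zero ℂ 2 haarH] with D h1
    rw [h1, Vg, inner_zero_right, Pi.zero_apply]
  smul_mem' := by
    rintro c h ⟨f, hf⟩
    refine ⟨c • f, ?_⟩
    filter_upwards [Lp.coeFn_smul c h, hf] with D h1 h2
    rw [h1, Pi.smul_apply, h2, Vg, Vg, inner_smul_right, smul_eq_mul]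

/-- `L²(K, L²(H_(1,0)))`, with `K` identified with `K₀`. -/
abbrev L2KH : Type := Lp L2H 2 haarK

/-- The subspace `L²(K, 𝒦)` of `L²(K, L²(H_(1,0)))`, for a subspace `𝒦` of `L²(H_(1,0))`. -/
def L2K (S : Submodule ℂ L2H) : Submodule ℂ L2KH where
  carrier := {F | ∀ᵐ L ∂haarK, F L ∈ S}
  add_mem' := by
    intro F F' hF hF'
    change ∀ᵐ L ∂haarK, (F + F') L ∈ S
    filter_upwards [Lp.coeFn_add F F', hF, hF'] with L h1 h2 h3
    rw [h1]
    exact S.add_mem h2 h3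
  zero_mem' := by
    filter_upwards [Lp.coeFn_zero L2H 2 haarK] with L h1
    rw [h1]
    exact S.zero_mem
  smul_mem' := by
    intro c F hF
    change ∀ᵐ L ∂haarK, (c • F) L ∈ S
    filter_upwards [Lp.coeFn_smul c F, hF] with L h1 h2
    rw [h1]
    exact S.smul_mem c h2

/-- The graph of `W₁ : L²(GL₂(ℝ)) → L²(K, L²(H_(1,0)))`, `(W₁ f (L))(C) = |det C|^{1/2} f(L C)`;
here `f'` is a function in the class `f`. -/
def IsW1 (f : L2GL) (F : L2KH) : Prop :=
  ∃ f' : GL2 → ℂ, f =ᵐ[haarGL] f' ∧ ∀ᵐ L ∂haarK, F L =ᵐ[haarH] fun C =>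
    ((|((C : GL2) : Matrix (Fin 2) (Fin 2) ℝ).det| ^ (1 / 2 : ℝ) : ℝ) : ℂ) *
      f' ((L : GL2) * (C : GL2))

/-- `ℋ_g = W₁⁻¹ L²(K, 𝒦_g)`, as a subspace of `L²(GL₂(ℝ))`. -/
def Hg (g : L2R) : Submodule ℂ L2GL where
  carrier := {f | ∃ F ∈ L2K (Kg g), IsW1 f F}
  add_mem' := by
    rintro f₁ f₂ ⟨F₁, hF₁, f₁', h₁, hW₁⟩ ⟨F₂, hF₂, f₂', h₂, hW₂⟩
    refine ⟨F₁ + F₂, Submodule.add_mem _ hF₁ hF₂, f₁' + f₂', (Lp.coeFn_add f₁ f₂).trans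
      (h₁.add h₂), ?_⟩
    filter_upwards [Lp.coeFn_add F₁ F₂, hW₁, hW₂] with L hL h1 h2
    rw [hL, Pi.add_apply]
    filter_upwards [Lp.coeFn_add (F₁ L) (F₂ L), h1, h2] with C hC e1 e2
    rw [hC, Pi.add_apply, e1, e2, Pi.add_apply, mul_add]
  zero_mem' := by
    refine ⟨0, Submodule.zero_mem _, 0, Lp.coeFn_zero ℂ 2 haarGL, ?_⟩
    filter_upwards [Lp.coeFn_zero L2H 2 haarK] with L hL
    rw [hL, Pi.zero_apply]
    filter_upwards [Lp.coeFn_zero ℂ 2 haarH] with C hC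
    rw [hC, Pi.zero_apply, Pi.zero_apply, mul_zero]
  smul_mem' := by
    rintro c f ⟨F, hF, f', h, hW⟩
    refine ⟨c • F, Submodule.smul_mem _ c hF, c • f', (Lp.coeFn_smul c f).trans
      (h.fun_const_smul c), ?_⟩
    filter_upwards [Lp.coeFn_smul c F, hW] with L hL h1
    rw [hL, Pi.smul_apply]
    filter_upwards [Lp.coeFn_smul c (F L), h1] with C hC e1
    rw [hC, Pi.smul_apply, e1, Pi.smul_apply, smul_eq_mul, smul_eq_mul, mul_left_comm]

section Rep

variable {G H H' : Type*} [Group G] [NormedAddCommGroup H] [InnerProductSpace ℂ H]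
  [NormedAddCommGroup H'] [InnerProductSpace ℂ H']

/-- The subspace `S` is invariant under the unitary representation `ρ`. -/
def Invariant (ρ : G →* (H ≃ₗᵢ[ℂ] H)) (S : Submodule ℂ H) : Prop :=
  ∀ x : G, ∀ f ∈ S, ρ x f ∈ S

/-- The restriction of `ρ` to the invariant subspace `S` is unitarily equivalent to `τ`. -/
def RestrictionEquivalent (ρ : G →* (H ≃ₗᵢ[ℂ] H)) (S : Submodule ℂ H) (hS : Invariant ρ S)
    (τ : G →* (H' ≃ₗᵢ[ℂ] H')) : Prop :=
  ∃ U : S ≃ₗᵢ[ℂ] H', ∀ (x : G) (f : S), U ⟨ρ x f, hS x f f.2⟩ = τ x (U f)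

end Rep

end AffPlane

end

open AffPlane MeasureTheory

noncomputable section

namespace AffPlane

open MeasureTheory Set
open scoped ENNReal Matrix

/-! ### Square-integrable functions and their sections -/

section SquareIntegrable

variable {X Y E : Type*} [MeasurableSpace X] [MeasurableSpace Y] [NormedAddCommGroup E]

/-! Everything rests on one unitary model of all the transforms `V_g` at once. Writing out the inner
product and substituting `c = 1/b` gives, for `C = (1 0; u v)`, `V_g ξ (C) = ∫ e^{-2πi u c} |c|⁻¹
ξ(1/c) conj(g(1/(v c))) dc`, so for fixed `v` the transform is a Fourier integral in `u`
(`fourier_kern`). Plancherel in `u`, followed by the substitution `b = 1/c`, `t = 1/(v c)`, under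
which `c⁻² dc dv/v²` becomes `db/|b| dt` (`lintegral_btCoord`), yields a unitary map `modelEquiv`
from `L²(ℝ*, L²(𝒪₁))` onto `L²(H_(1,0))` that sends `ξ ⊗ conj g` to `V_g ξ` (`coeFn_voice`). This is
why `g` is normalised by Lebesgue measure: for such `g` the map `V_g` is isometric, and `𝒦_g` is the
image of `L²(ℝ*, ℂ conj g)`. The assumption `g ∈ L²(ℝ*)` gives meaning to `V_g` and makes the
Fourier integral absolutely convergent.

If the `g_j` form an orthonormal basis of `L²(𝒪₁)`, so do their conjugates (`isHilbertSum_star`).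
Hilbert sums survive passage to `L²(μ, ·)` (`isHilbertSum_lpMap`) and unitary maps
(`isHilbertSum_comp_equiv`). Hence `L²(H_(1,0))` is the Hilbert sum of the `𝒦_{g_j}`, next `L²(K,
L²(H_(1,0)))` is that of the `L²(K, 𝒦_{g_j})`, and `W₁⁻¹` carries this to `L²(GL₂(ℝ))`. That `W₁` is
unitary is the disintegration of Haar measure along `A = M_A C_A`, with density `|det C_A|`
(`lintegral_haarK_haarH`).

Finally `F ↦ W₁⁻¹(L ↦ V_g F(L))` is an isometry of `L²(K, L²(ℝ*))` with range `ℋ_g` (`Hg_eq_range`),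
so `ℋ_g` is closed. Its pointwise formula (`coeFn_embed`) shows that it intertwines `σ` with
`π^(1,0)` (`embed_sigma`), which gives both the invariance of `ℋ_g` and the equivalence. -/

theorem memLp_of_lintegral_lt_top {μ : Measure X} {f : X → E} (hf : AEStronglyMeasurable f μ)
    (h : ∫⁻ x, ‖f x‖ₑ ^ 2 ∂μ < ∞) : MemLp f 2 μ :=
  ⟨hf, by rw [eLpNorm_two]; exact ENNReal.rpow_lt_top_of_nonneg (by norm_num) h.ne⟩

theorem lintegral_enorm_sq_lt_top {μ : Measure X} {f : X → E} (hf : MemLp f 2 μ) :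
    ∫⁻ x, ‖f x‖ₑ ^ 2 ∂μ < ∞ := by
  have := hf.2
  rw [eLpNorm_two] at this
  exact (ENNReal.rpow_lt_top_iff_of_pos (by norm_num)).1 this

theorem enorm_sq_toLp {ν : Measure Y} {f : Y → ℂ} (hf : MemLp f 2 ν) :
    ‖hf.toLp f‖ₑ ^ 2 = ∫⁻ y, ‖f y‖ₑ ^ 2 ∂ν := by
  rw [Lp.enorm_toLp, eLpNorm_two, ← ENNReal.rpow_natCast, ← ENNReal.rpow_mul]
  norm_num

theorem dist_toLp {ν : Measure Y} {f : Y → ℂ} (hf : MemLp f 2 ν) (η : Lp ℂ 2 ν) :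
    dist (hf.toLp f) η = ((∫⁻ y, ‖f y - η y‖ₑ ^ 2 ∂ν) ^ (1 / 2 : ℝ)).toReal := by
  rw [Lp.dist_def, eLpNorm_two]
  congr 2
  apply lintegral_congr_ae
  filter_upwards [hf.coeFn_toLp] with y hy
  rw [Pi.sub_apply, hy]

theorem lp_ext₂ {μ : Measure X} {ν : Measure Y} {F G : Lp (Lp ℂ 2 ν) 2 μ}
    (h : ∀ᵐ x ∂μ, F x =ᵐ[ν] G x) : F = G := by
  apply Lp.ext
  filter_upwards [h] with x hx
  exact Lp.ext hx

open Classical in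
/-- The section of a function on a product over `x`, as an element of `L²(ν)` if it is one. -/
def slice (ν : Measure Y) (f : X × Y → ℂ) (x : X) : Lp ℂ 2 ν :=
  if h : MemLp (fun y => f (x, y)) 2 ν then h.toLp else 0

theorem memLp_slice_iff {ν : Measure Y} {f : X × Y → ℂ} (hf : StronglyMeasurable f) (x : X) :
    MemLp (fun y => f (x, y)) 2 ν ↔ ∫⁻ y, ‖f (x, y)‖ₑ ^ 2 ∂ν < ∞ :=
  ⟨lintegral_enorm_sq_lt_top, memLp_of_lintegral_lt_top
    (hf.comp_measurable measurable_prodMk_left).aestronglyMeasurable⟩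

theorem memLp_indicator_mul {μ : Measure X} {ν : Measure Y} [SFinite ν] {s : Set X}
    (hs : MeasurableSet s) (hμ : μ s ≠ ∞) (ξ : Lp ℂ 2 ν) :
    MemLp (fun p : X × Y => s.indicator (fun _ => (1 : ℂ)) p.1 * ξ p.2) 2 (μ.prod ν) := by
  have h1 : StronglyMeasurable fun p : X × Y => s.indicator (fun _ => (1 : ℂ)) p.1 * ξ p.2 :=
    ((stronglyMeasurable_const.indicator hs).comp_measurable measurable_fst).mul
      ((Lp.stronglyMeasurable ξ).comp_measurable measurable_snd)
  refine memLp_of_lintegral_lt_top h1.aestronglyMeasurable ?_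
  have e : ∀ p : X × Y, ‖s.indicator (fun _ => (1 : ℂ)) p.1 * ξ p.2‖ₑ ^ 2 =
      s.indicator 1 p.1 * ‖ξ p.2‖ₑ ^ 2 := by
    intro p
    by_cases hp : p.1 ∈ s <;> simp [hp]
  simp_rw [e]
  rw [lintegral_prod_mul (measurable_one.indicator hs).aemeasurable
    ((Lp.stronglyMeasurable ξ).measurable.enorm.pow_const 2).aemeasurable,
    lintegral_indicator_one hs]
  exact ENNReal.mul_lt_top hμ.lt_top (lintegral_enorm_sq_lt_top (Lp.memLp ξ))

theorem ae_memLp_slice {μ : Measure X} {ν : Measure Y} [SFinite ν] {f : X × Y → ℂ}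
    (hs : StronglyMeasurable f) (hf : MemLp f 2 (μ.prod ν)) :
    ∀ᵐ x ∂μ, MemLp (fun y => f (x, y)) 2 ν := by
  have h := lintegral_enorm_sq_lt_top hf
  have hm : Measurable fun p => ‖f p‖ₑ ^ 2 := hs.measurable.enorm.pow_const 2
  rw [lintegral_prod _ hm.aemeasurable] at h
  filter_upwards [ae_lt_top hm.lintegral_prod_right' h.ne] with x hx
  exact (memLp_slice_iff hs x).2 hx

theorem ae_slice_eq {μ : Measure X} {ν : Measure Y} [SFinite ν] {f : X × Y → ℂ}
    (hs : StronglyMeasurable f) (hf : MemLp f 2 (μ.prod ν)) :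
    ∀ᵐ x ∂μ, slice ν f x =ᵐ[ν] fun y => f (x, y) := by
  filter_upwards [ae_memLp_slice hs hf] with x hx
  rw [slice, dif_pos hx]
  exact hx.coeFn_toLp

/-- Tonelli's theorem; the sections that `slice` replaces by zero lie over a null set. -/
theorem eLpNorm_slice {μ : Measure X} {ν : Measure Y} [SFinite ν] {f : X × Y → ℂ}
    (hs : StronglyMeasurable f) (hf : MemLp f 2 (μ.prod ν)) :
    eLpNorm (slice ν f) 2 μ = eLpNorm f 2 (μ.prod ν) := by
  have hm : Measurable fun p => ‖f p‖ₑ ^ 2 := hs.measurable.enorm.pow_const 2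
  rw [eLpNorm_two, eLpNorm_two, lintegral_prod _ hm.aemeasurable]
  congr 1
  apply lintegral_congr_ae
  filter_upwards [ae_memLp_slice hs hf] with x hx
  rw [slice, dif_pos hx, enorm_sq_toLp]

end SquareIntegrable

/-! ### Applying an isometry pointwise in a vector-valued L² space -/

section LpMaps

variable {X Y E F : Type*} [MeasurableSpace X] [MeasurableSpace Y]
  [NormedAddCommGroup E] [InnerProductSpace ℂ E] [NormedAddCommGroup F] [InnerProductSpace ℂ F]

/-- The isometry `L²(μ, E) → L²(μ, F)` of composition with an isometry `E → F`. -/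
def lpMap (μ : Measure X) (V : E →ₗᵢ[ℂ] F) : Lp E 2 μ →ₗᵢ[ℂ] Lp F 2 μ where
  toLinearMap := V.toContinuousLinearMap.compLpₗ 2 μ
  norm_map' f := by
    rw [Lp.norm_def, Lp.norm_def]
    congr 1
    refine eLpNorm_congr_norm_ae ?_
    filter_upwards [V.toContinuousLinearMap.coeFn_compLp f] with x hx
    rw [← V.norm_map (f x)]
    exact congrArg _ hx

theorem coeFn_lpMap {μ : Measure X} (V : E →ₗᵢ[ℂ] F) (f : Lp E 2 μ) :
    ∀ᵐ x ∂μ, lpMap μ V f x = V (f x) :=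
  V.toContinuousLinearMap.coeFn_compLp f

/-- The unitary map `L²(μ, E) → L²(μ, F)` of composition with a unitary map `E → F`. -/
def lpMapEquiv (μ : Measure X) (V : E ≃ₗᵢ[ℂ] F) : Lp E 2 μ ≃ₗᵢ[ℂ] Lp F 2 μ :=
  LinearIsometryEquiv.ofSurjective (lpMap μ V.toLinearIsometry) fun f =>
    ⟨lpMap μ V.symm.toLinearIsometry f, by
      apply Lp.ext
      filter_upwards [coeFn_lpMap V.toLinearIsometry (lpMap μ V.symm.toLinearIsometry f),
        coeFn_lpMap V.symm.toLinearIsometry f] with x h1 h2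
      rw [h1, h2]
      exact V.apply_symm_apply _⟩

theorem coeFn_lpMapEquiv {μ : Measure X} (V : E ≃ₗᵢ[ℂ] F) (f : Lp E 2 μ) :
    ∀ᵐ x ∂μ, lpMapEquiv μ V f x = V (f x) :=
  coeFn_lpMap V.toLinearIsometry f

/-- Simple functions are dense, so a closed subspace is everything once it contains each `1_s c`.
This serves both the surjectivity of currying and the totality of Hilbert sums. -/
theorem submodule_lp_eq_top {μ : Measure X} (M : Submodule ℂ (Lp E 2 μ))
    (hM : IsClosed (M : Set (Lp E 2 μ)))
    (h : ∀ (s : Set X) (hs : MeasurableSet s) (hμ : μ s ≠ ∞) (c : E),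
      indicatorConstLp 2 hs hμ c ∈ M) : M = ⊤ := by
  rw [Submodule.eq_top_iff']
  intro f
  refine Lp.induction (by norm_num) (motive := fun f => f ∈ M) ?_ ?_ hM f
  · intro c s hs hμ
    rw [Lp.simpleFunc.coe_indicatorConst]
    exact h s hs hμ.ne c
  · intro f g hf hg _ h1 h2
    exact M.add_mem h1 h2

theorem isClosed_range_isometry [CompleteSpace E] (V : E →ₗᵢ[ℂ] F) :
    IsClosed (V.toLinearMap.range : Set F) := by
  rw [LinearMap.coe_range]
  exact V.isometry.isClosedEmbedding.isClosed_range

end LpMaps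

/-! ### The identification of L²(μ × ν) with L²(μ, L²(ν)) -/

section Curry

variable {X Y : Type*} [MeasurableSpace X] [MeasurableSpace Y]
  [MeasurableSpace.CountablyGenerated Y]

theorem secondCountable_lp (ν : Measure Y) [SFinite ν] : SecondCountableTopology (Lp ℂ 2 ν) :=
  have : Fact ((2 : ℝ≥0∞) ≠ ∞) := ⟨by norm_num⟩
  Lp.SecondCountableTopology

/-- As `L²(ν)` is second countable, it suffices that the distance to each fixed `η` is measurable,
and this distance is the square root of a parameter integral wherever the section lies in `L²`. -/
theorem stronglyMeasurable_slice (ν : Measure Y) [SFinite ν] {f : X × Y → ℂ}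
    (hf : StronglyMeasurable f) : StronglyMeasurable (slice ν f) := by
  classical
  have := secondCountable_lp ν
  borelize ↥(Lp ℂ 2 ν)
  refine Measurable.stronglyMeasurable (measurable_of_dist fun η => ?_)
  have hS : MeasurableSet {x : X | MemLp (fun y => f (x, y)) 2 ν} := by
    simp_rw [memLp_slice_iff hf]
    exact measurableSet_lt (Measurable.lintegral_prod_right' (hf.measurable.enorm.pow_const 2))
      measurable_const
  have e : (fun x => dist (slice ν f x) η) = fun x => if MemLp (fun y => f (x, y)) 2 ν then
      ((∫⁻ y, ‖f (x, y) - η y‖ₑ ^ 2 ∂ν) ^ (1 / 2 : ℝ)).toReal else dist 0 η := by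
    ext x
    by_cases h : MemLp (fun y => f (x, y)) 2 ν
    · rw [slice, dif_pos h, if_pos h, dist_toLp]
    · rw [slice, dif_neg h, if_neg h]
  rw [e]
  refine Measurable.ite hS ?_ measurable_const
  refine ((Measurable.lintegral_prod_right' (f := fun p : X × Y => ‖f p - η p.2‖ₑ ^ 2)
    ?_).pow_const _).ennreal_toReal
  exact (hf.measurable.sub ((Lp.stronglyMeasurable η).measurable.comp
    measurable_snd)).enorm.pow_const 2

variable {μ : Measure X} {ν : Measure Y} [SFinite μ] [SFinite ν]

theorem memLp_slice {f : X × Y → ℂ} (hs : StronglyMeasurable f) (hf : MemLp f 2 (μ.prod ν)) :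
    MemLp (slice ν f) 2 μ :=
  ⟨(stronglyMeasurable_slice ν hs).aestronglyMeasurable, by rw [eLpNorm_slice hs hf]; exact hf.2⟩

theorem coeFn_toLp_slice (f : Lp ℂ 2 (μ.prod ν)) :
    ∀ᵐ x ∂μ, (memLp_slice (Lp.stronglyMeasurable f) (Lp.memLp f)).toLp (slice ν f) x =ᵐ[ν]
      fun y => f (x, y) := by
  filter_upwards [(memLp_slice (Lp.stronglyMeasurable f) (Lp.memLp f)).coeFn_toLp,
    ae_slice_eq (Lp.stronglyMeasurable f) (Lp.memLp f)] with x h1 h2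
  rw [h1]
  exact h2

/-- The isometry `L²(μ × ν) → L²(μ, L²(ν))`. -/
def curryIsometry (μ : Measure X) (ν : Measure Y) [SFinite μ] [SFinite ν] :
    Lp ℂ 2 (μ.prod ν) →ₗᵢ[ℂ] Lp (Lp ℂ 2 ν) 2 μ where
  toFun f := (memLp_slice (Lp.stronglyMeasurable f) (Lp.memLp f)).toLp
  map_add' f g := by
    apply lp_ext₂
    filter_upwards [coeFn_toLp_slice (f + g), coeFn_toLp_slice f, coeFn_toLp_slice g,
      Measure.ae_ae_of_ae_prod (Lp.coeFn_add f g),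
      Lp.coeFn_add ((memLp_slice (Lp.stronglyMeasurable f) (Lp.memLp f)).toLp (slice ν f))
        ((memLp_slice (Lp.stronglyMeasurable g) (Lp.memLp g)).toLp (slice ν g))]
      with x h1 h2 h3 h4 h5
    rw [h5, Pi.add_apply]
    filter_upwards [h1, h2, h3, h4, Lp.coeFn_add
      ((memLp_slice (Lp.stronglyMeasurable f) (Lp.memLp f)).toLp (slice ν f) x)
      ((memLp_slice (Lp.stronglyMeasurable g) (Lp.memLp g)).toLp (slice ν g) x)]
      with y e1 e2 e3 e4 e5
    rw [e5, Pi.add_apply, e1, e2, e3, e4, Pi.add_apply]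
  map_smul' c f := by
    apply lp_ext₂
    filter_upwards [coeFn_toLp_slice (c • f), coeFn_toLp_slice f,
      Measure.ae_ae_of_ae_prod (Lp.coeFn_smul c f),
      Lp.coeFn_smul c ((memLp_slice (Lp.stronglyMeasurable f) (Lp.memLp f)).toLp (slice ν f))]
      with x h1 h2 h4 h5
    rw [RingHom.id_apply, h5, Pi.smul_apply]
    filter_upwards [h1, h2, h4, Lp.coeFn_smul c
      ((memLp_slice (Lp.stronglyMeasurable f) (Lp.memLp f)).toLp (slice ν f) x)]
      with y e1 e2 e4 e5
    rw [e5, Pi.smul_apply, e1, e2, e4, Pi.smul_apply]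
  norm_map' f := by
    simp only [LinearMap.coe_mk, AddHom.coe_mk]
    rw [Lp.norm_toLp, eLpNorm_slice (Lp.stronglyMeasurable f) (Lp.memLp f)]
    rfl

theorem coeFn_curryIsometry (f : Lp ℂ 2 (μ.prod ν)) :
    ∀ᵐ x ∂μ, curryIsometry μ ν f x =ᵐ[ν] fun y => f (x, y) :=
  coeFn_toLp_slice f

/-- The range of an isometry is closed, and it contains `1_s ξ` as the image of the product function
`1_s(x) ξ(y)`. -/
theorem curryIsometry_surjective : Function.Surjective (curryIsometry μ ν) := by
  have h := submodule_lp_eq_top (curryIsometry μ ν).toLinearMap.range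
    (isClosed_range_isometry _) (by
      intro s hs hμ ξ
      refine ⟨(memLp_indicator_mul hs hμ ξ).toLp, lp_ext₂ ?_⟩
      filter_upwards [coeFn_curryIsometry (memLp_indicator_mul hs hμ ξ).toLp,
        Measure.ae_ae_of_ae_prod (memLp_indicator_mul hs hμ ξ).coeFn_toLp,
        indicatorConstLp_coeFn (p := 2) (hs := hs) (hμs := hμ) (c := ξ)] with x h1 h2 h3
      refine h1.trans (Filter.EventuallyEq.trans (show _ =ᵐ[ν] _ from h2) ?_)
      rw [h3]
      by_cases hx : x ∈ s
      · simp [hx]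
      · simp only [hx, not_false_eq_true, indicator_of_notMem, zero_mul]
        exact (Lp.coeFn_zero ℂ 2 ν).symm)
  exact LinearMap.range_eq_top.1 h

/-- The unitary map `L²(μ × ν) → L²(μ, L²(ν))`. -/
def curryEquiv (μ : Measure X) (ν : Measure Y) [SFinite μ] [SFinite ν] :
    Lp ℂ 2 (μ.prod ν) ≃ₗᵢ[ℂ] Lp (Lp ℂ 2 ν) 2 μ :=
  LinearIsometryEquiv.ofSurjective (curryIsometry μ ν) curryIsometry_surjective

theorem coeFn_curryEquiv (f : Lp ℂ 2 (μ.prod ν)) :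
    ∀ᵐ x ∂μ, curryEquiv μ ν f x =ᵐ[ν] fun y => f (x, y) :=
  coeFn_toLp_slice f

end Curry

/-! ### Weighted composition operators between L² spaces -/

section WeightedComposition

variable {X Y : Type*} [MeasurableSpace X] [MeasurableSpace Y] {m : Measure X} {n : Measure Y}
  {φ : Y → X} {ψ : X → Y} {w : Y → ℂ}

/-- Testing the change-of-variables formula on the indicator of a null set `s` shows that `|w|²`
vanishes almost everywhere on `φ⁻¹ s`; since `w` is almost nowhere zero, `φ⁻¹ s` is null. -/
theorem quasi_weighted (hφ : Measurable φ) (hw : Measurable w) (hw0 : ∀ᵐ y ∂n, w y ≠ 0)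
    (hi : ∀ f : X → ℝ≥0∞, Measurable f → ∫⁻ y, ‖w y‖ₑ ^ 2 * f (φ y) ∂n = ∫⁻ x, f x ∂m) :
    Measure.QuasiMeasurePreserving φ n m := by
  refine ⟨hφ, Measure.AbsolutelyContinuous.mk fun s hs h => ?_⟩
  have := hi (s.indicator 1) (measurable_one.indicator hs)
  have hws : Measurable fun y => ‖w y‖ₑ ^ 2 * s.indicator (1 : X → ℝ≥0∞) (φ y) :=
    (hw.enorm.pow_const 2).mul ((measurable_one.indicator hs).comp hφ)
  rw [lintegral_indicator_one hs, h, lintegral_eq_zero_iff hws] at this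
  rw [Measure.map_apply hφ hs, measure_eq_zero_iff_ae_notMem]
  filter_upwards [hw0, this] with y h1 h2 (h3 : φ y ∈ s)
  simp [h1, h3] at h2

theorem eLpNorm_weighted
    (hi : ∀ f : X → ℝ≥0∞, Measurable f → ∫⁻ y, ‖w y‖ₑ ^ 2 * f (φ y) ∂n = ∫⁻ x, f x ∂m)
    (f : Lp ℂ 2 m) : eLpNorm (fun y => w y * f (φ y)) 2 n = eLpNorm f 2 m := by
  rw [eLpNorm_two, eLpNorm_two,
    ← hi (fun x => ‖f x‖ₑ ^ 2) ((Lp.stronglyMeasurable f).measurable.enorm.pow_const 2)]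
  simp_rw [enorm_mul, mul_pow]

theorem memLp_weighted (hφ : Measurable φ) (hw : Measurable w)
    (hi : ∀ f : X → ℝ≥0∞, Measurable f → ∫⁻ y, ‖w y‖ₑ ^ 2 * f (φ y) ∂n = ∫⁻ x, f x ∂m)
    (f : Lp ℂ 2 m) : MemLp (fun y => w y * f (φ y)) 2 n :=
  ⟨(hw.mul ((Lp.stronglyMeasurable f).measurable.comp hφ)).aestronglyMeasurable, by
    rw [eLpNorm_weighted hi]; exact Lp.eLpNorm_lt_top f⟩

/-- The isometry `f ↦ w · (f ∘ φ)` of `L²`-spaces, where `|w|²` compensates the change of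
measure. -/
def weightedIsometry (hφ : Measurable φ) (hw : Measurable w) (hw0 : ∀ᵐ y ∂n, w y ≠ 0)
    (hi : ∀ f : X → ℝ≥0∞, Measurable f → ∫⁻ y, ‖w y‖ₑ ^ 2 * f (φ y) ∂n = ∫⁻ x, f x ∂m) :
    Lp ℂ 2 m →ₗᵢ[ℂ] Lp ℂ 2 n where
  toFun f := (memLp_weighted hφ hw hi f).toLp
  map_add' f g := by
    rw [← MemLp.toLp_add, MemLp.toLp_eq_toLp_iff]
    filter_upwards [(quasi_weighted hφ hw hw0 hi).ae (Lp.coeFn_add f g)] with y hy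
    rw [hy, Pi.add_apply, Pi.add_apply, mul_add]
  map_smul' c f := by
    rw [RingHom.id_apply, ← MemLp.toLp_const_smul, MemLp.toLp_eq_toLp_iff]
    filter_upwards [(quasi_weighted hφ hw hw0 hi).ae (Lp.coeFn_smul c f)] with y hy
    rw [hy, Pi.smul_apply, Pi.smul_apply, smul_eq_mul, smul_eq_mul, mul_left_comm]
  norm_map' f := by
    simp only [LinearMap.coe_mk, AddHom.coe_mk]
    rw [Lp.norm_toLp, eLpNorm_weighted hi]
    rfl

/-- The preimage of `h` is `(h / w) ∘ ψ`. Only `ψ ∘ φ = id` is needed: the norm of this candidate is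
computed after pulling back along `φ`, where the weight cancels. -/
theorem weightedIsometry_surjective (hφ : Measurable φ) (hψ : Measurable ψ) (hw : Measurable w)
    (hw0 : ∀ᵐ y ∂n, w y ≠ 0) (hψφ : ∀ᵐ y ∂n, ψ (φ y) = y)
    (hi : ∀ f : X → ℝ≥0∞, Measurable f → ∫⁻ y, ‖w y‖ₑ ^ 2 * f (φ y) ∂n = ∫⁻ x, f x ∂m) :
    Function.Surjective (weightedIsometry hφ hw hw0 hi) := by
  intro h
  have hm : Measurable fun x => (w (ψ x))⁻¹ * h (ψ x) :=
    (hw.comp hψ).inv.mul ((Lp.stronglyMeasurable h).measurable.comp hψ)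
  have hL : MemLp (fun x => (w (ψ x))⁻¹ * h (ψ x)) 2 m := by
    refine memLp_of_lintegral_lt_top hm.aestronglyMeasurable ?_
    rw [← hi _ (hm.enorm.pow_const 2)]
    refine lt_of_eq_of_lt (lintegral_congr_ae ?_) (lintegral_enorm_sq_lt_top (Lp.memLp h))
    filter_upwards [hw0, hψφ] with y h0 hy
    rw [hy, ← mul_pow, ← enorm_mul, mul_inv_cancel_left₀ h0]
  refine ⟨hL.toLp, Lp.ext ?_⟩
  filter_upwards [(memLp_weighted hφ hw hi hL.toLp).coeFn_toLp, hw0, hψφ,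
    (quasi_weighted hφ hw hw0 hi).ae hL.coeFn_toLp] with y h1 h0 hy h2
  refine h1.trans ?_
  rw [h2, hy, mul_inv_cancel_left₀ h0]

/-- The unitary map `f ↦ w · (f ∘ φ)` of `L²`-spaces, for an almost everywhere invertible `φ`. -/
def weightedEquiv (hφ : Measurable φ) (hψ : Measurable ψ) (hw : Measurable w)
    (hw0 : ∀ᵐ y ∂n, w y ≠ 0) (hψφ : ∀ᵐ y ∂n, ψ (φ y) = y)
    (hi : ∀ f : X → ℝ≥0∞, Measurable f → ∫⁻ y, ‖w y‖ₑ ^ 2 * f (φ y) ∂n = ∫⁻ x, f x ∂m) :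
    Lp ℂ 2 m ≃ₗᵢ[ℂ] Lp ℂ 2 n :=
  LinearIsometryEquiv.ofSurjective (weightedIsometry hφ hw hw0 hi)
    (weightedIsometry_surjective hφ hψ hw hw0 hψφ hi)

theorem coeFn_weightedEquiv (hφ : Measurable φ) (hψ : Measurable ψ) (hw : Measurable w)
    (hw0 : ∀ᵐ y ∂n, w y ≠ 0) (hψφ : ∀ᵐ y ∂n, ψ (φ y) = y)
    (hi : ∀ f : X → ℝ≥0∞, Measurable f → ∫⁻ y, ‖w y‖ₑ ^ 2 * f (φ y) ∂n = ∫⁻ x, f x ∂m)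
    (f : Lp ℂ 2 m) :
    weightedEquiv hφ hψ hw hw0 hψφ hi f =ᵐ[n] fun y => w y * f (φ y) :=
  (memLp_weighted hφ hw hi f).coeFn_toLp

end WeightedComposition

/-! ### Stability properties of Hilbert sums -/

section HilbertSums

/-- Multiplication of a vector by the indicator function of `s`, as an element of `L²`. -/
def indicatorConstLpCLM {X B : Type*} [MeasurableSpace X] [NormedAddCommGroup B]
    [InnerProductSpace ℂ B] (μ : Measure X) (s : Set X) (hs : MeasurableSet s) (hμ : μ s ≠ ∞) :
    B →L[ℂ] Lp B 2 μ :=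
  LinearMap.mkContinuous
    { toFun := fun b => indicatorConstLp 2 hs hμ b
      map_add' := fun b b' => by
        rw [indicatorConstLp, indicatorConstLp, indicatorConstLp, ← MemLp.toLp_add]
        congr 1
        exact indicator_add s _ _
      map_smul' := fun c b => by
        rw [indicatorConstLp, indicatorConstLp, RingHom.id_apply, ← MemLp.toLp_const_smul]
        congr 1
        exact indicator_const_smul s c _ }
    (μ.real s ^ (1 / (2 : ℝ≥0∞).toReal)) fun b => by
      rw [mul_comm]
      exact norm_indicatorConstLp_le (hs := hs) (hμs := hμ)

variable {J A B B' : Type*} [NormedAddCommGroup A] [InnerProductSpace ℂ A] [CompleteSpace A]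
  [NormedAddCommGroup B] [InnerProductSpace ℂ B] [CompleteSpace B]
  [NormedAddCommGroup B'] [InnerProductSpace ℂ B'] [CompleteSpace B']

theorem total_of_isHilbertSum {V : J → A →ₗᵢ[ℂ] B} (h : IsHilbertSum ℂ (fun _ => A) V) :
    (⨆ j, (V j).toLinearMap.range).topologicalClosure = ⊤ := by
  rw [← h.OrthogonalFamily.range_linearIsometry]
  exact LinearMap.range_eq_top.2 h.surjective_isometry

/-- Orthogonality holds pointwise under the integral. For totality it suffices to approximate `1_s
b`, and this follows from approximating `b` in `B`. -/
theorem isHilbertSum_lpMap {X : Type*} [MeasurableSpace X] (μ : Measure X)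
    {V : J → A →ₗᵢ[ℂ] B} (h : IsHilbertSum ℂ (fun _ => A) V) :
    IsHilbertSum ℂ (fun _ => Lp A 2 μ) fun j => lpMap μ (V j) := by
  refine IsHilbertSum.mk ?_ (ge_of_eq (submodule_lp_eq_top _
    (Submodule.isClosed_topologicalClosure _) ?_))
  · intro i j hij F G
    rw [L2.inner_def]
    refine integral_eq_zero_of_ae ?_
    filter_upwards [coeFn_lpMap (V i) F, coeFn_lpMap (V j) G] with x h1 h2
    rw [h1, h2]
    exact h.OrthogonalFamily hij _ _
  · intro s hs hμ b
    -- The map `b ↦ 1_s b` is continuous, so the closed span pulls back to a closed subspace of `B`.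
    -- It contains every range of `V j` because `1_s V_j a = V_j ∘ (1_s a)`.
    let T : B →L[ℂ] Lp B 2 μ := indicatorConstLpCLM μ s hs hμ
    have hb : b ∈ (⨆ j, (V j).toLinearMap.range).topologicalClosure := by
      rw [total_of_isHilbertSum h]; trivial
    have hle : (⨆ j, (V j).toLinearMap.range) ≤
        ((⨆ j, (lpMap μ (V j)).toLinearMap.range).topologicalClosure).comap T.toLinearMap := by
      refine iSup_le fun j => ?_
      rintro _ ⟨a, rfl⟩
      refine Submodule.le_topologicalClosure _ (Submodule.mem_iSup_of_mem j
        ⟨indicatorConstLp 2 hs hμ a, Lp.ext ?_⟩)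
      filter_upwards [coeFn_lpMap (V j) (indicatorConstLp 2 hs hμ a),
        indicatorConstLp_coeFn (p := 2) (hs := hs) (hμs := hμ) (c := a),
        indicatorConstLp_coeFn (p := 2) (hs := hs) (hμs := hμ) (c := V j a)] with x h1 h2 h3
      refine h1.trans ?_
      rw [h2]
      refine Eq.trans ?_ h3.symm
      by_cases hx : x ∈ s <;> simp [hx]
    have := Submodule.topologicalClosure_minimal _ hle
      ((Submodule.isClosed_topologicalClosure _).preimage T.continuous)
    exact this hb

theorem isHilbertSum_comp_equiv (U : B ≃ₗᵢ[ℂ] B') {V : J → A →ₗᵢ[ℂ] B}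
    (h : IsHilbertSum ℂ (fun _ => A) V) :
    IsHilbertSum ℂ (fun _ => A) fun j => U.toLinearIsometry.comp (V j) := by
  have ho : OrthogonalFamily ℂ (fun _ => A) fun j => U.toLinearIsometry.comp (V j) := by
    intro i j hij a b
    exact (U.inner_map_map _ _).trans (h.OrthogonalFamily hij _ _)
  refine IsHilbertSum.mk ho ?_
  intro b _
  have hb : U.symm b ∈ (⨆ j, (V j).toLinearMap.range).topologicalClosure := by
    rw [total_of_isHilbertSum h]; trivial
  have hle : (⨆ j, (V j).toLinearMap.range) ≤
      ((⨆ j, (U.toLinearIsometry.comp (V j)).toLinearMap.range).topologicalClosure).comap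
        U.toLinearEquiv.toLinearMap := by
    refine iSup_le fun j => ?_
    rintro _ ⟨a, rfl⟩
    exact Submodule.le_topologicalClosure _ (Submodule.mem_iSup_of_mem j ⟨a, rfl⟩)
  have := Submodule.topologicalClosure_minimal _ hle
    ((Submodule.isClosed_topologicalClosure _).preimage U.continuous) hb
  simpa using this

/-- Passes from a family of isometric embeddings to the internal sum of their ranges; the ranges are
complete because `A` is. -/
theorem isHilbertSum_range {V : J → A →ₗᵢ[ℂ] B} (h : IsHilbertSum ℂ (fun _ => A) V)
    {S : J → Submodule ℂ B} (hS : ∀ j, S j = (V j).toLinearMap.range) :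
    IsHilbertSum ℂ (fun j => S j) fun j => (S j).subtypeₗᵢ := by
  have hc : ∀ j, CompleteSpace (S j) := fun j => by
    rw [hS j]
    exact (isClosed_range_isometry (V j)).completeSpace_coe
  refine IsHilbertSum.mkInternal _ ?_ ?_
  · rintro i j hij ⟨a, ha⟩ ⟨b, hb⟩
    rw [hS] at ha hb
    obtain ⟨a, rfl⟩ := ha
    obtain ⟨b, rfl⟩ := hb
    exact h.OrthogonalFamily hij a b
  · simp_rw [hS]
    exact (total_of_isHilbertSum h).ge

end HilbertSums

/-! ### Complex conjugation of an orthonormal basis -/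

section Conj

variable {X J : Type*} [MeasurableSpace X] {μ : Measure X}

theorem inner_star_star (f g : Lp ℂ 2 μ) : inner ℂ (star f) (star g) = inner ℂ g f := by
  rw [L2.inner_def, L2.inner_def]
  apply integral_congr_ae
  filter_upwards [Lp.coeFn_star f, Lp.coeFn_star g] with x h1 h2
  rw [h1, h2]
  simp [mul_comm]

theorem orthonormal_star {g : J → Lp ℂ 2 μ} (hg : Orthonormal ℂ g) :
    Orthonormal ℂ fun j => star (g j) := by
  classical
  rw [orthonormal_iff_ite] at *
  intro i j
  rw [inner_star_star, hg]
  simp [eq_comm]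

/-- Since `V_g` is conjugate-linear in `g`, the model sees `conj g_j` rather than `g_j`. Conjugation
is antiunitary: if `h` is orthogonal to every `conj g_j`, then `conj h` is orthogonal to every
`g_j`, hence zero. -/
theorem isHilbertSum_star (g : HilbertBasis J ℂ (Lp ℂ 2 μ)) :
    IsHilbertSum ℂ (fun _ => ℂ) fun j =>
      LinearIsometry.toSpanSingleton ℂ (Lp ℂ 2 μ) ((orthonormal_star g.orthonormal).1 j) := by
  refine (orthonormal_star g.orthonormal).isHilbertSum ?_
  rw [top_le_iff, Submodule.topologicalClosure_eq_top_iff, Submodule.eq_bot_iff]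
  intro h hh
  have h0 : star h = 0 := by
    have h1 : star h ∈ (Submodule.span ℂ (range g))ᗮ := by
      rw [Submodule.mem_orthogonal]
      intro v hv
      induction hv using Submodule.span_induction with
      | mem v hv =>
        obtain ⟨j, rfl⟩ := hv
        rw [← star_star (g j), inner_star_star]
        exact Submodule.inner_left_of_mem_orthogonal (Submodule.subset_span (mem_range_self j)) hh
      | zero => exact inner_zero_left _
      | add v v' _ _ h1 h2 => rw [inner_add_left, h1, h2, add_zero]
      | smul c v _ h1 => rw [inner_smul_left, h1, mul_zero]
    rw [(Submodule.topologicalClosure_eq_top_iff).1 g.dense_span] at h1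
    exact h1
  rw [← inner_self_eq_zero (𝕜 := ℂ), ← inner_star_star, h0, inner_zero_left]

end Conj

/-! ### Lebesgue integrals in the coordinates of the factorisation -/

section ChangeOfVariables

theorem lintegral_finTwo {G : ℝ × ℝ → ℝ≥0∞} (hG : Measurable G) :
    ∫⁻ x : Fin 2 → ℝ, G (x 0, x 1) = ∫⁻ z, G z :=
  (volume_preserving_finTwoArrow ℝ).lintegral_comp hG

theorem lintegral_linear_two {G : ℝ × ℝ → ℝ≥0∞} (hG : Measurable G) {a b c d : ℝ}
    (h : a * d - b * c ≠ 0) :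
    ∫⁻ z, G z = ENNReal.ofReal |a * d - b * c| *
      ∫⁻ z : ℝ × ℝ, G (a * z.1 + b * z.2, c * z.1 + d * z.2) := by
  have hM : (!![a, b; c, d]).det ≠ 0 := by rwa [Matrix.det_fin_two_of]
  have hv := Real.map_matrix_volume_pi_eq_smul_volume_pi hM
  set T := Matrix.toLin' !![a, b; c, d] with hT
  have hTm : Measurable T := (LinearMap.continuous_on_pi T).measurable
  have hG' : Measurable fun x : Fin 2 → ℝ => G (x 0, x 1) := by fun_prop
  have e := lintegral_map (μ := volume) hG' hTm
  rw [hv, lintegral_smul_measure, lintegral_finTwo hG] at e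
  have e2 : ∫⁻ x : Fin 2 → ℝ, G ((T x) 0, (T x) 1) =
      ∫⁻ z : ℝ × ℝ, G (a * z.1 + b * z.2, c * z.1 + d * z.2) := by
    rw [← lintegral_finTwo (by fun_prop)]
    apply lintegral_congr
    intro x
    simp [hT, Matrix.mulVec, dotProduct, Fin.sum_univ_two]
  rw [← e2, ← e, Matrix.det_fin_two_of, smul_eq_mul, ← mul_assoc,
    ← ENNReal.ofReal_mul (abs_nonneg _), ← abs_mul, mul_inv_cancel₀ h]
  simp

theorem lintegral_mul_left {G : ℝ → ℝ≥0∞} (hG : Measurable G) {a : ℝ} (ha : a ≠ 0) :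
    ∫⁻ x, G x = ENNReal.ofReal |a| * ∫⁻ x, G (a * x) := by
  have e := lintegral_map (μ := volume) hG (measurable_const_mul a)
  rw [Real.map_volume_mul_left ha, lintegral_smul_measure] at e
  rw [← e, smul_eq_mul, ← mul_assoc, ← ENNReal.ofReal_mul (abs_nonneg _), ← abs_mul,
    mul_inv_cancel₀ ha]
  simp

/-- Scale invariance of `dx/|x|`, here for functions on all of `ℝ`. -/
theorem lintegral_abs_inv_mul_left {G : ℝ → ℝ≥0∞} (hG : Measurable G) {a : ℝ} (ha : a ≠ 0) :
    ∫⁻ x, ENNReal.ofReal |x|⁻¹ * G x = ∫⁻ x, ENNReal.ofReal |x|⁻¹ * G (a * x) := by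
  rw [lintegral_mul_left (by fun_prop) ha, ← lintegral_const_mul _ (by fun_prop)]
  apply lintegral_congr
  intro x
  rw [← mul_assoc, ← ENNReal.ofReal_mul (abs_nonneg _), abs_mul, mul_inv,
    mul_inv_cancel_left₀ (abs_ne_zero.2 ha)]

theorem ae_prod_real_ne : ∀ᵐ z : ℝ × ℝ, z.1 ^ 2 + z.2 ^ 2 ≠ 0 := by
  filter_upwards [compl_mem_ae_iff.2 (measure_singleton (μ := volume) ((0, 0) : ℝ × ℝ))] with z hz h
  apply hz
  have h1 : z.1 = 0 := by nlinarith [sq_nonneg z.1, sq_nonneg z.2]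
  have h2 : z.2 = 0 := by nlinarith [sq_nonneg z.1, sq_nonneg z.2]
  exact Prod.ext h1 h2

theorem ae_real_ne : ∀ᵐ x : ℝ, x ≠ 0 :=
  compl_mem_ae_iff.2 (measure_singleton (μ := volume) (0 : ℝ))

/-- Lebesgue measure divided by `det²`, in the coordinates `ω`, `u`, `v` of the factorisation
`A = γ(ω) (1 0; u v)`. -/
theorem lintegral_cols {F : ℝ → ℝ → ℝ → ℝ → ℝ≥0∞}
    (hF : Measurable fun p : ℝ × ℝ × ℝ × ℝ => F p.1 p.2.1 p.2.2.1 p.2.2.2) :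
    ∫⁻ ω : ℝ × ℝ, ENNReal.ofReal (ω.1 ^ 2 + ω.2 ^ 2)⁻¹ * ∫⁻ u : ℝ, ∫⁻ v : ℝ,
      ENNReal.ofReal |v|⁻¹ * F ((ω.1 ^ 2 + ω.2 ^ 2)⁻¹ * (ω.1 - u * ω.2))
        ((ω.1 ^ 2 + ω.2 ^ 2)⁻¹ * (ω.2 + u * ω.1)) ((ω.1 ^ 2 + ω.2 ^ 2)⁻¹ * (v * -ω.2))
        ((ω.1 ^ 2 + ω.2 ^ 2)⁻¹ * (v * ω.1)) =
    ∫⁻ c : ℝ × ℝ, ∫⁻ b : ℝ × ℝ, ENNReal.ofReal ((b.1 * c.2 - c.1 * b.2) ^ 2)⁻¹ *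
      F b.1 b.2 c.1 c.2 := by
  have hFc {Z : Type} [MeasurableSpace Z] {a b c d : Z → ℝ} (ha : Measurable a)
      (hb : Measurable b) (hc : Measurable c) (hd : Measurable d) :
      Measurable fun z => F (a z) (b z) (c z) (d z) :=
    hF.comp (ha.prodMk (hb.prodMk (hc.prodMk hd)))
  calc
    -- The substitution `v = ‖ω‖² D` preserves `dv/|v|` and turns the second column into `D (-ω₂,
    -- ω₁)`. The new variable `D` is the determinant of the matrix.
    _ = ∫⁻ ω : ℝ × ℝ, ∫⁻ D : ℝ, ∫⁻ u : ℝ, ENNReal.ofReal (ω.1 ^ 2 + ω.2 ^ 2)⁻¹ *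
          (ENNReal.ofReal |D|⁻¹ * F ((ω.1 ^ 2 + ω.2 ^ 2)⁻¹ * (ω.1 - u * ω.2))
          ((ω.1 ^ 2 + ω.2 ^ 2)⁻¹ * (ω.2 + u * ω.1)) (D * -ω.2) (D * ω.1)) := by
      apply lintegral_congr_ae
      filter_upwards [ae_prod_real_ne] with ω hω
      rw [← lintegral_const_mul _ (Measurable.lintegral_prod_right'
        (f := fun p : ℝ × ℝ => ENNReal.ofReal |p.2|⁻¹ *
          F ((ω.1 ^ 2 + ω.2 ^ 2)⁻¹ * (ω.1 - p.1 * ω.2))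
        ((ω.1 ^ 2 + ω.2 ^ 2)⁻¹ * (ω.2 + p.1 * ω.1)) ((ω.1 ^ 2 + ω.2 ^ 2)⁻¹ * (p.2 * -ω.2))
        ((ω.1 ^ 2 + ω.2 ^ 2)⁻¹ * (p.2 * ω.1)))
        (Measurable.fun_mul (by fun_prop) (hFc (by fun_prop) (by fun_prop) (by fun_prop)
          (by fun_prop))))]
      have hsw := lintegral_lintegral_swap (μ := volume) (ν := volume) (f := fun D u : ℝ =>
        ENNReal.ofReal (ω.1 ^ 2 + ω.2 ^ 2)⁻¹ * (ENNReal.ofReal |D|⁻¹ *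
          F ((ω.1 ^ 2 + ω.2 ^ 2)⁻¹ * (ω.1 - u * ω.2)) ((ω.1 ^ 2 + ω.2 ^ 2)⁻¹ * (ω.2 + u * ω.1))
          (D * -ω.2) (D * ω.1))) (Measurable.aemeasurable (Measurable.fun_mul (by fun_prop)
        (Measurable.fun_mul (by fun_prop) (hFc (by fun_prop) (by fun_prop) (by fun_prop)
          (by fun_prop)))))
      rw [hsw]
      apply lintegral_congr
      intro u
      rw [lintegral_const_mul _ (Measurable.fun_mul (by fun_prop) (hFc (by fun_prop) (by fun_prop)
        (by fun_prop) (by fun_prop)))]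
      congr 1
      rw [lintegral_abs_inv_mul_left (hFc (by fun_prop) (by fun_prop)
        (by fun_prop) (by fun_prop)) hω]
      apply lintegral_congr
      intro D
      congr 2 <;> field_simp
    _ = ∫⁻ D : ℝ, ∫⁻ ω : ℝ × ℝ, ∫⁻ u : ℝ, ENNReal.ofReal (ω.1 ^ 2 + ω.2 ^ 2)⁻¹ *
          (ENNReal.ofReal |D|⁻¹ * F ((ω.1 ^ 2 + ω.2 ^ 2)⁻¹ * (ω.1 - u * ω.2))
          ((ω.1 ^ 2 + ω.2 ^ 2)⁻¹ * (ω.2 + u * ω.1)) (D * -ω.2) (D * ω.1)) := by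
      refine lintegral_lintegral_swap (Measurable.aemeasurable ?_)
      refine Measurable.lintegral_prod_right' (f := fun q : ((ℝ × ℝ) × ℝ) × ℝ =>
        ENNReal.ofReal (q.1.1.1 ^ 2 + q.1.1.2 ^ 2)⁻¹ *
          (ENNReal.ofReal |q.1.2|⁻¹ * F ((q.1.1.1 ^ 2 + q.1.1.2 ^ 2)⁻¹ * (q.1.1.1 - q.2 * q.1.1.2))
          ((q.1.1.1 ^ 2 + q.1.1.2 ^ 2)⁻¹ * (q.1.1.2 + q.2 * q.1.1.1)) (q.1.2 * -q.1.1.2)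
          (q.1.2 * q.1.1.1))) ?_
      exact Measurable.fun_mul (by fun_prop) (Measurable.fun_mul (by fun_prop) (hFc (by fun_prop)
        (by fun_prop) (by fun_prop) (by fun_prop)))
    -- For fixed `D ≠ 0`, put `ω = D⁻¹ (c₂, -c₁)`, so that `c` is the second column, and `u = D⁻¹
    -- p`. The Jacobians are `D⁻²` and `|D|⁻¹`, and `‖ω‖⁻² = D² ‖c‖⁻²`; with the factor `|D|⁻¹`
    -- already present the weight becomes `‖c‖⁻² D⁻²`.
    _ = ∫⁻ D : ℝ, ∫⁻ c : ℝ × ℝ, ∫⁻ p : ℝ, ENNReal.ofReal (c.1 ^ 2 + c.2 ^ 2)⁻¹ *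
          (ENNReal.ofReal (D ^ 2)⁻¹ * F ((c.1 ^ 2 + c.2 ^ 2)⁻¹ * (D * c.2 + p * c.1))
          ((c.1 ^ 2 + c.2 ^ 2)⁻¹ * (-(D * c.1) + p * c.2)) c.1 c.2) := by
      apply lintegral_congr_ae
      filter_upwards [ae_real_ne] with D hD
      have hδ : 0 * 0 - D⁻¹ * -D⁻¹ ≠ 0 := by simpa using hD
      rw [lintegral_linear_two (a := 0) (b := D⁻¹) (c := -D⁻¹) (d := 0)
        (Measurable.lintegral_prod_right' (f := fun q : (ℝ × ℝ) × ℝ =>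
          ENNReal.ofReal (q.1.1 ^ 2 + q.1.2 ^ 2)⁻¹ *
          (ENNReal.ofReal |D|⁻¹ * F ((q.1.1 ^ 2 + q.1.2 ^ 2)⁻¹ * (q.1.1 - q.2 * q.1.2))
          ((q.1.1 ^ 2 + q.1.2 ^ 2)⁻¹ * (q.1.2 + q.2 * q.1.1)) (D * -q.1.2) (D * q.1.1)))
          (Measurable.fun_mul (by fun_prop) (Measurable.fun_mul (by fun_prop) (hFc (by fun_prop)
          (by fun_prop) (by fun_prop) (by fun_prop))))) hδ,
        ← lintegral_const_mul' _ _ (by finiteness)]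
      apply lintegral_congr_ae
      filter_upwards [ae_prod_real_ne] with c hc
      rw [lintegral_mul_left (Measurable.fun_mul (by fun_prop) (Measurable.fun_mul (by fun_prop)
        (hFc (by fun_prop) (by fun_prop) (by fun_prop) (by fun_prop)))) (inv_ne_zero hD),
        ← lintegral_const_mul' _ _ (by finiteness), ← lintegral_const_mul' _ _ (by finiteness)]
      apply lintegral_congr
      intro u
      have h1 : (0 * c.1 + D⁻¹ * c.2) ^ 2 + (-D⁻¹ * c.1 + 0 * c.2) ^ 2 =
          (D ^ 2)⁻¹ * (c.1 ^ 2 + c.2 ^ 2) := by field_simp; ring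
      have h2 : |0 * 0 - D⁻¹ * -D⁻¹| = (D ^ 2)⁻¹ := by
        rw [show 0 * 0 - D⁻¹ * -D⁻¹ = (D ^ 2)⁻¹ by field_simp; ring, abs_of_nonneg (by positivity)]
      simp only [h1, h2, ← mul_assoc]
      congr 1
      · rw [← ENNReal.ofReal_mul (by positivity), ← ENNReal.ofReal_mul (by positivity),
          ← ENNReal.ofReal_mul (by positivity), ← ENNReal.ofReal_mul (by positivity)]
        congr 1
        have := abs_ne_zero.2 hD
        rw [abs_inv, ← sq_abs D]
        field_simp
      · congr 1 <;> field_simp <;> ring_nf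
    _ = ∫⁻ c : ℝ × ℝ, ∫⁻ D : ℝ, ∫⁻ p : ℝ, ENNReal.ofReal (c.1 ^ 2 + c.2 ^ 2)⁻¹ *
          (ENNReal.ofReal (D ^ 2)⁻¹ * F ((c.1 ^ 2 + c.2 ^ 2)⁻¹ * (D * c.2 + p * c.1))
          ((c.1 ^ 2 + c.2 ^ 2)⁻¹ * (-(D * c.1) + p * c.2)) c.1 c.2) := by
      refine lintegral_lintegral_swap (Measurable.aemeasurable ?_)
      refine Measurable.lintegral_prod_right' (f := fun q : (ℝ × (ℝ × ℝ)) × ℝ =>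
        ENNReal.ofReal (q.1.2.1 ^ 2 + q.1.2.2 ^ 2)⁻¹ * (ENNReal.ofReal (q.1.1 ^ 2)⁻¹ *
          F ((q.1.2.1 ^ 2 + q.1.2.2 ^ 2)⁻¹ * (q.1.1 * q.1.2.2 + q.2 * q.1.2.1))
          ((q.1.2.1 ^ 2 + q.1.2.2 ^ 2)⁻¹ * (-(q.1.1 * q.1.2.1) + q.2 * q.1.2.2))
          q.1.2.1 q.1.2.2)) ?_
      exact Measurable.fun_mul (by fun_prop) (Measurable.fun_mul (by fun_prop) (hFc (by fun_prop)
        (by fun_prop) (by fun_prop) (by fun_prop)))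
    -- For fixed `c ≠ 0`, the first column `b` depends linearly on `(D, p)` with determinant
    -- `‖c‖⁻²`; inversely `D = b₁ c₂ - c₁ b₂` and `p = b₁ c₁ + b₂ c₂`.
    _ = _ := by
      apply lintegral_congr_ae
      filter_upwards [ae_prod_real_ne] with c hc
      set N := c.1 ^ 2 + c.2 ^ 2 with hN
      have hδ : (N⁻¹ * c.2) * (N⁻¹ * c.2) - (N⁻¹ * c.1) * -(N⁻¹ * c.1) = N⁻¹ := by
        field_simp; rw [hN]; ring
      rw [lintegral_linear_two (a := N⁻¹ * c.2) (b := N⁻¹ * c.1) (c := -(N⁻¹ * c.1))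
        (d := N⁻¹ * c.2) (Measurable.fun_mul (by fun_prop) (hFc (by fun_prop)
        (by fun_prop) (by fun_prop) (by fun_prop))) (by rw [hδ]; exact inv_ne_zero hc), hδ,
        abs_of_nonneg (by positivity), ← lintegral_const_mul' _ _ (by finiteness),
        Measure.volume_eq_prod, lintegral_prod]
      swap
      · exact Measurable.aemeasurable (Measurable.fun_mul (by fun_prop) (Measurable.fun_mul
          (by fun_prop) (hFc (by fun_prop) (by fun_prop) (by fun_prop) (by fun_prop))))
      apply lintegral_congr
      intro D
      apply lintegral_congr
      intro p
      congr 2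
      · congr 3
        field_simp
        rw [hN]; ring
      · congr 1 <;> ring

end ChangeOfVariables

/-! ### The Haar measures in coordinates and the disintegration of Haar measure on GL₂(ℝ) -/

section Coordinates

/-- Requiring `G` to vanish off the range of the chart removes the restriction to that range, so
singular matrices need no separate null-set argument. -/
theorem lintegral_comap_withDensity {X V : Type*} [MeasurableSpace X] [MeasurableSpace V]
    {c : X → V} (hc : MeasurableEmbedding c) (ν : Measure V) {ρ : X → ℝ≥0∞} (hρ : Measurable ρ)
    {f : X → ℝ≥0∞} (hf : Measurable f) {G : V → ℝ≥0∞}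
    (hG : ∀ x, G (c x) = ρ x * f x) (h0 : ∀ v ∉ range c, G v = 0) :
    ∫⁻ x, f x ∂((ν.comap c).withDensity ρ) = ∫⁻ v, G v ∂ν := by
  rw [lintegral_withDensity_eq_lintegral_mul _ hρ hf]
  simp_rw [Pi.mul_apply, ← hG]
  rw [← hc.lintegral_map, hc.map_comap, ← lintegral_indicator hc.measurableSet_range]
  apply lintegral_congr
  intro v
  by_cases hv : v ∈ range c
  · rw [indicator_of_mem hv]
  · rw [indicator_of_notMem hv, h0 v hv]

theorem sigmaFinite_comap {X V : Type*} [MeasurableSpace X] [MeasurableSpace V] {c : X → V}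
    (hc : MeasurableEmbedding c) (ν : Measure V) [SigmaFinite ν] : SigmaFinite (ν.comap c) := by
  refine ⟨⟨⟨fun n => c ⁻¹' spanningSets ν n, fun _ => trivial, fun n => ?_, ?_⟩⟩⟩
  · rw [hc.comap_preimage]
    exact (measure_mono inter_subset_left).trans_lt (measure_spanningSets_lt_top ν n)
  · rw [← preimage_iUnion, iUnion_spanningSets, preimage_univ]

theorem lintegral_lebO1 (g : ℝ → ℝ≥0∞) : ∫⁻ v : ℝˣ, g v ∂lebO1 = ∫⁻ v : ℝ, g v := by
  rw [lebO1, ← measurableEmbedding_unitsVal.lintegral_map, measurableEmbedding_unitsVal.map_comap,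
    range_unitsVal, restrict_compl_singleton]

/-- The matrix `(1 0; u v)`. -/
def hMat (v : ℝˣ) (u : ℝ) : H10 :=
  ⟨Matrix.GeneralLinearGroup.mkOfDetNeZero !![1, 0; u, (v : ℝ)] (by
    rw [Matrix.det_fin_two_of]; simp), by
    simp [mem_H10, Matrix.GeneralLinearGroup.mkOfDetNeZero]⟩

theorem hMat_10 (v : ℝˣ) (u : ℝ) : (hMat v u : GL2) 1 0 = u := rfl

theorem hMat_11 (v : ℝˣ) (u : ℝ) : (hMat v u : GL2) 1 1 = v := rfl

theorem det_hMat (v : ℝˣ) (u : ℝ) : Matrix.GeneralLinearGroup.det (hMat v u : GL2) = v := by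
  ext
  rw [det_H10, hMat_11]

theorem hMat_det (C : H10) :
    hMat (Matrix.GeneralLinearGroup.det (C : GL2)) ((C : GL2) 1 0) = C := by
  have h := mem_H10.1 C.2
  apply Subtype.ext
  ext i j
  fin_cases i <;> fin_cases j
  · exact h.1.symm
  · exact h.2.symm
  · rfl
  · exact det_H10 C

/-- The coordinates `(v, u)` of the matrix `(1 0; u v)`. -/
def hEquiv : H10 ≃ᵐ ℝˣ × ℝ where
  toFun C := (Matrix.GeneralLinearGroup.det (C : GL2), (C : GL2) 1 0)
  invFun p := hMat p.1 p.2
  left_inv C := hMat_det C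
  right_inv p := Prod.ext (det_hMat p.1 p.2) (hMat_10 p.1 p.2)
  measurable_toFun := by
    refine Measurable.prodMk (measurable_toUnits ?_)
      ((measurable_entry 1 0).comp measurable_subtype_coe)
    simp only [Matrix.GeneralLinearGroup.val_det_apply]
    exact measurable_det.comp measurable_subtype_coe
  measurable_invFun := by
    refine Measurable.subtype_mk (measurable_toGL fun i j => ?_)
    have h1 : Measurable fun p : ℝˣ × ℝ => (p.1 : ℝ) := measurable_unitsVal.comp measurable_fst
    fin_cases i <;> fin_cases j
    exacts [measurable_const, measurable_const, measurable_snd, h1]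

theorem measurable_hMat : Measurable fun p : ℝˣ × ℝ => hMat p.1 p.2 := hEquiv.symm.measurable

theorem measurableEmbedding_coordH :
    MeasurableEmbedding fun C : H10 => ((C : GL2) 1 0, (C : GL2) 1 1) := by
  have h : MeasurableEmbedding fun p : ℝˣ × ℝ => (p.2, (p.1 : ℝ)) :=
    MeasurableEquiv.prodComm.measurableEmbedding.comp
      (measurableEmbedding_unitsVal.prodMap MeasurableEmbedding.id)
  convert h.comp hEquiv.measurableEmbedding using 1
  ext C
  · rfl
  · exact (det_H10 C).symm

instance : SFinite haarH := by
  have := sigmaFinite_comap measurableEmbedding_coordH volume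
  unfold haarH
  infer_instance

instance : SFinite haarK := by
  have := sigmaFinite_comap measurableEmbedding_orb volume
  unfold haarK
  infer_instance

theorem lintegral_haarH {f : H10 → ℝ≥0∞} (hf : Measurable f) :
    ∫⁻ C, f C ∂haarH =
      ∫⁻ v : ℝˣ, (∫⁻ u : ℝ, ENNReal.ofReal ((v : ℝ) ^ 2)⁻¹ * f (hMat v u)) ∂lebO1 := by
  set c : H10 → ℝ × ℝ := fun C => ((C : GL2) 1 0, (C : GL2) 1 1) with hc
  have hce : MeasurableEmbedding c := measurableEmbedding_coordH
  set ρ : H10 → ℝ≥0∞ := fun C => ENNReal.ofReal ((C : GL2) 1 1 ^ 2)⁻¹ with hρ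
  have hρm : Measurable ρ :=
    (((measurable_entry 1 1).comp measurable_subtype_coe).pow_const 2).inv.ennreal_ofReal
  have hGm : Measurable (Function.extend c (fun C => ρ C * f C) 0) :=
    hce.measurable_extend (hρm.mul hf) measurable_const
  rw [haarH, lintegral_comap_withDensity hce volume hρm hf
    (G := Function.extend c (fun C => ρ C * f C) 0) (fun C => hce.injective.extend_apply _ _ C)
    (fun v hv => Function.extend_apply' _ _ _ (by simpa using hv)), Measure.volume_eq_prod,
    lintegral_prod_symm _ hGm.aemeasurable,
    ← lintegral_lebO1 fun v => ∫⁻ u, Function.extend c (fun C => ρ C * f C) 0 (u, v)]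
  apply lintegral_congr
  intro v
  apply lintegral_congr
  intro u
  exact hce.injective.extend_apply (fun C => ρ C * f C) 0 (hMat v u)

/-- The extension by zero of a function on `GL₂(ℝ)` to all matrices. -/
def extendGL (f : GL2 → ℝ≥0∞) (a b c d : ℝ) : ℝ≥0∞ :=
  Function.extend colsGL f 0 (![a, b], ![c, d])

theorem measurable_extendGL {f : GL2 → ℝ≥0∞} (hf : Measurable f) :
    Measurable fun p : ℝ × ℝ × ℝ × ℝ => extendGL f p.1 p.2.1 p.2.2.1 p.2.2.2 := by
  refine (measurableEmbedding_colsGL.measurable_extend hf measurable_const).comp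
    (Measurable.prodMk (measurable_pi_lambda _ fun i => ?_) (measurable_pi_lambda _ fun i => ?_)) <;>
  fin_cases i <;> simp <;> fun_prop

theorem extendGL_apply (f : GL2 → ℝ≥0∞) (A : GL2) :
    extendGL f (A 0 0) (A 1 0) (A 0 1) (A 1 1) = f A := by
  rw [extendGL, ← measurableEmbedding_colsGL.injective.extend_apply f 0 A]
  congr 1
  ext i <;> fin_cases i <;> rfl

theorem extendGL_of_det_eq_zero (f : GL2 → ℝ≥0∞) {a b c d : ℝ} (h : a * d - c * b = 0) :
    extendGL f a b c d = 0 := by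
  refine Function.extend_apply' _ _ _ ?_
  rintro ⟨A, hA⟩
  have : (![a, b], ![c, d]) ∈ range colsGL := ⟨A, hA⟩
  rw [range_colsGL] at this
  exact this h

theorem lintegral_haarGL {f : GL2 → ℝ≥0∞} (hf : Measurable f) :
    ∫⁻ A, f A ∂haarGL = ∫⁻ c : ℝ × ℝ, ∫⁻ b : ℝ × ℝ,
      ENNReal.ofReal ((b.1 * c.2 - c.1 * b.2) ^ 2)⁻¹ * extendGL f b.1 b.2 c.1 c.2 := by
  have hm := measurable_extendGL hf
  have hGm : Measurable fun p : (ℝ × ℝ) × (ℝ × ℝ) =>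
      ENNReal.ofReal ((p.1.1 * p.2.2 - p.2.1 * p.1.2) ^ 2)⁻¹ *
        extendGL f p.1.1 p.1.2 p.2.1 p.2.2 :=
    Measurable.mul (by fun_prop) (hm.comp (g := fun p : ℝ × ℝ × ℝ × ℝ => _)
      (f := fun p : (ℝ × ℝ) × (ℝ × ℝ) => (p.1.1, p.1.2, p.2.1, p.2.2)) (by fun_prop))
  have hGm' : Measurable fun p : (Fin 2 → ℝ) × (Fin 2 → ℝ) =>
      ENNReal.ofReal ((p.1 0 * p.2 1 - p.2 0 * p.1 1) ^ 2)⁻¹ *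
        extendGL f (p.1 0) (p.1 1) (p.2 0) (p.2 1) :=
    hGm.comp (f := fun p : (Fin 2 → ℝ) × (Fin 2 → ℝ) => ((p.1 0, p.1 1), (p.2 0, p.2 1)))
      (by fun_prop)
  rw [haarGL, lintegral_comap_withDensity measurableEmbedding_colsGL _
    (by have := measurable_det; fun_prop) hf
    (G := fun p => ENNReal.ofReal ((p.1 0 * p.2 1 - p.2 0 * p.1 1) ^ 2)⁻¹ *
      extendGL f (p.1 0) (p.1 1) (p.2 0) (p.2 1))
    (fun A => by rw [Matrix.det_fin_two]; exact congrArg _ (extendGL_apply f A))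
    (fun p hp => by
      rw [range_colsGL, mem_ofPred_eq, not_not] at hp
      rw [extendGL_of_det_eq_zero f hp, mul_zero]), Measure.volume_eq_prod,
    lintegral_prod_symm _ hGm'.aemeasurable, ← lintegral_finTwo hGm.lintegral_prod_left']
  apply lintegral_congr
  intro c
  exact lintegral_finTwo (hGm.comp (g := fun p : (ℝ × ℝ) × (ℝ × ℝ) =>
      ENNReal.ofReal ((p.1.1 * p.2.2 - p.2.1 * p.1.2) ^ 2)⁻¹ *
        extendGL f p.1.1 p.1.2 p.2.1 p.2.2) (f := fun z : ℝ × ℝ => (z, (c 0, c 1))) (by fun_prop))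

theorem lintegral_haarK {f : K0 → ℝ≥0∞} (hf : Measurable f) {G : ℝ → ℝ → ℝ≥0∞}
    (hG : Measurable fun p : ℝ × ℝ => G p.1 p.2) (h : ∀ L, f L = G (orb L 0) (orb L 1)) :
    ∫⁻ L, f L ∂haarK =
      ∫⁻ ω : ℝ × ℝ, ENNReal.ofReal (ω.1 ^ 2 + ω.2 ^ 2)⁻¹ * G ω.1 ω.2 := by
  have hm (i : Fin 2) : Measurable fun L : K0 => orb L i :=
    (measurable_pi_apply i).comp measurable_orb
  have hGm : Measurable fun ω : ℝ × ℝ =>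
      ENNReal.ofReal (ω.1 ^ 2 + ω.2 ^ 2)⁻¹ * G ω.1 ω.2 := Measurable.mul (by fun_prop) hG
  have hρ : Measurable fun L : K0 => ENNReal.ofReal (orb L 0 ^ 2 + orb L 1 ^ 2)⁻¹ := by
    have h0 := hm 0
    have h1 := hm 1
    fun_prop
  rw [← lintegral_finTwo hGm, haarK,
    lintegral_comap_withDensity measurableEmbedding_orb _
    hρ hf (G := fun ω => ENNReal.ofReal (ω 0 ^ 2 + ω 1 ^ 2)⁻¹ * G (ω 0) (ω 1))
    (fun L => by rw [h]) (fun ω hω => by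
      rw [range_orb, mem_ofPred_eq, not_not] at hω
      -- Off the range of `orb` the density is the inverse of zero, which is zero by convention, so
      -- the integrand vanishes there.
      rw [hω]; simp)]

theorem K0_entries (L : K0) :
    (L : GL2) 0 0 = (orb L 0 ^ 2 + orb L 1 ^ 2)⁻¹ * orb L 0 ∧
    (L : GL2) 0 1 = -((orb L 0 ^ 2 + orb L 1 ^ 2)⁻¹ * orb L 1) ∧
    (L : GL2) 1 0 = (orb L 0 ^ 2 + orb L 1 ^ 2)⁻¹ * orb L 1 ∧
    (L : GL2) 1 1 = (orb L 0 ^ 2 + orb L 1 ^ 2)⁻¹ * orb L 0 := by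
  have h := congrArg (fun L : K0 => ((L : GL2) : Matrix (Fin 2) (Fin 2) ℝ))
    (gam_orb L (orb_sq_ne L))
  exact ⟨(congrFun (congrFun h 0) 0).symm, (congrFun (congrFun h 0) 1).symm,
    (congrFun (congrFun h 1) 0).symm, (congrFun (congrFun h 1) 1).symm⟩

theorem measurable_fac_mul : Measurable fun p : K0 × H10 => (p.1 : GL2) * (p.2 : GL2) :=
  measurable_mulGL (measurable_subtype_coe.comp measurable_fst)
    (measurable_subtype_coe.comp measurable_snd)

theorem measurable_det_H10 :
    Measurable fun C : H10 => ((C : GL2) : Matrix (Fin 2) (Fin 2) ℝ).det :=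
  measurable_det.comp measurable_subtype_coe

theorem measurable_extendGL_comp {f : GL2 → ℝ≥0∞} (hf : Measurable f) {Z : Type}
    [MeasurableSpace Z] {a b c d : Z → ℝ} (ha : Measurable a)
    (hb : Measurable b) (hc : Measurable c) (hd : Measurable d) :
    Measurable fun z => extendGL f (a z) (b z) (c z) (d z) :=
  (measurable_extendGL hf).comp (ha.prodMk (hb.prodMk (hc.prodMk hd)))

theorem extendGL_mul_hMat (f : GL2 → ℝ≥0∞) (L : K0) (v : ℝˣ) (u : ℝ) :
    f ((L : GL2) * (hMat v u : GL2)) =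
      extendGL f ((orb L 0 ^ 2 + orb L 1 ^ 2)⁻¹ * (orb L 0 - u * orb L 1))
        ((orb L 0 ^ 2 + orb L 1 ^ 2)⁻¹ * (orb L 1 + u * orb L 0))
        ((orb L 0 ^ 2 + orb L 1 ^ 2)⁻¹ * (v * -orb L 1))
        ((orb L 0 ^ 2 + orb L 1 ^ 2)⁻¹ * (v * orb L 0)) := by
  obtain ⟨h00, h01, h10, h11⟩ := K0_entries L
  have hC := mem_H10.1 (hMat v u).2
  rw [← extendGL_apply f]
  simp only [Matrix.GeneralLinearGroup.coe_mul, Matrix.mul_apply, Fin.sum_univ_two, hC.1, hC.2,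
    hMat_10, hMat_11, h00, h01, h10, h11]
  congr 1 <;> ring

/-- The factor `|det C| = |v|` turns `du dv/v²` into `du dv/|v|`, the scale-invariant form that
`lintegral_cols` takes as input. -/
theorem lintegral_haarH_mul {f : GL2 → ℝ≥0∞} (hf : Measurable f) (L : K0) :
    ∫⁻ C : H10, ENNReal.ofReal |((C : GL2) : Matrix (Fin 2) (Fin 2) ℝ).det| *
      f ((L : GL2) * (C : GL2)) ∂haarH = ∫⁻ u : ℝ, ∫⁻ v : ℝ, ENNReal.ofReal |v|⁻¹ *
        extendGL f ((orb L 0 ^ 2 + orb L 1 ^ 2)⁻¹ * (orb L 0 - u * orb L 1))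
        ((orb L 0 ^ 2 + orb L 1 ^ 2)⁻¹ * (orb L 1 + u * orb L 0))
        ((orb L 0 ^ 2 + orb L 1 ^ 2)⁻¹ * (v * -orb L 1))
        ((orb L 0 ^ 2 + orb L 1 ^ 2)⁻¹ * (v * orb L 0)) := by
  have hm : Measurable fun C : H10 => ENNReal.ofReal
      |((C : GL2) : Matrix (Fin 2) (Fin 2) ℝ).det| * f ((L : GL2) * (C : GL2)) :=
    (measurable_norm.comp measurable_det_H10).ennreal_ofReal.mul
      (hf.comp (measurable_mulGL measurable_const measurable_subtype_coe))
  have hsw := lintegral_lintegral_swap (μ := volume) (ν := volume) (f := fun u v : ℝ =>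
      ENNReal.ofReal |v|⁻¹ *
        extendGL f ((orb L 0 ^ 2 + orb L 1 ^ 2)⁻¹ * (orb L 0 - u * orb L 1))
        ((orb L 0 ^ 2 + orb L 1 ^ 2)⁻¹ * (orb L 1 + u * orb L 0))
        ((orb L 0 ^ 2 + orb L 1 ^ 2)⁻¹ * (v * -orb L 1))
        ((orb L 0 ^ 2 + orb L 1 ^ 2)⁻¹ * (v * orb L 0)))
      (Measurable.aemeasurable (Measurable.mul (by fun_prop) (measurable_extendGL_comp hf
        (by fun_prop) (by fun_prop) (by fun_prop) (by fun_prop))))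
  rw [hsw, ← lintegral_lebO1, lintegral_haarH hm]
  apply lintegral_congr
  intro v
  apply lintegral_congr
  intro u
  have hv : |(v : ℝ)| ≠ 0 := abs_ne_zero.2 v.ne_zero
  have hdet : ((hMat v u : GL2) : Matrix (Fin 2) (Fin 2) ℝ).det = v := by
    rw [← Matrix.GeneralLinearGroup.val_det_apply, det_hMat]
  rw [hdet, ← mul_assoc, ← ENNReal.ofReal_mul (by positivity), extendGL_mul_hMat f]
  congr 2
  rw [← sq_abs]
  field_simp

/-- The disintegration that makes `W₁` isometric: under `A = L C`, Haar measure on `GL₂(ℝ)` is `|det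
C|` times the product of the measures on `K₀` and `H_(1,0)`. In coordinates it is `lintegral_cols`.
-/
theorem lintegral_haarK_haarH {f : GL2 → ℝ≥0∞} (hf : Measurable f) :
    ∫⁻ L : K0, ∫⁻ C : H10, ENNReal.ofReal |((C : GL2) : Matrix (Fin 2) (Fin 2) ℝ).det| *
      f ((L : GL2) * (C : GL2)) ∂haarH ∂haarK = ∫⁻ A, f A ∂haarGL := by
  have hI : Measurable fun p : K0 × H10 =>
      ENNReal.ofReal |((p.2 : GL2) : Matrix (Fin 2) (Fin 2) ℝ).det| *
        f ((p.1 : GL2) * (p.2 : GL2)) :=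
    (measurable_norm.comp (measurable_det_H10.comp measurable_snd)).ennreal_ofReal.mul
      (hf.comp measurable_fac_mul)
  have hJ : Measurable fun q : ((ℝ × ℝ) × ℝ) × ℝ => ENNReal.ofReal |q.2|⁻¹ *
      extendGL f ((q.1.1.1 ^ 2 + q.1.1.2 ^ 2)⁻¹ * (q.1.1.1 - q.1.2 * q.1.1.2))
        ((q.1.1.1 ^ 2 + q.1.1.2 ^ 2)⁻¹ * (q.1.1.2 + q.1.2 * q.1.1.1))
        ((q.1.1.1 ^ 2 + q.1.1.2 ^ 2)⁻¹ * (q.2 * -q.1.1.2))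
        ((q.1.1.1 ^ 2 + q.1.1.2 ^ 2)⁻¹ * (q.2 * q.1.1.1)) :=
    Measurable.mul (by fun_prop) (measurable_extendGL_comp hf
      (by fun_prop) (by fun_prop) (by fun_prop) (by fun_prop))
  rw [lintegral_haarGL hf, ← lintegral_cols (measurable_extendGL hf)]
  exact lintegral_haarK hI.lintegral_prod_right' (G := fun x y => ∫⁻ u : ℝ, ∫⁻ v : ℝ,
      ENNReal.ofReal |v|⁻¹ * extendGL f ((x ^ 2 + y ^ 2)⁻¹ * (x - u * y))
        ((x ^ 2 + y ^ 2)⁻¹ * (y + u * x)) ((x ^ 2 + y ^ 2)⁻¹ * (v * -y))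
        ((x ^ 2 + y ^ 2)⁻¹ * (v * x))) hJ.lintegral_prod_right'.lintegral_prod_right'
    fun L => lintegral_haarH_mul hf L

end Coordinates

/-! ### The unitary map W₁ and the transfer of null sets -/

section Disintegration

instance : MeasurableSpace.CountablyGenerated (Matrix (Fin 2) (Fin 2) ℝ) :=
  inferInstanceAs (MeasurableSpace.CountablyGenerated (Fin 2 → Fin 2 → ℝ))

instance : MeasurableSpace.CountablyGenerated GL2 := MeasurableSpace.CountablyGenerated.comap _

instance : MeasurableSpace.CountablyGenerated H10 := MeasurableSpace.CountablyGenerated.comap _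

/-- The factor `|det C|^{1/2}`. -/
def detWeight (C : H10) : ℂ :=
  ((|((C : GL2) : Matrix (Fin 2) (Fin 2) ℝ).det| ^ (1 / 2 : ℝ) : ℝ) : ℂ)

theorem measurable_detWeight : Measurable detWeight :=
  Complex.measurable_ofReal.comp ((measurable_norm.comp measurable_det_H10).pow_const _)

theorem detWeight_ne_zero (C : H10) : detWeight C ≠ 0 :=
  Complex.ofReal_ne_zero.2 (Real.rpow_pos_of_pos (abs_pos.2 (det_ne _)) _).ne'

theorem enorm_detWeight_sq (C : H10) :
    ‖detWeight C‖ₑ ^ 2 = ENNReal.ofReal |((C : GL2) : Matrix (Fin 2) (Fin 2) ℝ).det| := by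
  rw [detWeight, ← ofReal_norm, Complex.norm_real,
    Real.norm_of_nonneg (by positivity), ← ENNReal.ofReal_pow (by positivity),
    ← Real.rpow_natCast, ← Real.rpow_mul (abs_nonneg _)]
  norm_num

theorem lintegral_fac {f : GL2 → ℝ≥0∞} (hf : Measurable f) :
    ∫⁻ p : K0 × H10, ‖detWeight p.2‖ₑ ^ 2 * f ((p.1 : GL2) * (p.2 : GL2)) ∂(haarK.prod haarH) =
      ∫⁻ A, f A ∂haarGL := by
  have hm : Measurable fun p : K0 × H10 =>
      ‖detWeight p.2‖ₑ ^ 2 * f ((p.1 : GL2) * (p.2 : GL2)) :=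
    ((measurable_detWeight.comp measurable_snd).enorm.pow_const 2).mul
      (hf.comp measurable_fac_mul)
  rw [lintegral_prod _ hm.aemeasurable, ← lintegral_haarK_haarH hf]
  simp_rw [enorm_detWeight_sq]

theorem quasi_fac_mul : Measure.QuasiMeasurePreserving
    (fun p : K0 × H10 => (p.1 : GL2) * (p.2 : GL2)) (haarK.prod haarH) haarGL :=
  quasi_weighted measurable_fac_mul (measurable_detWeight.comp measurable_snd)
    (ae_of_all _ fun p => detWeight_ne_zero p.2) fun _ hf => lintegral_fac hf

theorem fac_fac_mul (p : K0 × H10) :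
    (facK ((p.1 : GL2) * (p.2 : GL2)), facH ((p.1 : GL2) * (p.2 : GL2))) = p := by
  rw [facK_mul, facH_mul, (fac_of_mem p.1).1, (fac_of_mem p.1).2, one_mul]

/-- The unitary map `W₁ : L²(GL₂(ℝ)) → L²(K, L²(H_(1,0)))`. -/
def wEquiv : L2GL ≃ₗᵢ[ℂ] L2KH :=
  (weightedEquiv (w := fun p : K0 × H10 => detWeight p.2) measurable_fac_mul
    (measurable_facK.prodMk measurable_facH) (measurable_detWeight.comp measurable_snd)
    (ae_of_all _ fun p => detWeight_ne_zero p.2) (ae_of_all _ fac_fac_mul)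
    fun _ hf => lintegral_fac hf).trans (curryEquiv haarK haarH)

theorem coeFn_wEquiv (f : L2GL) : ∀ᵐ L ∂haarK, wEquiv f L =ᵐ[haarH] fun C =>
    detWeight C * f ((L : GL2) * (C : GL2)) := by
  have h := coeFn_weightedEquiv (w := fun p : K0 × H10 => detWeight p.2) measurable_fac_mul
    (measurable_facK.prodMk measurable_facH) (measurable_detWeight.comp measurable_snd)
    (ae_of_all _ fun p => detWeight_ne_zero p.2) (ae_of_all _ fac_fac_mul)
    (fun _ hf => lintegral_fac hf) f
  filter_upwards [coeFn_curryEquiv (μ := haarK) (ν := haarH) _, Measure.ae_ae_of_ae_prod h]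
    with L h1 h2
  exact h1.trans h2

/-- The choice of representative in `IsW1` is immaterial: `(L, C) ↦ L C` pulls null sets back to
null sets, so two representatives agree along almost every `L` at almost every `C`. -/
theorem isW1_iff {f : L2GL} {F : L2KH} : IsW1 f F ↔ F = wEquiv f := by
  constructor
  · rintro ⟨f', hf, hF⟩
    apply lp_ext₂
    filter_upwards [coeFn_wEquiv f, hF, Measure.ae_ae_of_ae_prod (quasi_fac_mul.ae hf)]
      with L h1 h2 h3
    filter_upwards [h1, h2, h3] with C e1 e2 e3
    rw [e1, e2, e3]
    rfl
  · rintro rfl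
    exact ⟨f, ae_eq_rfl, coeFn_wEquiv f⟩

/-- By the disintegration formula applied to an indicator, a property of `A` may be checked on the
products `L C`, where `M_A = L` and `C_A = C`. -/
theorem ae_haarGL_of_ae_ae {p : GL2 → Prop} (hp : MeasurableSet {A | p A})
    (h : ∀ᵐ (L : K0) ∂haarK, ∀ᵐ (C : H10) ∂haarH, p ((L : GL2) * (C : GL2))) :
    ∀ᵐ A ∂haarGL, p A := by
  rw [ae_iff]
  have hs : MeasurableSet {A | ¬ p A} := hp.compl
  rw [← lintegral_indicator_one hs, ← lintegral_haarK_haarH (measurable_one.indicator hs)]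
  refine (lintegral_congr_ae (g := fun _ => 0) ?_).trans lintegral_zero
  filter_upwards [h] with L hL
  refine (lintegral_congr_ae (g := fun _ => 0) ?_).trans lintegral_zero
  filter_upwards [hL] with C hC
  simp [hC]

/-- Allows identities valid for almost every `L` in `K₀` to be used at `L = M_A` for almost every
`A`. -/
theorem quasi_facK : Measure.QuasiMeasurePreserving facK haarGL haarK := by
  refine ⟨measurable_facK, Measure.AbsolutelyContinuous.mk fun s hs h => ?_⟩
  rw [Measure.map_apply measurable_facK hs, measure_eq_zero_iff_ae_notMem]
  refine ae_haarGL_of_ae_ae (measurable_facK hs).compl ?_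
  filter_upwards [measure_eq_zero_iff_ae_notMem.1 h] with L hL
  refine ae_of_all _ fun C hC => hL ?_
  rwa [mem_preimage, facK_mul, (fac_of_mem L).1] at hC

end Disintegration

/-! ### The L² Fourier transform on L¹ ∩ L² -/

section Fourier

open scoped FourierTransform SchwartzMap ContDiff

/-- On `L¹ ∩ L²`, the `L²` Fourier transform is given by the Fourier integral. -/
theorem coeFn_fourier_toLp {k : ℝ → ℂ} (h1 : Integrable k) (h2 : MemLp k 2) :
    (𝓕 h2.toLp : Lp ℂ 2 (volume : Measure ℝ)) =ᵐ[volume] 𝓕 k := by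
  have hc : Continuous (𝓕 k) := VectorFourier.fourierIntegral_continuous
    Real.continuous_fourierChar (by exact continuous_inner) h1
  -- Both sides are locally integrable, so it suffices to pair them with smooth compactly supported
  -- functions, which are Schwartz. In either pairing the transform moves onto the test function: by
  -- duality of tempered distributions for the `L²` transform, by Fubini for the Fourier integral.
  refine ae_eq_of_integral_contDiff_smul_eq
    ((Lp.memLp (𝓕 (h2.toLp k) : Lp ℂ 2 (volume : Measure ℝ))).locallyIntegrable (by norm_num))
    hc.locallyIntegrable fun φ hφ hφc => ?_
  have hφc' : HasCompactSupport fun x => (φ x : ℂ) := hφc.comp_left Complex.ofReal_zero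
  have hφ' : ContDiff ℝ ∞ fun x => (φ x : ℂ) := Complex.ofRealCLM.contDiff.comp hφ
  set ψ : 𝓢(ℝ, ℂ) := hφc'.toSchwartzMap hφ' with hψ
  have e := congrArg (fun T => T ψ) (Lp.fourier_toTemperedDistribution_eq (h2.toLp k))
  simp only [TemperedDistribution.fourier_apply, Lp.toTemperedDistribution_apply] at e
  have e1 : ∫ x, φ x • (𝓕 (h2.toLp k) : Lp ℂ 2 (volume : Measure ℝ)) x =
      ∫ x, ψ x • (𝓕 (h2.toLp k) : Lp ℂ 2 (volume : Measure ℝ)) x := by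
    simp [hψ]
  have e2 : ∫ x, φ x • 𝓕 k x = ∫ x, ψ x • 𝓕 k x := by
    simp [hψ]
  have e3 : ∫ x, (𝓕 ψ) x • (h2.toLp k) x = ∫ x, (𝓕 ψ) x • k x := by
    apply integral_congr_ae
    filter_upwards [h2.coeFn_toLp] with x hx
    rw [hx]
  rw [e1, e2, ← e, e3]
  have := VectorFourier.integral_fourierIntegral_smul_eq_flip (L := innerₗ ℝ)
    (μ := volume) (ν := volume) Real.continuous_fourierChar
    (by exact continuous_inner) (ψ.integrable (μ := volume)) h1
  rw [SchwartzMap.fourier_coe]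
  simpa using! this

end Fourier

/-! ### The substitution c = 1/b -/

section Inversion

/-- The map `c ↦ c⁻¹` from `ℝ` to `ℝ*` (with value `1` at `0`). -/
def invU (c : ℝ) : ℝˣ := if h : c = 0 then 1 else (Units.mk0 c h)⁻¹

theorem invU_of_ne {c : ℝ} (h : c ≠ 0) : invU c = (Units.mk0 c h)⁻¹ := dif_neg h

theorem invU_coe (c : ℝˣ) : invU c = c⁻¹ := by
  rw [invU_of_ne c.ne_zero, Units.mk0_val]

theorem coe_invU {c : ℝ} (h : c ≠ 0) : (invU c : ℝ) = c⁻¹ := by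
  rw [invU_of_ne h]; simp

theorem measurable_invU : Measurable invU := by
  refine measurable_toUnits ?_
  have e : (fun c => (invU c : ℝ)) = fun c => if c = 0 then 1 else c⁻¹ := by
    ext c
    by_cases h : c = 0
    · simp [invU, h]
    · rw [coe_invU h, if_neg h]
  rw [e]
  exact Measurable.ite (measurableSet_singleton 0) measurable_const measurable_inv

theorem measurable_invUnits : Measurable fun t : ℝˣ => t⁻¹ := by
  simp_rw [← invU_coe]
  exact measurable_invU.comp measurable_unitsVal

theorem lintegral_inv_lebO1 (G : ℝˣ → ℝ≥0∞) :
    ∫⁻ x, ENNReal.ofReal ((x : ℝ) ^ 2)⁻¹ * G x⁻¹ ∂lebO1 = ∫⁻ x, G x ∂lebO1 := by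
  have h1 := lintegral_image_eq_lintegral_abs_deriv_mul (s := ({0}ᶜ : Set ℝ)) (f := fun x => x⁻¹)
    (f' := fun x => -(x ^ 2)⁻¹) (measurableSet_singleton 0).compl
    (fun x hx => (hasDerivAt_inv hx).hasDerivWithinAt) inv_injective.injOn
    -- For `x ≠ 0` the unit `(invU x)⁻¹` is `x` itself, so this extends `G` from `ℝ*` to `ℝ`.
    (fun x => G (invU x)⁻¹)
  have h2 : (fun x : ℝ => x⁻¹) '' {0}ᶜ = {0}ᶜ := by
    ext x
    simp only [mem_image, mem_compl_iff, mem_singleton_iff]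
    exact ⟨by rintro ⟨y, hy, rfl⟩; exact inv_ne_zero hy,
      fun hx => ⟨x⁻¹, inv_ne_zero hx, inv_inv x⟩⟩
  rw [h2, restrict_compl_singleton, ← lintegral_lebO1, ← lintegral_lebO1] at h1
  simp_rw [← Units.val_inv_eq_inv_val, invU_coe, inv_inv] at h1
  rw [h1]
  apply lintegral_congr
  intro x
  rw [abs_neg, abs_of_nonneg (by positivity)]

theorem lintegral_haarR {f : ℝˣ → ℝ≥0∞} (hf : Measurable f) :
    ∫⁻ b, f b ∂haarR = ∫⁻ b : ℝˣ, ENNReal.ofReal |(b : ℝ)|⁻¹ * f b ∂lebO1 := by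
  have := measurable_unitsVal
  rw [haarR, lintegral_withDensity_eq_lintegral_mul _ (by fun_prop) hf]
  rfl

theorem lintegral_invU {f : ℝˣ → ℝ≥0∞} (hf : Measurable f) :
    ∫⁻ c : ℝ, ENNReal.ofReal |c|⁻¹ * f (invU c) = ∫⁻ b, f b ∂haarR := by
  rw [lintegral_haarR hf, ← lintegral_lebO1, ← lintegral_inv_lebO1]
  apply lintegral_congr
  intro c
  have hc : |(c : ℝ)| ≠ 0 := abs_ne_zero.2 c.ne_zero
  rw [invU_coe, ← mul_assoc, ← ENNReal.ofReal_mul (by positivity)]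
  congr 2
  rw [Units.val_inv_eq_inv_val, abs_inv, inv_inv, ← sq_abs]
  field_simp

/-- The measure `dc/|c|` is invariant under inversion, and the arbitrary value of `invU` at `0` sits
on a null set. -/
theorem map_invU :
    ((volume : Measure ℝ).withDensity fun c => ENNReal.ofReal |c|⁻¹).map invU = haarR := by
  refine Measure.ext_of_lintegral _ fun f hf => ?_
  rw [lintegral_map hf measurable_invU, lintegral_withDensity_eq_lintegral_mul _ (by fun_prop)
    (g := fun c => f (invU c)) (hf.comp measurable_invU), ← lintegral_invU hf]
  rfl

theorem integral_invU {f : ℝˣ → ℂ} (hf : AEStronglyMeasurable f haarR) :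
    ∫ c : ℝ, |c|⁻¹ • f (invU c) = ∫ b, f b ∂haarR := by
  rw [← map_invU] at hf
  rw [← map_invU, integral_map measurable_invU.aemeasurable hf,
    integral_withDensity_eq_integral_toReal_smul (by fun_prop) (ae_of_all _ fun _ => by simp)]
  apply integral_congr_ae
  refine ae_of_all _ fun c => ?_
  simp only
  rw [ENNReal.toReal_ofReal (by positivity)]

theorem integrable_invU {f : ℝˣ → ℂ} (hf : Integrable f haarR) :
    Integrable fun c : ℝ => |c|⁻¹ • f (invU c) := by
  rw [← map_invU, integrable_map_measure hf.1
    measurable_invU.aemeasurable, integrable_withDensity_iff_integrable_smul' (by fun_prop)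
    (ae_of_all _ fun _ => by simp)] at hf
  refine hf.congr (ae_of_all _ fun c => ?_)
  simp only [Function.comp]
  rw [ENNReal.toReal_ofReal (by positivity)]

end Inversion

/-! ### The unitary model of L²(H_(1,0)) -/

section Model

/-- The measure `dv / v²` on `ℝ*`. -/
def measV : Measure ℝˣ := lebO1.withDensity fun v => ENNReal.ofReal ((v : ℝ) ^ 2)⁻¹

instance : SFinite measV := by unfold measV; infer_instance

theorem lintegral_measV {f : ℝˣ → ℝ≥0∞} (hf : Measurable f) :
    ∫⁻ v, f v ∂measV = ∫⁻ v : ℝˣ, ENNReal.ofReal ((v : ℝ) ^ 2)⁻¹ * f v ∂lebO1 := by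
  have := measurable_unitsVal
  rw [measV, lintegral_withDensity_eq_lintegral_mul _ (by fun_prop) hf]
  rfl

theorem lintegral_hEquiv {f : ℝˣ × ℝ → ℝ≥0∞} (hf : Measurable f) :
    ∫⁻ C, ‖(1 : ℂ)‖ₑ ^ 2 * f (hEquiv C) ∂haarH = ∫⁻ p, f p ∂(measV.prod volume) := by
  rw [lintegral_prod _ hf.aemeasurable, lintegral_measV hf.lintegral_prod_right']
  simp only [enorm_one, one_pow, one_mul]
  rw [lintegral_haarH (f := fun C => f (hEquiv C)) (hf.comp hEquiv.measurable)]
  apply lintegral_congr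
  intro v
  rw [lintegral_const_mul' _ _ (by finiteness)]
  congr 2
  ext u
  exact congrArg f (hEquiv.apply_symm_apply (v, u))

/-- The unitary map from functions of `(v, u)` to functions of `(1 0; u v)`. -/
def hCoord : Lp ℂ 2 (measV.prod (volume : Measure ℝ)) ≃ₗᵢ[ℂ] L2H :=
  weightedEquiv (w := fun _ => 1) hEquiv.measurable hEquiv.symm.measurable measurable_const
    (ae_of_all _ fun _ => one_ne_zero) (ae_of_all _ hEquiv.symm_apply_apply)
    fun _ hf => lintegral_hEquiv hf

theorem coeFn_hCoord (f : Lp ℂ 2 (measV.prod (volume : Measure ℝ))) :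
    hCoord f =ᵐ[haarH] fun C => f (hEquiv C) := by
  have h := coeFn_weightedEquiv (w := fun _ => 1) hEquiv.measurable hEquiv.symm.measurable
    measurable_const (ae_of_all _ fun _ => one_ne_zero) (ae_of_all _ hEquiv.symm_apply_apply)
    (fun _ hf => lintegral_hEquiv hf) f
  filter_upwards [h] with C hC
  rw [hCoord, hC, one_mul]

theorem quasi_hEquiv : Measure.QuasiMeasurePreserving hEquiv haarH (measV.prod volume) :=
  quasi_weighted (w := fun _ => 1) hEquiv.measurable measurable_const
    (ae_of_all _ fun _ => one_ne_zero) fun _ hf => lintegral_hEquiv hf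

/-- The coordinates `b = 1 / c`, `t = 1 / (v c)`. -/
def btCoord (p : ℝˣ × ℝ) : ℝˣ × ℝˣ := (invU p.2, p.1⁻¹ * invU p.2)

theorem measurable_mulUnits₂ {X : Type*} [MeasurableSpace X] {f g : X → ℝˣ}
    (hf : Measurable f) (hg : Measurable g) : Measurable fun x => f x * g x :=
  measurable_toUnits ((measurable_unitsVal.comp hf).mul (measurable_unitsVal.comp hg))

theorem measurable_btCoord : Measurable btCoord :=
  (measurable_invU.comp measurable_snd).prodMk (measurable_mulUnits₂
    (measurable_invUnits.comp measurable_fst) (measurable_invU.comp measurable_snd))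

theorem lintegral_mul_right_lebO1 (c : ℝˣ) {g : ℝˣ → ℝ≥0∞} (hg : Measurable g) :
    ∫⁻ v, g (c * v) ∂lebO1 = ENNReal.ofReal |(c : ℝ)|⁻¹ * ∫⁻ x, g x ∂lebO1 := by
  rw [← lintegral_map hg (measurable_mulUnits c), map_mul_lebO1, lintegral_smul_measure,
    abs_inv, smul_eq_mul]

/-- With `c = 1/b` one has `dc/c² = db`, and with `v = b/t` at fixed `b` one has `dv/v² = dt/|b|`.
The product is Haar measure in `b` and Lebesgue measure in `t`, whence the Lebesgue normalisation of
`g`. -/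
theorem lintegral_btCoord {f : ℝˣ × ℝˣ → ℝ≥0∞} (hf : Measurable f) :
    ∫⁻ p, ‖((|p.2|⁻¹ : ℝ) : ℂ)‖ₑ ^ 2 * f (btCoord p) ∂(measV.prod volume) =
      ∫⁻ q, f q ∂(haarR.prod lebO1) := by
  have hv := measurable_unitsVal
  have hm : Measurable fun p : ℝˣ × ℝ => ‖((|p.2|⁻¹ : ℝ) : ℂ)‖ₑ ^ 2 * f (btCoord p) :=
    Measurable.mul (by fun_prop) (hf.comp measurable_btCoord)
  have hn (c : ℝ) : ‖((|c|⁻¹ : ℝ) : ℂ)‖ₑ ^ 2 = ENNReal.ofReal (c ^ 2)⁻¹ := by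
    rw [← ofReal_norm, Complex.norm_real, Real.norm_of_nonneg (by positivity),
      ← ENNReal.ofReal_pow (by positivity), inv_pow, sq_abs]
  have hg (c : ℝˣ) : Measurable fun x : ℝˣ => ENNReal.ofReal ((x : ℝ) ^ 2)⁻¹ * f (c⁻¹, x⁻¹) :=
    Measurable.mul (by fun_prop) (hf.comp (measurable_const.prodMk measurable_invUnits))
  calc
    _ = ∫⁻ v : ℝˣ, ∫⁻ c : ℝˣ, ENNReal.ofReal (((c * v : ℝˣ) : ℝ) ^ 2)⁻¹ *
        f (c⁻¹, (c * v)⁻¹) ∂lebO1 ∂lebO1 := by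
      rw [lintegral_prod _ hm.aemeasurable, lintegral_measV hm.lintegral_prod_right']
      apply lintegral_congr
      intro v
      rw [← lintegral_const_mul' _ _ (by finiteness), ← lintegral_lebO1]
      apply lintegral_congr
      intro c
      simp only [hn, btCoord, invU_coe]
      rw [← mul_assoc, ← ENNReal.ofReal_mul (by positivity), mul_inv, mul_comm c⁻¹]
      congr 2
      push_cast
      rw [mul_pow, mul_inv, mul_comm]
    _ = ∫⁻ c : ℝˣ, ∫⁻ v : ℝˣ, ENNReal.ofReal (((c * v : ℝˣ) : ℝ) ^ 2)⁻¹ *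
        f (c⁻¹, (c * v)⁻¹) ∂lebO1 ∂lebO1 := by
      refine lintegral_lintegral_swap (Measurable.aemeasurable ?_)
      have h1 : Measurable fun p : ℝˣ × ℝˣ => p.2 * p.1 :=
        measurable_mulUnits₂ measurable_snd measurable_fst
      exact ((hv.comp h1).pow_const 2).inv.ennreal_ofReal.mul
        (hf.comp ((measurable_invUnits.comp measurable_snd).prodMk (measurable_invUnits.comp h1)))
    -- For fixed `c`, the variable `x = c v` contributes `|c|⁻¹`, and then `t = 1/x` absorbs the
    -- density `x⁻²`.
    _ = ∫⁻ c : ℝˣ, ENNReal.ofReal ((c : ℝ) ^ 2)⁻¹ * (ENNReal.ofReal |((c⁻¹ : ℝˣ) : ℝ)|⁻¹ *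
        ∫⁻ t : ℝˣ, f (c⁻¹, t) ∂lebO1) ∂lebO1 := by
      apply lintegral_congr
      intro c
      have hc : |(c : ℝ)| ≠ 0 := abs_ne_zero.2 c.ne_zero
      rw [lintegral_mul_right_lebO1 c (hg c), lintegral_inv_lebO1 fun t => f (c⁻¹, t),
        ← mul_assoc, ← ENNReal.ofReal_mul (by positivity)]
      congr 2
      rw [Units.val_inv_eq_inv_val, abs_inv, inv_inv, ← sq_abs]
      field_simp
    _ = _ := by
      rw [lintegral_inv_lebO1 fun b : ℝˣ => ENNReal.ofReal |(b : ℝ)|⁻¹ *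
        ∫⁻ t : ℝˣ, f (b, t) ∂lebO1, lintegral_prod _ hf.aemeasurable,
        lintegral_haarR hf.lintegral_prod_right']

theorem ae_snd_ne_zero : ∀ᵐ p ∂(measV.prod (volume : Measure ℝ)), p.2 ≠ 0 :=
  Measure.quasiMeasurePreserving_snd.ae ae_real_ne

theorem ae_weight_ne_zero :
    ∀ᵐ p ∂(measV.prod (volume : Measure ℝ)), ((|p.2|⁻¹ : ℝ) : ℂ) ≠ 0 := by
  filter_upwards [ae_snd_ne_zero] with p hp
  simpa using hp

theorem ae_btCoord_symm : ∀ᵐ p ∂(measV.prod (volume : Measure ℝ)),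
    (fun q : ℝˣ × ℝˣ => (q.1 * q.2⁻¹, ((q.1⁻¹ : ℝˣ) : ℝ))) (btCoord p) = p := by
  filter_upwards [ae_snd_ne_zero] with p hp
  ext
  · simp [btCoord]
  · simp [btCoord, coe_invU hp]

theorem measurable_weight : Measurable fun p : ℝˣ × ℝ => ((|p.2|⁻¹ : ℝ) : ℂ) := by fun_prop

/-- The unitary map `q ↦ ((v, c) ↦ |c|⁻¹ q(1 / c, 1 / (v c)))`. -/
def btEquiv : Lp ℂ 2 (haarR.prod lebO1) ≃ₗᵢ[ℂ] Lp ℂ 2 (measV.prod (volume : Measure ℝ)) :=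
  weightedEquiv (φ := btCoord) (w := fun p : ℝˣ × ℝ => ((|p.2|⁻¹ : ℝ) : ℂ))
    (ψ := fun q : ℝˣ × ℝˣ => (q.1 * q.2⁻¹, ((q.1⁻¹ : ℝˣ) : ℝ))) measurable_btCoord
    ((measurable_mulUnits₂ measurable_fst (measurable_invUnits.comp measurable_snd)).prodMk
      (measurable_unitsVal.comp (measurable_invUnits.comp measurable_fst)))
    measurable_weight ae_weight_ne_zero ae_btCoord_symm fun _ hf => lintegral_btCoord hf

theorem coeFn_btEquiv (q : Lp ℂ 2 (haarR.prod lebO1)) :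
    btEquiv q =ᵐ[measV.prod volume] fun p => ((|p.2|⁻¹ : ℝ) : ℂ) * q (btCoord p) :=
  coeFn_weightedEquiv measurable_btCoord _ measurable_weight ae_weight_ne_zero ae_btCoord_symm
    (fun _ hf => lintegral_btCoord hf) q

theorem quasi_btCoord :
    Measure.QuasiMeasurePreserving btCoord (measV.prod volume) (haarR.prod lebO1) :=
  quasi_weighted measurable_btCoord measurable_weight ae_weight_ne_zero
    fun _ hf => lintegral_btCoord hf

/-- The Fourier transform in the second variable. -/
def partialFourier : Lp ℂ 2 (measV.prod (volume : Measure ℝ)) ≃ₗᵢ[ℂ]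
    Lp ℂ 2 (measV.prod (volume : Measure ℝ)) :=
  ((curryEquiv measV volume).trans
    (lpMapEquiv measV (Lp.fourierTransformₗᵢ ℝ ℂ))).trans (curryEquiv measV volume).symm

/-- The unitary map `L²(ℝ*, L²(𝒪₁)) → L²(H_(1,0))` that takes `ξ ⊗ conj g` to `V_g ξ`. -/
def modelEquiv : Lp (Lp ℂ 2 lebO1) 2 haarR ≃ₗᵢ[ℂ] L2H :=
  (((curryEquiv haarR lebO1).symm.trans btEquiv).trans partialFourier).trans hCoord

end Model

/-! ### V_g as a Fourier transform -/

section VoiceTransform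

open scoped FourierTransform

/-- The isometry `ξ ↦ V_g ξ` from `L²(ℝ*)` to `L²(H_(1,0))`, for a unit vector `g` of `L²(𝒪₁)`. -/
def voice {g : Lp ℂ 2 lebO1} (hg : ‖star g‖ = 1) : L2R →ₗᵢ[ℂ] L2H :=
  modelEquiv.toLinearIsometry.comp (lpMap haarR (LinearIsometry.toSpanSingleton ℂ _ hg))

/-- Identifies the elementary tensor `ξ ⊗ conj g` with a function of two variables, the starting
point for following it through the model. -/
theorem ae_curry_symm_apply {g : Lp ℂ 2 lebO1} (hg : ‖star g‖ = 1) (ξ : L2R) :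
    ∀ᵐ q ∂(haarR.prod lebO1), (curryEquiv haarR lebO1).symm
      (lpMap haarR (LinearIsometry.toSpanSingleton ℂ _ hg) ξ) q = ξ q.1 * star (g q.2) := by
  set F := lpMap haarR (LinearIsometry.toSpanSingleton ℂ _ hg) ξ
  refine (Measure.ae_prod_iff_ae_ae ?_).2 ?_
  · exact measurableSet_eq_fun (Lp.stronglyMeasurable _).measurable
      (((Lp.stronglyMeasurable ξ).measurable.comp measurable_fst).mul
        (continuous_star.measurable.comp
        ((Lp.stronglyMeasurable g).measurable.comp measurable_snd)))
  · have h := coeFn_curryEquiv ((curryEquiv haarR lebO1).symm F)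
    rw [LinearIsometryEquiv.apply_symm_apply] at h
    filter_upwards [h, coeFn_lpMap (LinearIsometry.toSpanSingleton ℂ _ hg) ξ] with b h1 h2
    rw [h2] at h1
    filter_upwards [h1, Lp.coeFn_smul (ξ b) (star g), Lp.coeFn_star g] with t e1 e2 e3
    rw [← e1]
    refine Eq.trans e2 ?_
    rw [Pi.smul_apply, e3, smul_eq_mul, Pi.star_apply]

/-- The function of `c` whose Fourier transform is `V_g ξ (1 0; · v)`. -/
def kern (g : Lp ℂ 2 lebO1) (ξ : L2R) (v : ℝˣ) (c : ℝ) : ℂ :=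
  |c|⁻¹ • (ξ (invU c) * star (g (v⁻¹ * invU c)))

theorem ae_curry_btEquiv {g : Lp ℂ 2 lebO1} (hg : ‖star g‖ = 1) (ξ : L2R) :
    ∀ᵐ v ∂measV, curryEquiv measV volume (btEquiv ((curryEquiv haarR lebO1).symm
      (lpMap haarR (LinearIsometry.toSpanSingleton ℂ _ hg) ξ))) v =ᵐ[volume] kern g ξ v := by
  set q := (curryEquiv haarR lebO1).symm
      (lpMap haarR (LinearIsometry.toSpanSingleton ℂ _ hg) ξ)
  have h : ∀ᵐ p ∂(measV.prod volume), btEquiv q p = kern g ξ p.1 p.2 := by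
    filter_upwards [coeFn_btEquiv q, quasi_btCoord.ae (ae_curry_symm_apply hg ξ)] with p h1 h2
    rw [h1, h2, kern, Complex.real_smul]
    rfl
  filter_upwards [coeFn_curryEquiv (btEquiv q), Measure.ae_ae_of_ae_prod h] with v h1 h2
  exact h1.trans h2

theorem memLp_translate {G : ℝˣ → ℂ} (hG : MemLp G 2 haarR) (v : ℝˣ) :
    MemLp (fun b => G (v⁻¹ * b)) 2 haarR := by
  refine memLp_of_lintegral_lt_top
    (hG.1.comp_quasiMeasurePreserving (quasi_mul_haarR v⁻¹)) ?_
  rw [lintegral_mul_haarR v⁻¹ (fun b => ‖G b‖ₑ ^ 2) (hG.1.enorm.pow_const 2)]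
  exact lintegral_enorm_sq_lt_top hG

/-- Here `g ∈ L²(ℝ*)` matters: by Hölder's inequality it gives absolute convergence of the integral
defining `V_g ξ`, for every `v`. -/
theorem integrable_mul_star_translate {g : Lp ℂ 2 lebO1} (hg : MemLp g 2 haarR) (ξ : L2R)
    (v : ℝˣ) : Integrable (fun b => ξ b * star (g (v⁻¹ * b))) haarR :=
  (Lp.memLp ξ).integrable_mul (memLp_translate hg v).star

theorem star_e2pi (r : ℝ) : star (e2pi r) = e2pi (-r) := by
  rw [Complex.star_def, e2pi, e2pi, ← Complex.exp_conj]
  congr 1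
  simp only [map_mul, Complex.conj_ofReal, Complex.conj_I, Complex.conj_ofNat]
  push_cast
  ring

/-- Under `c = 1/b` the factor `e^{-2πi u/b}`, conjugate to the one in `π¹`, becomes the Fourier
character `e^{-2πi u c}`, and `db/|b|` becomes `dc/|c|`. -/
theorem fourier_kern {g : Lp ℂ 2 lebO1} (hg : MemLp g 2 haarR) (ξ : L2R) (v : ℝˣ) (u : ℝ) :
    𝓕 (kern g ξ v) u = Vg (hg.toLp g) ξ (hMat v u) := by
  have hm : AEStronglyMeasurable
      (fun b : ℝˣ => e2pi (-(u / (b : ℝ))) * (ξ b * star (g (v⁻¹ * b)))) haarR :=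
    (measurable_e2pi.comp (measurable_unitsVal.const_div u).neg).aestronglyMeasurable.mul
      (integrable_mul_star_translate hg ξ v).1
  rw [Vg, L2.inner_def, Real.fourier_eq']
  refine Eq.trans ?_ ((integral_invU hm).trans (integral_congr_ae ?_))
  · apply integral_congr_ae
    filter_upwards [ae_real_ne] with c hc
    rw [kern, coe_invU hc, smul_comm]
    congr 1
    simp [e2pi]
    left
    congr 1
    ring
  · filter_upwards [coeFn_pi1 (hMat v u) (hg.toLp g), (quasi_mul_haarR v⁻¹).ae hg.coeFn_toLp]
      with b h1 h2
    rw [h1, det_hMat, h2, hMat_10, RCLike.inner_apply, ← star_e2pi, ← Complex.star_def, star_mul]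
    ring

theorem stronglyMeasurable_Vg (g ξ : L2R) : StronglyMeasurable (Vg g ξ) :=
  (stronglyMeasurable_pi1 g).inner stronglyMeasurable_const

/-- Identifies the abstractly built isometry with `V_g`. For almost every `v` the kernel lies in `L¹
∩ L²`, so its Plancherel transform is the Fourier integral computed in `fourier_kern`. In particular
`V_g` is isometric. -/
theorem coeFn_voice {g : Lp ℂ 2 lebO1} (hn : ‖star g‖ = 1) (hg : MemLp g 2 haarR) (ξ : L2R) :
    voice hn ξ =ᵐ[haarH] Vg (hg.toLp g) ξ := by
  set k := btEquiv ((curryEquiv haarR lebO1).symm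
      (lpMap haarR (LinearIsometry.toSpanSingleton ℂ _ hn) ξ)) with hk
  have h : ∀ᵐ p ∂(measV.prod volume), partialFourier k p = Vg (hg.toLp g) ξ (hMat p.1 p.2) := by
    refine (Measure.ae_prod_iff_ae_ae ?_).2 ?_
    · exact measurableSet_eq_fun (Lp.stronglyMeasurable _).measurable
        ((stronglyMeasurable_Vg _ ξ).measurable.comp measurable_hMat)
    · have h0 := coeFn_curryEquiv (partialFourier k)
      have e : curryEquiv measV volume (partialFourier k) =
          lpMapEquiv measV (Lp.fourierTransformₗᵢ ℝ ℂ) (curryEquiv measV volume k) :=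
        LinearIsometryEquiv.apply_symm_apply _ _
      rw [e] at h0
      filter_upwards [h0, coeFn_lpMapEquiv (Lp.fourierTransformₗᵢ ℝ ℂ) (curryEquiv measV volume k),
        ae_curry_btEquiv hn ξ] with v h1 h2 h3
      -- For almost every `v` the kernel is a section of a function that is square-integrable in
      -- both variables; `L²` membership comes from there.
      have hL2 : MemLp (kern g ξ v) 2 := (memLp_congr_ae h3).1 (Lp.memLp _)
      have hk' : curryEquiv measV volume k v = hL2.toLp := by
        apply Lp.ext
        exact h3.trans hL2.coeFn_toLp.symm
      rw [hk'] at h2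
      rw [h2] at h1
      have h4 := coeFn_fourier_toLp
        (integrable_invU (integrable_mul_star_translate hg ξ v)) hL2
      filter_upwards [h1, h4] with u e1 e2
      rw [← e1, ← fourier_kern]
      exact e2
  refine (coeFn_hCoord (partialFourier k)).trans ?_
  filter_upwards [quasi_hEquiv.ae h] with C hC
  rw [hC]
  congr 1
  exact hMat_det C

end VoiceTransform

/-! ### The spaces ℋ_g and the intertwining relation -/

section Main

variable {g : Lp ℂ 2 lebO1}

/-- The adjoint of an isometry is a left inverse of it, so applying the adjoint pointwise selects
the preimages measurably and in `L²`. -/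
theorem mem_range_lpMap {X A B : Type*} [MeasurableSpace X] {μ : Measure X}
    [NormedAddCommGroup A] [InnerProductSpace ℂ A] [CompleteSpace A]
    [NormedAddCommGroup B] [InnerProductSpace ℂ B] [CompleteSpace B] (V : A →ₗᵢ[ℂ] B)
    {F : Lp B 2 μ} (hF : ∀ᵐ x ∂μ, F x ∈ V.toLinearMap.range) : ∃ F', lpMap μ V F' = F := by
  set T := ContinuousLinearMap.adjoint V.toContinuousLinearMap with hT
  have hTV (a : A) : T (V a) = a := by
    refine ext_inner_left ℂ fun b => ?_
    rw [hT, ContinuousLinearMap.adjoint_inner_right]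
    exact V.inner_map_map b a
  refine ⟨T.compLp F, Lp.ext ?_⟩
  filter_upwards [coeFn_lpMap V (T.compLp F), T.coeFn_compLp F, hF] with x h1 h2 h3
  obtain ⟨a, ha⟩ := h3
  rw [h1, h2, ← ha]
  exact congrArg V (hTV a)

/-- The isometry `F ↦ W₁⁻¹(L ↦ V_g F(L))` from `L²(K, L²(ℝ*))` to `L²(GL₂(ℝ))`. -/
def embed (hn : ‖star g‖ = 1) : L2KR →ₗᵢ[ℂ] L2GL :=
  wEquiv.symm.toLinearIsometry.comp (lpMap haarK (voice hn))

theorem mem_Kg_iff (hn : ‖star g‖ = 1) (hg : MemLp g 2 haarR) {h : L2H} :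
    h ∈ Kg (hg.toLp g) ↔ h ∈ (voice hn).toLinearMap.range := by
  constructor
  · rintro ⟨ξ, hξ⟩
    exact ⟨ξ, Lp.ext ((coeFn_voice hn hg ξ).trans hξ.symm)⟩
  · rintro ⟨ξ, rfl⟩
    exact ⟨ξ, coeFn_voice hn hg ξ⟩

/-- A section that takes values in `𝒦_g` almost everywhere is `V_g` applied to a single element of
`L²(K, L²(ℝ*))`, by `mem_range_lpMap`; the rest is the unitarity of `W₁`. -/
theorem Hg_eq_range (hn : ‖star g‖ = 1) (hg : MemLp g 2 haarR) :
    Hg (hg.toLp g) = (embed hn).toLinearMap.range := by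
  ext f
  constructor
  · rintro ⟨F, hF, hW⟩
    rw [isW1_iff] at hW
    obtain ⟨F', rfl⟩ := mem_range_lpMap (voice hn) (F := F) (by
      filter_upwards [hF] with L hL
      exact (mem_Kg_iff hn hg).1 hL)
    exact ⟨F', (wEquiv.symm_apply_eq.2 hW)⟩
  · rintro ⟨F, rfl⟩
    refine ⟨lpMap haarK (voice hn) F, ?_, isW1_iff.2 ?_⟩
    · filter_upwards [coeFn_lpMap (voice hn) F] with L hL
      rw [hL]
      exact (mem_Kg_iff hn hg).2 ⟨_, rfl⟩
    · exact (wEquiv.apply_symm_apply _).symm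

/-- Dividing by the weight `|det C|^{1/2}` inverts `W₁` along `A = L C`. The formula is what makes
the intertwining relation a pointwise computation. -/
theorem coeFn_embed (hn : ‖star g‖ = 1) (hg : MemLp g 2 haarR) (F : L2KR) :
    embed hn F =ᵐ[haarGL] fun A =>
    (detWeight (facH A))⁻¹ * Vg (hg.toLp g) (F (facK A)) (facH A) := by
  have h0 := coeFn_wEquiv (embed hn F)
  have e : wEquiv (embed hn F) = lpMap haarK (voice hn) F := wEquiv.apply_symm_apply _
  rw [e] at h0
  refine ae_haarGL_of_ae_ae (measurableSet_eq_fun (Lp.stronglyMeasurable _).measurable ?_) ?_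
  · exact (measurable_detWeight.comp measurable_facH).inv.mul
      (((stronglyMeasurable_pi1 (hg.toLp g)).comp_measurable measurable_facH).inner
        ((Lp.stronglyMeasurable F).comp_measurable measurable_facK)).measurable
  filter_upwards [h0, coeFn_lpMap (voice hn) F] with L h1 h2
  rw [h2] at h1
  filter_upwards [h1, coeFn_voice hn hg (F L)] with C e1 e2
  rw [facK_mul, facH_mul, (fac_of_mem L).1, (fac_of_mem L).2, one_mul, ← e2, e1,
    inv_mul_cancel_left₀ (detWeight_ne_zero C)]

theorem detWeight_mul (C D : H10) : detWeight (C * D) = detWeight C * detWeight D := by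
  rw [detWeight, Subgroup.coe_mul, Matrix.GeneralLinearGroup.coe_mul, Matrix.det_mul, abs_mul,
    Real.mul_rpow (abs_nonneg _) (abs_nonneg _), Complex.ofReal_mul]
  rfl

theorem sigmaWeight_eq (x : Aff2) (L : K0) :
    sigmaWeight x L = (detWeight (facH (x.lin⁻¹ * L)))⁻¹ *
      e2pi (![1, 0] ⬝ᵥ ((((L : GL2)⁻¹ : GL2) : Matrix (Fin 2) (Fin 2) ℝ) *ᵥ x.trans)) := by
  rw [sigmaWeight, detWeight, Real.rpow_neg (abs_nonneg _), Complex.ofReal_inv]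

/-- The factor `C_B` fixes the row `(1,0)`, so the character in `π^(1,0)` depends on `B` only
through `M_B` and agrees with the one in `σ`. -/
theorem dot_inv_mulVec (B : GL2) (y : Fin 2 → ℝ) :
    ![1, 0] ⬝ᵥ (((B⁻¹ : GL2) : Matrix (Fin 2) (Fin 2) ℝ) *ᵥ y) =
      ![1, 0] ⬝ᵥ ((((facK B : GL2)⁻¹ : GL2) : Matrix (Fin 2) (Fin 2) ℝ) *ᵥ y) := by
  have h : B⁻¹ = ((facH B)⁻¹ : H10) * (facK B : GL2)⁻¹ := by
    conv_lhs => rw [← fac_mul B, mul_inv_rev]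
    rfl
  have h2 : ![1, 0] ᵥ* ((((facH B)⁻¹ : H10) : GL2) : Matrix (Fin 2) (Fin 2) ℝ) = ![1, 0] :=
    (facH B)⁻¹.2
  rw [h, Matrix.GeneralLinearGroup.coe_mul, Matrix.dotProduct_mulVec, ← Matrix.vecMul_vecMul, h2,
    ← Matrix.dotProduct_mulVec]

/-- By unitarity `π¹(D)` can be moved to the other side of the inner product: `V_g` intertwines `π¹`
with left translation. -/
theorem Vg_smul_pi1 (g φ : L2R) (s : ℂ) (C D : H10) :
    Vg g (s • pi1 D⁻¹ φ) C = s * Vg g φ (D * C) := by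
  rw [Vg, Vg, inner_smul_right, map_mul, map_inv, ← (pi1 D).inner_map_map (pi1 C g)]
  congr 2
  exact (pi1 D).apply_symm_apply φ

/-- Put `X = A⁻¹ M_B`. As `A⁻¹ B = X C_B`, its factors are `M_X` and `C_X C_B`. The operator
`π¹(C_X⁻¹)` in `σ` shifts the argument of `V_g` from `C_B` to `C_X C_B`, and the factor `|det
C_X|^{-1/2}` completes the weight of `C_B` to that of `C_X C_B`. -/
theorem embed_sigma (hn : ‖star g‖ = 1) (hg : MemLp g 2 haarR) (x : Aff2)
    (F : L2KR) : embed hn (sigma x F) = pi10 x (embed hn F) := by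
  apply Lp.ext
  filter_upwards [coeFn_embed hn hg (sigma x F), coeFn_pi10 x (embed hn F),
    quasi_facK.ae (coeFn_sigma x F), (quasi_mul_haarGL x.lin⁻¹).ae (coeFn_embed hn hg F)]
    with B h1 h2 h3 h4
  have hB : x.lin⁻¹ * B = x.lin⁻¹ * (facK B : GL2) * (facH B : GL2) := by
    rw [mul_assoc, fac_mul]
  rw [h1, h2, h3, h4, hB, facK_mul, facH_mul, Vg_smul_pi1, sigmaWeight_eq, dot_inv_mulVec B,
    detWeight_mul, mul_inv]
  ring

end Main

end AffPlane

end

/-! ### The proposition -/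

theorem mainTheorem7 {J : Type*} (g : HilbertBasis J ℂ (Lp ℂ 2 lebO1))
    (hg : ∀ j, MemLp (g j) 2 haarR) :
    (∀ j, IsClosed (Hg ((hg j).toLp (g j)) : Set L2GL) ∧
      ∃ hinv : Invariant pi10 (Hg ((hg j).toLp (g j))),
        RestrictionEquivalent pi10 (Hg ((hg j).toLp (g j))) hinv sigma) ∧
    IsHilbertSum ℂ (fun j => Hg ((hg j).toLp (g j)))
      (fun j => (Hg ((hg j).toLp (g j))).subtypeₗᵢ) := by
  have hn := (orthonormal_star g.orthonormal).1
  have hr : ∀ j, Hg ((hg j).toLp (g j)) = (embed (hn j)).toLinearMap.range :=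
    fun j => Hg_eq_range (hn j) (hg j)
  refine ⟨fun j => ⟨?_, ?_, ?_⟩, isHilbertSum_range (V := fun j => embed (hn j)) ?_ hr⟩
  · rw [hr]
    exact isClosed_range_isometry _
  · intro x f hf
    rw [hr] at hf ⊢
    obtain ⟨F, rfl⟩ := hf
    exact ⟨sigma x F, embed_sigma (hn j) (hg j) x F⟩
  · have hmem : ∀ F, embed (hn j) F ∈ Hg ((hg j).toLp (g j)) := fun F => by
      rw [hr]; exact ⟨F, rfl⟩
    -- The embedding, corestricted to its range, is the unitary from `L²(K, L²(ℝ*))` onto `ℋ_g`; the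
    -- required equivalence is its inverse.
    let T : L2KR →ₗᵢ[ℂ] Hg ((hg j).toLp (g j)) :=
      { toLinearMap := (embed (hn j)).toLinearMap.codRestrict _ hmem
        norm_map' := (embed (hn j)).norm_map }
    have hT : Function.Surjective T := by
      rintro ⟨f, hf⟩
      rw [hr] at hf
      obtain ⟨F, rfl⟩ := hf
      exact ⟨F, rfl⟩
    refine ⟨(LinearIsometryEquiv.ofSurjective T hT).symm, fun x f => ?_⟩
    rw [LinearIsometryEquiv.symm_apply_eq]
    obtain ⟨F, rfl⟩ := (LinearIsometryEquiv.ofSurjective T hT).surjective f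
    rw [LinearIsometryEquiv.symm_apply_apply]
    exact Subtype.ext (embed_sigma (hn j) (hg j) x F).symm
  -- `embed` unfolds to exactly this tower: the lines `ℂ conj g_j` in `L²(𝒪₁)`, then `L²(ℝ*, ·)`,
  -- the model of `L²(H_(1,0))`, `L²(K, ·)`, and `W₁⁻¹`.
  · exact isHilbertSum_comp_equiv wEquiv.symm (isHilbertSum_lpMap haarK
      (isHilbertSum_comp_equiv modelEquiv (isHilbertSum_lpMap haarR (isHilbertSum_star g))))
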